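/- \textbf{Setting.} Let $d\ge 1$, let $M\cong\mathbb Z^{d+1}$ be a lattice with dual lattice $N$, and let $\Delta\subset M_{\mathbb R}$ be a reflexive polytope (a lattice polytope with $0$ in its interior whose dual $\{n:\langle m,n\rangle\le 1\ \forall m\in\Delta\}$ is a lattice polytope). Let $h:\Delta\cap M\to\mathbb Z$ satisfy $h(0)=0$ and $h(m)>0$ for $m\ne 0$, and put $$\Delta_h^\vee=\{n\in N_{\mathbb R}:\langle m,n\rangle\le h(m)\ \text{for all } m\in\Delta\cap M\},\qquad \tau_m=\{n\in\Delta_h^\vee:\langle m,n\rangle=h(m)\}.$$ Let $A=\partial\Delta$, $B=\partial\Delta_h^\vee$; let $\sigma^\circ$ be the relative interior of a facet $\sigma$, $B^\circ$ the union of the relative interiors of the facets of $\Delta_h^\vee$, and $B_{d-1}=B\setminus B^\circ$. For $m\in A\cap M$, let $\mathrm{St}(m)$ be the union of the closed proper faces of $\Delta$ containing $m$. For a facet $\sigma$ of $\Delta$ (respectively $\tau$ of $\Delta_h^\vee$), let $n_\sigma\in N$ (respectively $m_\tau\in M$) be its primitive outward normal; choose generators $m_1,\dots,m_d$ of $n_\sigma^\perp\cap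 M$ and put $\beta_\sigma(n)=(\langle m_1,n\rangle,\dots,\langle m_d,n\rangle)$. This map is one-to-one on $\bigcup_{m\in\sigma\cap M}\tau_m$. Let $\mu_M$ be the measure on $A$ which on each $\sigma^\circ$ is Lebesgue measure in the coordinates $x$ of $p+\sum x_im_i$ ($p\in\sigma$) and which does not charge $A\setminus\bigcup_\sigma\sigma^\circ$. Let $\mathcal P(\Delta)$ be the set of convex $\Psi:N_{\mathbb R}\to\mathbb R$ with $\sup_{n}|\Psi(n)-\max_{m\in\Delta\cap M}\langle m,n\rangle|<\infty$. For continuous $\Psi$ on $B$ and $\Phi$ on $A$ put $\Psi^c(m)=\sup_{n\in B}(\langle m,n\rangle-\Psi(n))$ and $\Phi^c(n)=\sup_{m\in A}(\langle m,n\rangle-\Phi(m))$; $\Psi$ is $c$-convex if $(\Psi^c)^c=\Psi$ on $B$. For $m\in A$ let $\partial^c\Phi(m)=\{n\in B:\Phi(m')\ge\Phi(m)+\langle m'-m,n\rangle\ \forall m'\in A\}$, and $\partial^c\Phi(E)=\bigcup_{m\in E}\partial^c\Phi(m)$. Let $\nu$ be a positive Borel measure on $B$ of total mass $\mu_M(A)$.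 An optimal transport plan is a coupling $\gamma$ of $\mu_M$ and $\nu$ minimizing $-\int\langle m,n\rangle\,d\gamma$. A Kantorovich potential of $\nu$ is a $\Psi\in\mathcal P(\Delta)$ whose restriction to $B$ is $c$-convex and maximizes $J(\Psi)=-\int_A\Psi^c\,d\mu_M-\int_B\Psi\,d\nu$ among all $c$-convex functions. For $\Psi\in\mathcal P(\Delta)$ and each facet $\sigma$ of $\Delta$ put $$U_{\sigma,\Psi}=B\setminus\partial^c\Psi^c(A\setminus\sigma^\circ),\qquad \Sigma_\Psi=B_{d-1}\setminus\bigcup_\sigma U_{\sigma,\Psi}.$$ For $U\subset B$ and a facet $\sigma$ such that $\beta_\sigma$ is one-to-one on $U$, write $\mathrm{MA}(f|_U)=\nu|_U$ in the chart $\beta_\sigma$ if, for every Borel set $E\subset U$, $\nu(E)$ equals the Lebesgue measure of $$\bigcup_{n\in E}\{x\in\mathbb R^d: f(n')\ge f(n)+\langle x,\beta_\sigma(n')-\beta_\sigma(n)\rangle\ \forall n'\in U\}.$$ We say that $\Psi\in\mathcal P(\Delta)$ \emph{solves the extended Monge--Amp\`ere equation on $B\setminus\Sigma_\Psi$} if (a)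 $\mathrm{MA}(\Psi|_{\tau^\circ})=\nu|_{\tau^\circ}$ in the chart $\beta_\sigma$, for all facets $\tau$ of $\Delta_h^\vee$ and $\sigma$ of $\Delta$ with $m_\tau\in\sigma$; and (b) $\mathrm{MA}((\Psi-m)|_{U_{\sigma,\Psi}})=\nu|_{U_{\sigma,\Psi}}$ in the chart $\beta_\sigma$, for every facet $\sigma$ of $\Delta$ and every $m\in\sigma$. \textbf{Theorem.} For every $\Psi\in\mathcal P(\Delta)$ the sets $U_{\sigma,\Psi}$ are pairwise disjoint, open in $B$, and $U_{\sigma,\Psi}\subset\bigcup_{m\in\sigma\cap M}\tau_m$. Moreover: (1) If there is an optimal transport plan from $\mu_M$ to $\nu$ supported on $\bigcup_{m\in A\cap M}\mathrm{St}(m)\times\tau_m$, then $\nu$ has a Kantorovich potential, and every Kantorovich potential $\Psi$ of $\nu$ solves the extended Monge--Amp\`ere equation on $B\setminus\Sigma_\Psi$. (2) If $\Psi\in\mathcal P(\Delta)$ solves the extended Monge--Amp\`ere equation on $B\setminus\Sigma_\Psi$ and $\nu(\Sigma_\Psi)=0$, then there is an optimal transport plan from $\mu_M$ to $\nu$ supported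 on $\bigcup_{m\in A\cap M}\mathrm{St}(m)\times\tau_m$. (3) If $\Psi,\Psi'\in\mathcal P(\Delta)$ solve the extended Monge--Amp\`ere equation on $B\setminus\Sigma_\Psi$ and on $B\setminus\Sigma_{\Psi'}$, respectively, and $\nu(\Sigma_\Psi)=\nu(\Sigma_{\Psi'})=0$, then $\Sigma_\Psi=\Sigma_{\Psi'}$ and $\Psi-\Psi'$ is constant on $B$. -/

import Mathlib

open MeasureTheory Set

noncomputable section

namespace ReflexiveMA

/-- A lattice of rank `d + 1`. It serves both as `M` and as its dual `N`, which are paired by the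
dot product. -/
abbrev Lat (d : ℕ) : Type := Fin (d + 1) → ℤ

/-- The real vector space `M ⊗ ℝ`, respectively `N ⊗ ℝ`. -/
abbrev Vec (d : ℕ) : Type := Fin (d + 1) → ℝ

variable {d : ℕ}

/-- The inclusion of the lattice into the real vector space. -/
def toVec (u : Lat d) : Vec d := fun i => (u i : ℝ)

/-! ### Polytopes, faces and facets -/

/-- Convex hulls of finite sets of lattice points. -/
def IsLatticePolytope (P : Set (Vec d)) : Prop :=
  ∃ S : Finset (Lat d), P = convexHull ℝ (toVec '' (S : Set (Lat d)))

/-- The dual `{n | ⟨m, n⟩ ≤ 1 for all m ∈ P}`. -/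
def dualPolytope (P : Set (Vec d)) : Set (Vec d) := {n | ∀ m ∈ P, dotProduct m n ≤ 1}

/-- A reflexive polytope: a lattice polytope with the origin in its interior whose dual is a
lattice polytope. -/
structure IsReflexive (P : Set (Vec d)) : Prop where
  isLatticePolytope : IsLatticePolytope P
  zero_mem_interior : (0 : Vec d) ∈ interior P
  dual_isLatticePolytope : IsLatticePolytope (dualPolytope P)

/-- The closed face of `P` on which the linear functional `u` attains its maximum over `P`. -/
def face (P : Set (Vec d)) (u : Vec d) : Set (Vec d) :=
  {x ∈ P | ∀ y ∈ P, dotProduct u y ≤ dotProduct u x}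

/-- Lattice vectors that are not a proper multiple of a lattice vector. -/
def IsPrimitive (u : Lat d) : Prop := ∀ (k : ℤ) (w : Lat d), u = k • w → IsUnit k

theorem IsPrimitive.ne_zero {u : Lat d} (hu : IsPrimitive u) : u ≠ 0 := by
  rintro rfl
  have h2 := hu 2 0 (by simp)
  rw [Int.isUnit_iff] at h2
  omega

/-- A facet of a rational polytope in dimension `d + 1` is a nonempty face of dimension `d`. It is
encoded by its primitive outward normal, which determines it and is determined by it. -/
structure Facet (P : Set (Vec d)) where
  /-- the primitive outward normal -/
  normal : Lat d
  primitive : IsPrimitive normal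
  nonempty : (face P (toVec normal)).Nonempty
  finrank_eq : Module.finrank ℝ (vectorSpan ℝ (face P (toVec normal))) = d

/-- The closed facet as a set. -/
def Facet.carrier {P : Set (Vec d)} (σ : Facet P) : Set (Vec d) := face P (toVec σ.normal)

/-- The relative interior of a facet. -/
def Facet.relint {P : Set (Vec d)} (σ : Facet P) : Set (Vec d) := intrinsicInterior ℝ σ.carrier

/-- The union of the relative interiors of the facets of `P`. -/
def openFacets (P : Set (Vec d)) : Set (Vec d) := ⋃ σ : Facet P, σ.relint

/-- The closed star of `m` in the boundary of `P`: the union of all closed proper faces that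
contain `m`. -/
def closedStar (P : Set (Vec d)) (m : Vec d) : Set (Vec d) :=
  {x | ∃ u : Vec d, u ≠ 0 ∧ m ∈ face P u ∧ x ∈ face P u}

/-! ### Height functions and the polytope `Δ_h^∨` -/

/-- `h(0) = 0` and `h(m) > 0` for all other lattice points `m` of `Δ`. The values of `h` at lattice
points outside `Δ` are never used. -/
def IsHeight (Δ : Set (Vec d)) (h : Lat d → ℤ) : Prop :=
  h 0 = 0 ∧ ∀ m : Lat d, toVec m ∈ Δ → m ≠ 0 → 0 < h m

/-- `Δ_h^∨ = {n | ⟨m, n⟩ ≤ h(m) for all lattice points m of Δ}`. -/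
def dualH (Δ : Set (Vec d)) (h : Lat d → ℤ) : Set (Vec d) :=
  {n | ∀ m : Lat d, toVec m ∈ Δ → dotProduct (toVec m) n ≤ (h m : ℝ)}

/-- The boundary `A` of `Δ`. -/
def bdA (Δ : Set (Vec d)) : Set (Vec d) := frontier Δ

/-- The boundary `B` of `Δ_h^∨`. -/
def bdB (Δ : Set (Vec d)) (h : Lat d → ℤ) : Set (Vec d) := frontier (dualH Δ h)

/-- The face `τ_m` of `Δ_h^∨` dual to the lattice point `m`. -/
def dualFace (Δ : Set (Vec d)) (h : Lat d → ℤ) (m : Lat d) : Set (Vec d) :=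
  {n ∈ dualH Δ h | dotProduct (toVec m) n = (h m : ℝ)}

/-- The union of `St(m) × τ_m` over all lattice points `m` of `A`. -/
def stableSet (Δ : Set (Vec d)) (h : Lat d → ℤ) : Set (Vec d × Vec d) :=
  ⋃ m ∈ {m : Lat d | toVec m ∈ bdA Δ}, closedStar Δ (toVec m) ×ˢ dualFace Δ h m

/-! ### Integral affine coordinates and the measure on `A` -/

/-- Pairing with `u` as a linear functional on the lattice. -/
def pairing (u : Lat d) : Lat d →ₗ[ℤ] ℤ where
  toFun m := dotProduct m u
  map_add' x y := add_dotProduct x y u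
  map_smul' c x := smul_dotProduct c x u

/-- The lattice `u^⊥` of all lattice points that pair to zero with `u`. -/
def orthLattice (u : Lat d) : Submodule ℤ (Lat d) := LinearMap.ker (pairing u)

theorem finrank_orthLattice {u : Lat d} (hu : u ≠ 0) :
    Module.finrank ℤ (orthLattice u) = d := by
  have h1 := Submodule.finrank_quotient_add_finrank (LinearMap.ker (pairing u))
  rw [(pairing u).quotKerEquivRange.finrank_eq] at h1
  have hne : LinearMap.range (pairing u) ≠ ⊥ := by
    intro hbot
    rw [LinearMap.range_eq_bot] at hbot
    have h2 : pairing u u = 0 := by rw [hbot]; rfl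
    exact hu (dotProduct_self_eq_zero.mp h2)
  have h3 : Module.finrank ℤ (LinearMap.range (pairing u)) = 1 := by
    apply le_antisymm
    · simpa using Submodule.finrank_le (LinearMap.range (pairing u))
    · rw [Nat.one_le_iff_ne_zero]
      intro h0
      exact hne (Submodule.finrank_eq_zero.mp h0)
  have h4 : Module.finrank ℤ (Lat d) = d + 1 := by simp
  have h5 : Module.finrank ℤ (LinearMap.ker (pairing u)) = d := by omega
  exact h5

/-- Generators `m_1, …, m_d` of the lattice `n_σ^⊥`, for a facet `σ` with normal `n_σ`. -/
def Facet.basis {P : Set (Vec d)} (σ : Facet P) : Module.Basis (Fin d) ℤ (orthLattice σ.normal) :=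
  Module.finBasisOfFinrankEq ℤ (orthLattice σ.normal) (finrank_orthLattice σ.primitive.ne_zero)

/-- The coordinate map `β_σ(n) = (⟨m_1, n⟩, …, ⟨m_d, n⟩)`. -/
def Facet.chart {P : Set (Vec d)} (σ : Facet P) (n : Vec d) : Fin d → ℝ :=
  fun i => dotProduct (toVec (σ.basis i : Lat d)) n

/-- An integral affine parametrization `x ↦ p + ∑ x_i m_i` of the affine span of `σ`, where `p` is
a point of `σ`. -/
def Facet.param {P : Set (Vec d)} (σ : Facet P) (x : Fin d → ℝ) : Vec d :=
  σ.nonempty.some + ∑ i, x i • toVec (σ.basis i : Lat d)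

/-- The measure `μ_M`: on each open facet, Lebesgue measure in integral affine coordinates. It does
not depend on the choice of generators and base points. -/
def muM (Δ : Set (Vec d)) : Measure (Vec d) :=
  Measure.sum fun σ : Facet Δ => ((volume : Measure (Fin d → ℝ)).map σ.param).restrict σ.relint

/-! ### Potentials, `c`-transforms and `c`-gradients -/

/-- The space `𝒫(Δ)`: convex functions at bounded distance from the support function of `Δ`. -/
def InP (Δ : Set (Vec d)) (Ψ : Vec d → ℝ) : Prop :=
  ConvexOn ℝ univ Ψ ∧
    ∃ C : ℝ, ∀ n, |Ψ n - ⨆ m : {m : Lat d // toVec m ∈ Δ}, dotProduct (toVec m.1) n| ≤ C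

/-- `Ψ^c(m) = sup_{n ∈ B} ⟨m, n⟩ - Ψ(n)`. -/
def cTransB (Δ : Set (Vec d)) (h : Lat d → ℤ) (Ψ : Vec d → ℝ) (m : Vec d) : ℝ :=
  ⨆ n : bdB Δ h, (dotProduct m n.1 - Ψ n.1)

/-- `Φ^c(n) = sup_{m ∈ A} ⟨m, n⟩ - Φ(m)`. -/
def cTransA (Δ : Set (Vec d)) (Φ : Vec d → ℝ) (n : Vec d) : ℝ :=
  ⨆ m : bdA Δ, (dotProduct m.1 n - Φ m.1)

/-- Continuous functions on `B` (values outside `B` play no role) with `(Ψ^c)^c = Ψ` on `B`. -/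
def IsCConvex (Δ : Set (Vec d)) (h : Lat d → ℤ) (Ψ : Vec d → ℝ) : Prop :=
  ContinuousOn Ψ (bdB Δ h) ∧ ∀ n ∈ bdB Δ h, cTransA Δ (cTransB Δ h Ψ) n = Ψ n

/-- The `c`-gradient of a function on `A` at `m ∈ A`. -/
def cGradA (Δ : Set (Vec d)) (h : Lat d → ℤ) (Φ : Vec d → ℝ) (m : Vec d) : Set (Vec d) :=
  {n ∈ bdB Δ h | ∀ m' ∈ bdA Δ, Φ m + dotProduct (m' - m) n ≤ Φ m'}

/-! ### Optimal transport -/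

/-- Transport plans between `μ_M` and `ν`. -/
def IsPlan (Δ : Set (Vec d)) (ν : Measure (Vec d)) (γ : Measure (Vec d × Vec d)) : Prop :=
  γ.map Prod.fst = muM Δ ∧ γ.map Prod.snd = ν

/-- The transport cost for the cost function `-⟨m, n⟩`. -/
def cost (γ : Measure (Vec d × Vec d)) : ℝ := ∫ p, -dotProduct p.1 p.2 ∂γ

/-- Transport plans of minimal cost. -/
def IsOptimalPlan (Δ : Set (Vec d)) (ν : Measure (Vec d)) (γ : Measure (Vec d × Vec d)) : Prop :=
  IsPlan Δ ν γ ∧ ∀ γ', IsPlan Δ ν γ' → cost γ ≤ cost γ'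

/-- There is an optimal transport plan supported on the union of the sets `St(m) × τ_m`. -/
def HasStablePlan (Δ : Set (Vec d)) (h : Lat d → ℤ) (ν : Measure (Vec d)) : Prop :=
  ∃ γ, IsOptimalPlan Δ ν γ ∧ γ (stableSet Δ h)ᶜ = 0

/-- The dual functional `J(Ψ) = -∫_A Ψ^c dμ_M - ∫_B Ψ dν`. -/
def dualJ (Δ : Set (Vec d)) (h : Lat d → ℤ) (ν : Measure (Vec d)) (Ψ : Vec d → ℝ) : ℝ :=
  -(∫ m in bdA Δ, cTransB Δ h Ψ m ∂(muM Δ)) - ∫ n in bdB Δ h, Ψ n ∂ν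

/-- Kantorovich potentials of `ν`: elements of `𝒫(Δ)` whose restriction to `B` is `c`-convex and
maximizes `J` among all `c`-convex functions. -/
def IsKantorovichPotential (Δ : Set (Vec d)) (h : Lat d → ℤ) (ν : Measure (Vec d))
    (Ψ : Vec d → ℝ) : Prop :=
  InP Δ Ψ ∧ IsCConvex Δ h Ψ ∧ ∀ Ψ', IsCConvex Δ h Ψ' → dualJ Δ h ν Ψ' ≤ dualJ Δ h ν Ψ

/-! ### Charts and the Monge-Ampère equation -/

/-- The union of the faces `τ_m` over the lattice points `m` of `σ`, where `β_σ` is one-to-one. -/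
def chartDomain (Δ : Set (Vec d)) (h : Lat d → ℤ) (σ : Facet Δ) : Set (Vec d) :=
  ⋃ m ∈ {m : Lat d | toVec m ∈ σ.carrier}, dualFace Δ h m

/-- Pairwise disjoint, relatively open subsets `U σ` of `B`, each contained in the domain where
`β_σ` is one-to-one. -/
structure IsChartCollection (Δ : Set (Vec d)) (h : Lat d → ℤ) (U : Facet Δ → Set (Vec d)) :
    Prop where
  subset_domain : ∀ σ, U σ ⊆ chartDomain Δ h σ
  isOpen : ∀ σ, ∃ O : Set (Vec d), IsOpen O ∧ U σ = O ∩ bdB Δ h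
  disjoint : Pairwise fun σ σ' => Disjoint (U σ) (U σ')

/-- The singular set of a collection of charts: the complement in `B` of the open facets and of the
charts. -/
def singularSet (Δ : Set (Vec d)) (h : Lat d → ℤ) (U : Facet Δ → Set (Vec d)) : Set (Vec d) :=
  (bdB Δ h \ openFacets (dualH Δ h)) \ ⋃ σ, U σ

/-- The subgradient at `β(n)` of the function `f ∘ (β|_U)⁻¹` on `β(U)`, for a coordinate map `β`
that is one-to-one on `U`, and `n ∈ U`. -/
def subgradient (U : Set (Vec d)) (β : Vec d → Fin d → ℝ) (f : Vec d → ℝ) (n : Vec d) :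
    Set (Fin d → ℝ) :=
  {x | ∀ n' ∈ U, f n + dotProduct x (β n' - β n) ≤ f n'}

/-- `MA(f|_U) = ν|_U` in the sense of Aleksandrov, in the coordinates `β` on `U`: for all Borel
sets `E ⊆ U`, the Lebesgue measure of the set of all subgradients at points of `E` is `ν(E)`. -/
def SolvesMAOn (ν : Measure (Vec d)) (U : Set (Vec d)) (β : Vec d → Fin d → ℝ)
    (f : Vec d → ℝ) : Prop :=
  ∀ E : Set (Vec d), MeasurableSet E → E ⊆ U → volume (⋃ n ∈ E, subgradient U β f n) = ν E

/-- The extended Monge-Ampère equation for the charts `U`: the equation for `Ψ` on the relative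
interior of every facet `τ` of `Δ_h^∨`, in each of the coordinates `β_σ` with `m_τ ∈ σ`, and the
equation for `Ψ - m` on `U σ`, in the coordinates `β_σ`, for every facet `σ` of `Δ` and every
`m ∈ σ`. -/
structure SolvesExtendedMA (Δ : Set (Vec d)) (h : Lat d → ℤ) (ν : Measure (Vec d))
    (U : Facet Δ → Set (Vec d)) (Ψ : Vec d → ℝ) : Prop where
  mem_P : InP Δ Ψ
  on_facets : ∀ (τ : Facet (dualH Δ h)) (σ : Facet Δ), toVec τ.normal ∈ σ.carrier →
    SolvesMAOn ν τ.relint σ.chart Ψ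
  on_charts : ∀ (σ : Facet Δ), ∀ m ∈ σ.carrier,
    SolvesMAOn ν (U σ) σ.chart fun n => Ψ n - dotProduct m n

/-- The charts `U_{σ,Ψ} = B ∖ ∂^cΨ^c(A ∖ σ°)`. -/
def chartSet (Δ : Set (Vec d)) (h : Lat d → ℤ) (Ψ : Vec d → ℝ) (σ : Facet Δ) : Set (Vec d) :=
  bdB Δ h \ ⋃ m ∈ bdA Δ \ σ.relint, cGradA Δ h (cTransB Δ h Ψ) m

/-- The singular set `Σ_Ψ` of the charts `U_{σ,Ψ}`. -/
def sing (Δ : Set (Vec d)) (h : Lat d → ℤ) (Ψ : Vec d → ℝ) : Set (Vec d) :=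
  singularSet Δ h (chartSet Δ h Ψ)

end ReflexiveMA

end

open ReflexiveMA

namespace ReflexiveMA

open Filter Topology

section

variable {d : ℕ}

/-! ### Lattice polytopes and their duals -/

/-! Everything is read off from the contact set of `Ψ`: the pairs `(m, n)` in `A × B` with `Ψ^c(m) +
Ψ(n) = ⟨m, n⟩`, and its stable part, the intersection with the union of the `St(m) × τ_m`. For `E ⊆
B` let `stableImage E` be the set of points of `A` in stable contact with a point of `E`.

Reflexivity enters through one mechanism. `Δ` is cut out by inequalities `⟨·, s⟩ ≤ 1` with `s` a
lattice point of the dual, so a lattice point of `Δ` that pairs positively with `s` pairs to exactly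
one. If a slope is in contact with `n` and the lattice point `m` is active at `n`, then pushing the
slope along `m` preserves contact (`contact_add_smul`), and the facet through which it finally
leaves `Δ` contains `m` (`exists_exit`). This puts the charts `U_σ` inside the domain where `β_σ` is
injective, and it shows that every element of `𝒫(Δ)` is `c`-convex on `B`.

The core is `solvesExtendedMA_iff`: both families of Monge-Ampère equations say `μ_M(stableImage E)
= ν(E)`, for `E` inside an open facet or a chart. On a chart, all contact points lie in `σ°`, and a
local supporting slope is made global by convexity. On an open facet `τ°`, the restriction of `Ψ`
determines slopes only modulo `m_τ`; Hahn-Banach produces a full slope, and pushing it along `m_τ`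
lands it in `St(m_τ)`. The resulting projection from the hyperplane of `σ` to the facets around
`m_τ` is piecewise unimodular, so it preserves volume.

Over `σ°`, a stable partner `n` of `m` is determined by `β_σ(n)`, which is the derivative of `Ψ^c`
along `σ`. By Rademacher's theorem, almost every `m` therefore has at most one stable partner
(`ae_stableContact_unique`), so `E ↦ μ_M(stableImage E)` is additive on disjoint sets.

Kantorovich duality links this to transport. For a plan `γ`, the gap `cost γ - J(Ψ)` is the integral
of the nonnegative function `Ψ^c + Ψ - ⟨·,·⟩`, hence vanishes exactly when `γ` lives on the contact
set. For (1), strong duality puts the given stable optimal plan on the stable contact set, and its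
marginals give the equations. For (2), the open facets and charts have full `ν`-measure, so equality
of masses gives almost every `m` a stable partner; the graph of this partner map is an optimal plan.
For (3), the plan built from `Ψ` also lives on the contact set of `Ψ'`. By compactness and full
support of `μ_M`, the two transforms share a subgradient at every point of `A`, so they differ by a
constant on each facet, and by one constant since `A` is connected. Transforming back gives the
claim on `B`, and the equality of contact sets gives that of the singular sets. -/

theorem toVec_injective : Function.Injective (toVec : Lat d → Vec d) := by
  intro u v huv
  funext i
  have := congrFun huv i
  simpa [toVec] using this

@[simp] theorem toVec_zero : toVec (0 : Lat d) = 0 := by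
  funext i; simp [toVec]

theorem toVec_dotProduct (u v : Lat d) : toVec u ⬝ᵥ toVec v = ((u ⬝ᵥ v : ℤ) : ℝ) := by
  simp [toVec, dotProduct]

theorem toVec_smul (k : ℤ) (u : Lat d) : toVec (k • u) = (k : ℝ) • toVec u := by
  funext i; simp [toVec]

theorem toVec_sub (u v : Lat d) : toVec (u - v) = toVec u - toVec v := by
  funext i; simp [toVec]

@[fun_prop] theorem continuous_dotProduct_left (v : Vec d) : Continuous fun u : Vec d => u ⬝ᵥ v :=
  continuous_id.dotProduct continuous_const

@[fun_prop] theorem continuous_dotProduct_right (v : Vec d) :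
    Continuous fun u : Vec d => v ⬝ᵥ u :=
  continuous_const.dotProduct continuous_id

theorem dotProduct_self_pos_of_ne_zero {u : Vec d} (hu : u ≠ 0) : 0 < u ⬝ᵥ u :=
  lt_of_le_of_ne (Finset.sum_nonneg fun _ _ => mul_self_nonneg _)
    fun h => hu (dotProduct_self_eq_zero.1 h.symm)

theorem finite_lattice_of_isBounded {K : Set (Vec d)} (hK : Bornology.IsBounded K) :
    {u : Lat d | toVec u ∈ K}.Finite := by
  obtain ⟨R, hR⟩ := hK.exists_norm_le
  refine (Set.finite_Icc (fun _ => -⌈R⌉ : Lat d) (fun _ => ⌈R⌉)).subset ?_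
  intro u hu
  have h1 := hR _ hu
  have h2 : ∀ i, |(u i : ℝ)| ≤ R := fun i => (norm_le_pi_norm (toVec u) i).trans h1
  constructor <;> intro i
  · have := (abs_le.1 (h2 i)).1
    have h3 := Int.le_ceil R
    have : (-⌈R⌉ : ℝ) ≤ u i := by linarith
    exact_mod_cast this
  · have := (abs_le.1 (h2 i)).2
    have h3 := Int.le_ceil R
    have : (u i : ℝ) ≤ ⌈R⌉ := by linarith
    exact_mod_cast this

theorem IsLatticePolytope.isCompact {P : Set (Vec d)} (hP : IsLatticePolytope P) :
    IsCompact P := by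
  obtain ⟨S, rfl⟩ := hP
  exact (S.finite_toSet.image _).isCompact_convexHull ℝ

theorem IsLatticePolytope.convex {P : Set (Vec d)} (hP : IsLatticePolytope P) :
    Convex ℝ P := by
  obtain ⟨S, rfl⟩ := hP
  exact convex_convexHull ℝ _

/-- A linear functional on a lattice polytope is dominated by its value at a lattice point. -/
theorem IsLatticePolytope.exists_lattice_ge {P : Set (Vec d)} (hP : IsLatticePolytope P)
    (u : Vec d) {x : Vec d} (hx : x ∈ P) : ∃ v : Lat d, toVec v ∈ P ∧ u ⬝ᵥ x ≤ u ⬝ᵥ toVec v := by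
  obtain ⟨S, rfl⟩ := hP
  by_contra! hcon
  have h1 : convexHull ℝ (toVec '' (S : Set (Lat d))) ⊆ {y | u ⬝ᵥ y < u ⬝ᵥ x} := by
    refine convexHull_min ?_ ?_
    · rintro _ ⟨v, hv, rfl⟩
      exact hcon v (subset_convexHull ℝ _ ⟨v, hv, rfl⟩)
    · exact convex_halfSpace_lt ⟨dotProduct_add u, fun c y => dotProduct_smul c u y⟩ _
  exact lt_irrefl (u ⬝ᵥ x) (h1 hx)

/-- Continuous linear functionals are given by pairings. -/
theorem exists_eq_dotProduct (f : Vec d →L[ℝ] ℝ) : ∃ w : Vec d, ∀ x, f x = w ⬝ᵥ x := by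
  refine ⟨fun i => f (Pi.single i 1), fun x => ?_⟩
  conv_lhs => rw [pi_eq_sum_univ' x]
  simp only [map_sum, map_smul, dotProduct, smul_eq_mul]
  refine Finset.sum_congr rfl fun i _ => ?_
  rw [mul_comm]

/-- The lattice points of the dual polytope. -/
def dualLat (Δ : Set (Vec d)) : Set (Lat d) := {s | toVec s ∈ dualPolytope Δ}

/-! ### Reflexive polytopes: inequalities at height one, boundary, stars and exit points -/

section Reflexive

variable {Δ : Set (Vec d)}

namespace IsReflexive

theorem isCompact (hΔ : IsReflexive Δ) : IsCompact Δ := hΔ.isLatticePolytope.isCompact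

theorem isClosed (hΔ : IsReflexive Δ) : IsClosed Δ := hΔ.isCompact.isClosed

theorem convex (hΔ : IsReflexive Δ) : Convex ℝ Δ := hΔ.isLatticePolytope.convex

theorem zero_mem (hΔ : IsReflexive Δ) : (0 : Vec d) ∈ Δ := interior_subset hΔ.zero_mem_interior

theorem finite_dualLat (hΔ : IsReflexive Δ) : (dualLat Δ).Finite :=
  finite_lattice_of_isBounded hΔ.dual_isLatticePolytope.isCompact.isBounded

theorem finite_lattice (hΔ : IsReflexive Δ) : {m : Lat d | toVec m ∈ Δ}.Finite :=
  finite_lattice_of_isBounded hΔ.isCompact.isBounded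

/-- Bipolar theorem: a functional separating `m` from `Δ`, divided by its bound on `Δ` (positive
because `0 ∈ Δ`), lies in the dual and is too large at `m`. -/
theorem mem_iff_dual (hΔ : IsReflexive Δ) {m : Vec d} :
    m ∈ Δ ↔ ∀ n ∈ dualPolytope Δ, m ⬝ᵥ n ≤ 1 := by
  refine ⟨fun hm n hn => hn m hm, fun hm => ?_⟩
  by_contra hmn
  obtain ⟨f, u, hf, hu⟩ := geometric_hahn_banach_closed_point hΔ.convex hΔ.isClosed hmn
  obtain ⟨w, hw⟩ := exists_eq_dotProduct f
  have h0 : 0 < u := by simpa using hf 0 hΔ.zero_mem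
  have h1 := hm (u⁻¹ • w) (fun a ha => by
    rw [dotProduct_smul, smul_eq_mul, inv_mul_le_iff₀ h0, mul_one, dotProduct_comm, ← hw]
    exact (hf a ha).le)
  rw [dotProduct_smul, smul_eq_mul, inv_mul_le_iff₀ h0, mul_one, dotProduct_comm, ← hw] at h1
  linarith

/-- A linear functional on the dual is dominated by its value at a lattice point, the dual being a
lattice polytope. The finitely many integral inequalities obtained here are the working description
of `Δ`. -/
theorem mem_iff (hΔ : IsReflexive Δ) {m : Vec d} :
    m ∈ Δ ↔ ∀ s ∈ dualLat Δ, m ⬝ᵥ toVec s ≤ 1 := by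
  rw [hΔ.mem_iff_dual]
  refine ⟨fun hm s hs => hm _ hs, fun hm n hn => ?_⟩
  obtain ⟨v, hv, hle⟩ := hΔ.dual_isLatticePolytope.exists_lattice_ge m hn
  exact hle.trans (hm v hv)

theorem pairing_le (hΔ : IsReflexive Δ) {m : Vec d} (hm : m ∈ Δ) {s : Lat d}
    (hs : s ∈ dualLat Δ) : m ⬝ᵥ toVec s ≤ 1 := hΔ.mem_iff.1 hm s hs

/-- A lattice point pairing positively with `s` pairs to one. -/
theorem lattice_pairing_eq_one (hΔ : IsReflexive Δ) {m : Lat d} (hm : toVec m ∈ Δ) {s : Lat d}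
    (hs : s ∈ dualLat Δ) (hpos : 0 < toVec m ⬝ᵥ toVec s) : toVec m ⬝ᵥ toVec s = 1 := by
  have h1 := hΔ.pairing_le hm hs
  rw [toVec_dotProduct] at *
  have h2 : (m ⬝ᵥ s : ℤ) ≤ 1 := by exact_mod_cast h1
  have h3 : 0 < (m ⬝ᵥ s : ℤ) := by exact_mod_cast hpos
  have : (m ⬝ᵥ s : ℤ) = 1 := by omega
  rw [this]; simp

theorem ball_subset (hΔ : IsReflexive Δ) : ∃ ε > 0, Metric.ball (0 : Vec d) ε ⊆ Δ := by
  have := mem_interior_iff_mem_nhds.1 hΔ.zero_mem_interior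
  exact Metric.mem_nhds_iff.1 this

/-- Every nonzero functional is positive somewhere on a reflexive polytope. -/
theorem exists_pos (hΔ : IsReflexive Δ) {u : Vec d} (hu : u ≠ 0) : ∃ m ∈ Δ, 0 < u ⬝ᵥ m := by
  have h1 : ∀ᶠ t : ℝ in 𝓝 0, t • u ∈ Δ := by
    have : Tendsto (fun t : ℝ => t • u) (𝓝 0) (𝓝 ((0 : ℝ) • u)) :=
      (continuous_id.smul continuous_const).tendsto 0
    rw [zero_smul] at this
    exact this.eventually (mem_interior_iff_mem_nhds.1 hΔ.zero_mem_interior)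
  have h2 : ∀ᶠ t : ℝ in 𝓝[>] 0, t • u ∈ Δ := h1.filter_mono nhdsWithin_le_nhds
  obtain ⟨t, ht, ht0⟩ := (h2.and self_mem_nhdsWithin).exists
  refine ⟨t • u, ht, ?_⟩
  rw [dotProduct_smul]
  exact mul_pos ht0 (dotProduct_self_pos_of_ne_zero hu)

theorem mem_interior_of_forall_lt (hΔ : IsReflexive Δ) {m : Vec d}
    (hm : ∀ s ∈ dualLat Δ, m ⬝ᵥ toVec s < 1) : m ∈ interior Δ := by
  rw [mem_interior]
  refine ⟨⋂ s ∈ dualLat Δ, {m' | m' ⬝ᵥ toVec s < 1}, ?_, ?_, ?_⟩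
  · intro m' hm'
    simp only [mem_iInter] at hm'
    exact hΔ.mem_iff.2 fun s hs => (hm' s hs).le
  · exact hΔ.finite_dualLat.isOpen_biInter fun s _ =>
      isOpen_lt (by fun_prop) continuous_const
  · simpa using hm

theorem mem_bdA_iff (hΔ : IsReflexive Δ) {m : Vec d} :
    m ∈ bdA Δ ↔ m ∈ Δ ∧ ∃ s ∈ dualLat Δ, m ⬝ᵥ toVec s = 1 := by
  unfold bdA
  rw [hΔ.isClosed.frontier_eq]
  constructor
  · rintro ⟨h1, h2⟩
    refine ⟨h1, ?_⟩
    by_contra! hcon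
    exact h2 (hΔ.mem_interior_of_forall_lt fun s hs =>
      lt_of_le_of_ne (hΔ.pairing_le h1 hs) (hcon s hs))
  · rintro ⟨h1, s, hs, hs1⟩
    refine ⟨h1, fun h2 => ?_⟩
    have h3 : ∀ᶠ t : ℝ in 𝓝[>] 1, t • m ∈ Δ := by
      have : Tendsto (fun t : ℝ => t • m) (𝓝 1) (𝓝 ((1 : ℝ) • m)) :=
        (continuous_id.smul continuous_const).tendsto 1
      rw [one_smul] at this
      exact (this.eventually (mem_interior_iff_mem_nhds.1 h2)).filter_mono nhdsWithin_le_nhds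
    obtain ⟨t, ht, ht1⟩ := (h3.and self_mem_nhdsWithin).exists
    have h4 := hΔ.pairing_le ht hs
    rw [smul_dotProduct, hs1, smul_eq_mul, mul_one] at h4
    exact absurd h4 (not_le.2 ht1)

theorem bdA_subset (hΔ : IsReflexive Δ) : bdA Δ ⊆ Δ := hΔ.isClosed.frontier_subset

theorem isCompact_bdA (hΔ : IsReflexive Δ) : IsCompact (bdA Δ) :=
  hΔ.isCompact.of_isClosed_subset isClosed_frontier hΔ.bdA_subset

/-- Nonzero lattice points of a reflexive polytope lie on its boundary. -/
theorem lattice_mem_bdA (hΔ : IsReflexive Δ) {m : Lat d} (hm : toVec m ∈ Δ) (hm0 : m ≠ 0) :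
    toVec m ∈ bdA Δ := by
  have h0 : toVec m ≠ 0 := fun h => hm0 (toVec_injective (by simpa using h))
  rw [hΔ.mem_bdA_iff]
  refine ⟨hm, ?_⟩
  by_contra! hcon
  have h1 : ∀ s ∈ dualLat Δ, toVec m ⬝ᵥ toVec s ≤ 0 := by
    intro s hs
    by_contra! hpos
    exact hcon s hs (hΔ.lattice_pairing_eq_one hm hs hpos)
  obtain ⟨R, hR⟩ := hΔ.isCompact.isBounded.exists_norm_le
  have hR0 : 0 ≤ R := (norm_nonneg _).trans (hR _ hm)
  -- With all pairings nonpositive, the whole ray through `m` lies in `Δ`. The multiple chosen has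
  -- norm `R + 1`, beyond the bound `R`.
  have h2 : ((R + 1) / ‖toVec m‖) • toVec m ∈ Δ := by
    rw [hΔ.mem_iff]
    intro s hs
    rw [smul_dotProduct, smul_eq_mul]
    have : ((R + 1) / ‖toVec m‖) * (toVec m ⬝ᵥ toVec s) ≤ 0 :=
      mul_nonpos_of_nonneg_of_nonpos (by positivity) (h1 s hs)
    linarith
  have h3 := hR _ h2
  rw [norm_smul, norm_div, norm_norm, div_mul_cancel₀ _ (norm_ne_zero_iff.2 h0),
    Real.norm_of_nonneg (by linarith)] at h3
  linarith

theorem ne_zero_of_mem_bdA (hΔ : IsReflexive Δ) {m : Vec d} (hm : m ∈ bdA Δ) : m ≠ 0 := by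
  rintro rfl
  obtain ⟨_, s, _, hs⟩ := hΔ.mem_bdA_iff.1 hm
  simp at hs

/-- Real supporting functionals can be replaced by lattice ones. After rescaling to height one, the
functional pairs to 2 with `m + x`; some lattice point `s` of the dual does at least as well, and
since both pairings with `s` are at most 1, both are equal to 1. -/
theorem mem_closedStar_iff (hΔ : IsReflexive Δ) {m x : Vec d} :
    x ∈ closedStar Δ m ↔ m ∈ Δ ∧ x ∈ Δ ∧ ∃ s ∈ dualLat Δ, m ⬝ᵥ toVec s = 1 ∧
      x ⬝ᵥ toVec s = 1 := by
  constructor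
  · rintro ⟨u, hu, ⟨hm, hmu⟩, ⟨hx, hxu⟩⟩
    refine ⟨hm, hx, ?_⟩
    obtain ⟨y, hy, hpos⟩ := hΔ.exists_pos hu
    have hc : 0 < u ⬝ᵥ m := hpos.trans_le (hmu y hy)
    have hxm : u ⬝ᵥ x = u ⬝ᵥ m := le_antisymm (hmu x hx) (hxu m hm)
    have hd : (u ⬝ᵥ m)⁻¹ • u ∈ dualPolytope Δ := by
      intro z hz
      rw [dotProduct_smul, smul_eq_mul, inv_mul_le_iff₀ hc, mul_one, dotProduct_comm]
      exact hmu z hz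
    obtain ⟨s, hs, hle⟩ := hΔ.dual_isLatticePolytope.exists_lattice_ge (m + x) hd
    have h1 : (m + x) ⬝ᵥ ((u ⬝ᵥ m)⁻¹ • u) = 2 := by
      rw [dotProduct_smul, add_dotProduct, dotProduct_comm m, dotProduct_comm x, hxm, smul_eq_mul]
      field_simp
      norm_num
    rw [h1, add_dotProduct] at hle
    have h2 := hΔ.pairing_le hm hs
    have h3 := hΔ.pairing_le hx hs
    exact ⟨s, hs, by linarith, by linarith⟩
  · rintro ⟨hm, hx, s, hs, hms, hxs⟩
    refine ⟨toVec s, ?_, ⟨hm, fun y hy => ?_⟩, ⟨hx, fun y hy => ?_⟩⟩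
    · rintro h0
      simp [h0] at hms
    · rw [dotProduct_comm, dotProduct_comm (toVec s), hms]
      exact hΔ.pairing_le hy hs
    · rw [dotProduct_comm, dotProduct_comm (toVec s), hxs]
      exact hΔ.pairing_le hy hs

/-- Moving inside the polytope in a direction `v ≠ 0` one reaches a boundary point at which some
facet inequality blocks any further move. -/
theorem exists_exit (hΔ : IsReflexive Δ) {m v : Vec d} (hm : m ∈ Δ) (hv : v ≠ 0) :
    ∃ t : ℝ, 0 ≤ t ∧ m + t • v ∈ bdA Δ ∧ ∃ s ∈ dualLat Δ, (m + t • v) ⬝ᵥ toVec s = 1 ∧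
      0 < v ⬝ᵥ toVec s := by
  have hcl : IsClosed {t : ℝ | m + t • v ∈ Δ} :=
    hΔ.isClosed.preimage (by fun_prop)
  obtain ⟨R, hR⟩ := hΔ.isCompact.isBounded.exists_norm_le
  have hv0 : 0 < ‖v‖ := norm_pos_iff.2 hv
  have hbd : BddAbove {t : ℝ | m + t • v ∈ Δ} := by
    refine ⟨(R + ‖m‖) / ‖v‖, fun t ht => ?_⟩
    rw [le_div_iff₀ hv0]
    have h1 := hR _ ht
    have h2 : ‖t • v‖ ≤ ‖m + t • v‖ + ‖m‖ := by
      have := norm_sub_le (m + t • v) m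
      simpa using this
    rw [norm_smul] at h2
    have := mul_le_mul_of_nonneg_right (le_abs_self t) hv0.le
    rw [Real.norm_eq_abs] at h2
    linarith
  have h0 : (0 : ℝ) ∈ {t : ℝ | m + t • v ∈ Δ} := by simpa using hm
  set T := sSup {t : ℝ | m + t • v ∈ Δ} with hT
  have hTm : m + T • v ∈ Δ := hcl.csSup_mem ⟨0, h0⟩ hbd
  -- If no active inequality increased along `v`, all of them would still hold slightly beyond the
  -- last admissible parameter `T`.
  have key : ∃ s ∈ dualLat Δ, (m + T • v) ⬝ᵥ toVec s = 1 ∧ 0 < v ⬝ᵥ toVec s := by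
    by_contra! hcon
    have h3 : ∀ᶠ t in 𝓝[>] T, ∀ s ∈ dualLat Δ, (m + t • v) ⬝ᵥ toVec s ≤ 1 := by
      rw [Filter.eventually_all_finite hΔ.finite_dualLat]
      intro s hs
      rcases (hΔ.pairing_le hTm hs).lt_or_eq with hlt | heq
      · have hc : Continuous fun t : ℝ => (m + t • v) ⬝ᵥ toVec s := by fun_prop
        have := (hc.tendsto T).eventually (gt_mem_nhds hlt)
        exact (this.filter_mono nhdsWithin_le_nhds).mono fun t ht => le_of_lt ht
      · filter_upwards [self_mem_nhdsWithin] with t ht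
        have h4 := hcon s hs heq
        rw [add_dotProduct, smul_dotProduct, smul_eq_mul] at heq ⊢
        have : (t - T) * (v ⬝ᵥ toVec s) ≤ 0 :=
          mul_nonpos_of_nonneg_of_nonpos (sub_nonneg.2 (le_of_lt ht)) h4
        linarith
    obtain ⟨t, ht, htT⟩ := (h3.and self_mem_nhdsWithin).exists
    exact absurd (le_csSup hbd (hΔ.mem_iff.2 ht : m + t • v ∈ Δ)) (not_le.2 htT)
  obtain ⟨s, hs, hs1, hs2⟩ := key
  exact ⟨T, le_csSup hbd h0, hΔ.mem_bdA_iff.2 ⟨hTm, s, hs, hs1⟩, s, hs, hs1, hs2⟩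

end IsReflexive

end Reflexive

end

section

variable {d : ℕ}

/-! ### Facets -/

/-- Pairing with `u` as a linear functional. -/
def dotLin (u : Vec d) : Vec d →ₗ[ℝ] ℝ where
  toFun x := u ⬝ᵥ x
  map_add' x y := dotProduct_add u x y
  map_smul' c x := dotProduct_smul c u x

@[simp] theorem dotLin_apply (u x : Vec d) : dotLin u x = u ⬝ᵥ x := rfl

theorem finrank_ker_dotLin {u : Vec d} (hu : u ≠ 0) :
    Module.finrank ℝ (LinearMap.ker (dotLin u)) = d := by
  have h1 := LinearMap.finrank_range_add_finrank_ker (dotLin u)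
  have h2 : LinearMap.range (dotLin u) = ⊤ := by
    refine LinearMap.range_eq_top.2 fun r => ⟨(r / (u ⬝ᵥ u)) • u, ?_⟩
    rw [dotLin_apply, dotProduct_smul, smul_eq_mul,
      div_mul_cancel₀ _ (dotProduct_self_pos_of_ne_zero hu).ne']
  rw [h2, finrank_top] at h1
  simp at h1
  omega

/-- The component of `w` orthogonal to `u` is killed by `u`, hence by `w`, hence is orthogonal to
itself. -/
theorem eq_smul_of_ker_le {u w : Vec d} (hu : u ≠ 0) (h : ∀ v, u ⬝ᵥ v = 0 → w ⬝ᵥ v = 0) :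
    ∃ t : ℝ, w = t • u := by
  have hpos := dotProduct_self_pos_of_ne_zero hu
  set t := (u ⬝ᵥ w) / (u ⬝ᵥ u) with ht
  have h1 : u ⬝ᵥ (w - t • u) = 0 := by
    rw [dotProduct_sub, dotProduct_smul, smul_eq_mul, ht, div_mul_cancel₀ _ hpos.ne', sub_self]
  have h2 := h _ h1
  have h3 : (w - t • u) ⬝ᵥ (w - t • u) = 0 := by
    rw [sub_dotProduct, h2, smul_dotProduct, h1, smul_zero, sub_zero]
  exact ⟨t, sub_eq_zero.1 (dotProduct_self_eq_zero.1 h3)⟩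

theorem toVec_ne_zero {u : Lat d} (hu : u ≠ 0) : toVec u ≠ 0 := fun h =>
  hu (toVec_injective (by simpa using h))

namespace Facet

variable {P : Set (Vec d)} (σ : Facet P)

theorem toVec_normal_ne_zero : toVec σ.normal ≠ 0 := toVec_ne_zero σ.primitive.ne_zero

theorem pairing_eq {x y : Vec d} (hx : x ∈ σ.carrier) (hy : y ∈ σ.carrier) :
    toVec σ.normal ⬝ᵥ x = toVec σ.normal ⬝ᵥ y :=
  le_antisymm (hy.2 x hx.1) (hx.2 y hy.1)

theorem vectorSpan_eq : vectorSpan ℝ σ.carrier = LinearMap.ker (dotLin (toVec σ.normal)) := by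
  refine Submodule.eq_of_le_of_finrank_eq ?_ ?_
  · rw [vectorSpan_def, Submodule.span_le]
    rintro _ ⟨x, hx, y, hy, rfl⟩
    simp only [SetLike.mem_coe, LinearMap.mem_ker, dotLin_apply, vsub_eq_sub, dotProduct_sub]
    rw [σ.pairing_eq hx hy, sub_self]
  · rw [finrank_ker_dotLin σ.toVec_normal_ne_zero]
    exact σ.finrank_eq

theorem mem_affineSpan_iff {x y : Vec d} (hx : x ∈ σ.carrier) :
    y ∈ affineSpan ℝ σ.carrier ↔ toVec σ.normal ⬝ᵥ y = toVec σ.normal ⬝ᵥ x := by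
  have h1 : y -ᵥ x ∈ (affineSpan ℝ σ.carrier).direction ↔ y ∈ affineSpan ℝ σ.carrier :=
    AffineSubspace.vsub_right_mem_direction_iff_mem (subset_affineSpan ℝ _ hx) y
  rw [← h1, direction_affineSpan, vectorSpan_eq]
  simp only [LinearMap.mem_ker, dotLin_apply, vsub_eq_sub, dotProduct_sub, sub_eq_zero]

/-- The affine span of a facet is the whole level hyperplane of its normal, so the intrinsic
interior can be expressed with ambient neighbourhoods instead of the subspace topology of the span.
-/
theorem mem_relint_iff {x : Vec d} : x ∈ σ.relint ↔
    x ∈ σ.carrier ∧ ∀ᶠ y in 𝓝 x, toVec σ.normal ⬝ᵥ y = toVec σ.normal ⬝ᵥ x → y ∈ σ.carrier := by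
  unfold relint
  rw [mem_intrinsicInterior]
  constructor
  · rintro ⟨y, hy, rfl⟩
    have hy' : y ∈ Subtype.val ⁻¹' σ.carrier := interior_subset hy
    have hyc : (y : Vec d) ∈ σ.carrier := hy'
    refine ⟨hyc, ?_⟩
    rw [mem_interior_iff_mem_nhds, nhds_subtype_eq_comap, mem_comap] at hy
    obtain ⟨t, ht, hts⟩ := hy
    filter_upwards [ht] with z hz hzn
    have hza : z ∈ affineSpan ℝ σ.carrier := (σ.mem_affineSpan_iff hyc).2 hzn
    exact @hts ⟨z, hza⟩ hz
  · rintro ⟨hx, hev⟩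
    refine ⟨⟨x, subset_affineSpan ℝ _ hx⟩, ?_, rfl⟩
    rw [mem_interior_iff_mem_nhds, nhds_subtype_eq_comap, mem_comap]
    exact ⟨_, hev, fun z hz => hz ((σ.mem_affineSpan_iff hx).1 z.2)⟩

theorem relint_subset : σ.relint ⊆ σ.carrier := fun _ hx => (σ.mem_relint_iff.1 hx).1

/-- A functional attaining its maximum over a facet at a relative interior point is a multiple of
the normal. -/
theorem eq_smul_normal {x w : Vec d} (hx : x ∈ σ.relint)
    (hw : ∀ y ∈ σ.carrier, w ⬝ᵥ y ≤ w ⬝ᵥ x) : ∃ t : ℝ, w = t • toVec σ.normal := by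
  refine eq_smul_of_ker_le σ.toVec_normal_ne_zero ?_
  have key : ∀ v, toVec σ.normal ⬝ᵥ v = 0 → w ⬝ᵥ v ≤ 0 := by
    intro v hv
    have h1 : Tendsto (fun t : ℝ => x + t • v) (𝓝 0) (𝓝 (x + (0 : ℝ) • v)) :=
      (by fun_prop : Continuous fun t : ℝ => x + t • v).tendsto 0
    rw [zero_smul, add_zero] at h1
    have h2 := (h1.eventually (σ.mem_relint_iff.1 hx).2).filter_mono
      (nhdsWithin_le_nhds (s := Ioi 0))
    obtain ⟨t, ht, ht0⟩ := (h2.and self_mem_nhdsWithin).exists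
    have h3 := hw _ (ht (by rw [dotProduct_add, dotProduct_smul, hv, smul_zero, add_zero]))
    rw [dotProduct_add, dotProduct_smul, smul_eq_mul] at h3
    have h4 : t * (w ⬝ᵥ v) ≤ 0 := by linarith
    exact nonpos_of_mul_nonpos_right h4 ht0
  intro v hv
  refine le_antisymm (key v hv) ?_
  have := key (-v) (by rw [dotProduct_neg, hv, neg_zero])
  rw [dotProduct_neg] at this
  linarith

end Facet

theorem IsPrimitive.eq_of_smul_eq {u w : Lat d} (hu : IsPrimitive u) {c : ℤ} (hc : 0 < c)
    (h : u = c • w) : u = w := by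
  have h1 := hu c w h
  rw [Int.isUnit_iff] at h1
  have : c = 1 := by omega
  rw [h, this, one_smul]

theorem isPrimitive_of_pairing_eq_one {u v : Lat d} (h : toVec u ⬝ᵥ toVec v = 1) :
    IsPrimitive u := by
  intro k w hk
  rw [toVec_dotProduct, hk, smul_dotProduct, smul_eq_mul] at h
  have h1 : k * (w ⬝ᵥ v) = 1 := by exact_mod_cast h
  exact IsUnit.of_mul_eq_one _ h1

/-! ### Facets of a reflexive polytope in terms of the lattice points of the dual -/

section Reflexive

variable {Δ : Set (Vec d)}

/-- The facet normals of a reflexive polytope lie at height one. -/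
theorem Facet.normal_spec (hΔ : IsReflexive Δ) (σ : Facet Δ) :
    σ.normal ∈ dualLat Δ ∧ ∀ m ∈ σ.carrier, m ⬝ᵥ toVec σ.normal = 1 := by
  obtain ⟨m₀, hm₀⟩ : σ.carrier.Nonempty := σ.nonempty
  obtain ⟨y, hy, hpos⟩ := hΔ.exists_pos σ.toVec_normal_ne_zero
  have hc : 0 < toVec σ.normal ⬝ᵥ m₀ := hpos.trans_le (hm₀.2 y hy)
  set c := toVec σ.normal ⬝ᵥ m₀ with hcdef
  obtain ⟨v, hv, hvle⟩ := hΔ.isLatticePolytope.exists_lattice_ge (toVec σ.normal) hm₀.1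
  have hvc : toVec σ.normal ⬝ᵥ toVec v = c := le_antisymm (hm₀.2 _ hv) hvle
  have hd : c⁻¹ • toVec σ.normal ∈ dualPolytope Δ := by
    intro z hz
    rw [dotProduct_smul, smul_eq_mul, inv_mul_le_iff₀ hc, mul_one, dotProduct_comm]
    exact hm₀.2 z hz
  -- a generator of the dual polytope that pairs to one with all points of the facet
  obtain ⟨S, hS⟩ := hΔ.dual_isLatticePolytope
  have hfin : ((toVec '' (S : Set (Lat d)))).Finite := S.finite_toSet.image _
  have hd' := hd
  rw [hS, hfin.convexHull_eq] at hd'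
  obtain ⟨w, hw0, hw1, hwc⟩ := hd'
  rw [Finset.centerMass_eq_of_sum_1 _ _ hw1] at hwc
  have hSd : ∀ z ∈ hfin.toFinset, z ∈ dualPolytope Δ := by
    intro z hz
    rw [hS]
    exact subset_convexHull ℝ _ (by simpa using hz)
  obtain ⟨z, hz, hwz⟩ : ∃ z ∈ hfin.toFinset, 0 < w z := by
    by_contra! hcon
    have : ∑ z ∈ hfin.toFinset, w z ≤ 0 := Finset.sum_nonpos hcon
    linarith
  -- The rescaled normal is a convex combination of generators, each pairing to at most 1 with `m`.
  -- It pairs to 1 with points of the facet, so every generator of positive weight does too.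
  have hz1 : ∀ m ∈ σ.carrier, m ⬝ᵥ z = 1 := by
    intro m hm
    have h1 : ∑ z ∈ hfin.toFinset, w z * (m ⬝ᵥ z) = 1 := by
      have h2 : m ⬝ᵥ (∑ z ∈ hfin.toFinset, w z • id z) = m ⬝ᵥ (c⁻¹ • toVec σ.normal) := by
        rw [hwc]
      rw [dotProduct_sum, dotProduct_smul, dotProduct_comm m (toVec σ.normal),
        σ.pairing_eq hm hm₀, ← hcdef, smul_eq_mul, inv_mul_cancel₀ hc.ne'] at h2
      simpa [dotProduct_smul] using h2
    have h3 : ∑ z ∈ hfin.toFinset, w z * (1 - m ⬝ᵥ z) = 0 := by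
      simp only [mul_sub, mul_one, Finset.sum_sub_distrib, h1]
      linarith
    have h4 := (Finset.sum_eq_zero_iff_of_nonneg (fun z hz =>
      mul_nonneg (hw0 z (by simpa using hz)) (sub_nonneg.2 (hSd z hz m hm.1)))).1 h3 z hz
    rcases mul_eq_zero.1 h4 with h5 | h5
    · exact absurd h5 hwz.ne'
    · linarith
  obtain ⟨s, hsS, rfl⟩ : ∃ s : Lat d, s ∈ S ∧ toVec s = z := by simpa using hz
  have hker : ∀ v, toVec σ.normal ⬝ᵥ v = 0 → toVec s ⬝ᵥ v = 0 := by
    have h1 : vectorSpan ℝ σ.carrier ≤ LinearMap.ker (dotLin (toVec s)) := by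
      rw [vectorSpan_def, Submodule.span_le]
      rintro _ ⟨x, hx, y, hy, rfl⟩
      simp only [SetLike.mem_coe, LinearMap.mem_ker, dotLin_apply, vsub_eq_sub, dotProduct_sub]
      rw [dotProduct_comm, dotProduct_comm (toVec s), hz1 x hx, hz1 y hy, sub_self]
    rw [σ.vectorSpan_eq] at h1
    exact fun v hv => h1 (by simpa using hv)
  obtain ⟨t, ht⟩ := eq_smul_of_ker_le σ.toVec_normal_ne_zero hker
  have hvσ : toVec v ∈ σ.carrier := ⟨hv, fun y hy => (hm₀.2 y hy).trans hvle⟩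
  have htc : t * c = 1 := by
    have := hz1 _ hm₀
    rw [ht, dotProduct_smul, dotProduct_comm, ← hcdef] at this
    exact this
  have hcint : c = ((σ.normal ⬝ᵥ v : ℤ) : ℝ) := by rw [← hvc, toVec_dotProduct]
  -- The height `c` is a positive integer, being the pairing with the lattice point `v`. Thus the
  -- normal is a positive integral multiple of `s`, and primitivity identifies the two.
  have hns : σ.normal = (σ.normal ⬝ᵥ v : ℤ) • s := by
    apply toVec_injective
    rw [toVec_smul, ← hcint, ht, smul_smul, mul_comm, htc, one_smul]
  have hcpos : 0 < (σ.normal ⬝ᵥ v : ℤ) := by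
    rw [hcint] at hc
    exact_mod_cast hc
  have hfinal := σ.primitive.eq_of_smul_eq hcpos hns
  rw [hfinal]
  exact ⟨hSd _ (by simpa using ⟨s, hsS, rfl⟩), hz1⟩

theorem Facet.mem_carrier_iff (hΔ : IsReflexive Δ) (σ : Facet Δ) {m : Vec d} :
    m ∈ σ.carrier ↔ m ∈ Δ ∧ m ⬝ᵥ toVec σ.normal = 1 := by
  refine ⟨fun hm => ⟨hm.1, (σ.normal_spec hΔ).2 m hm⟩, fun ⟨hm, h1⟩ => ⟨hm, fun y hy => ?_⟩⟩
  rw [dotProduct_comm _ m, h1, dotProduct_comm]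
  exact hΔ.pairing_le hy (σ.normal_spec hΔ).1

theorem Facet.normal_injective : Function.Injective (Facet.normal : Facet Δ → Lat d) := by
  rintro ⟨n, _, _, _⟩ ⟨n', _, _, _⟩ h
  simp only at h
  subst h
  rfl

theorem Facet.finite (hΔ : IsReflexive Δ) : Finite (Facet Δ) := by
  have : Finite (dualLat Δ) := hΔ.finite_dualLat
  exact Finite.of_injective (fun σ : Facet Δ => (⟨σ.normal, (σ.normal_spec hΔ).1⟩ : dualLat Δ))
    fun σ σ' h => Facet.normal_injective (congrArg Subtype.val h)

/-- A second active functional would attain its maximum over the facet at a relative interior point,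
hence be a multiple of the normal, and both take the value one there. Conversely, the finitely many
other inequalities are strict and persist nearby. -/
theorem Facet.mem_relint (hΔ : IsReflexive Δ) (σ : Facet Δ) {m : Vec d} :
    m ∈ σ.relint ↔ m ∈ Δ ∧ m ⬝ᵥ toVec σ.normal = 1 ∧
      ∀ s ∈ dualLat Δ, m ⬝ᵥ toVec s = 1 → s = σ.normal := by
  constructor
  · intro hm
    obtain ⟨h1, h2⟩ := (σ.mem_carrier_iff hΔ).1 (σ.relint_subset hm)
    refine ⟨h1, h2, fun s hs hs1 => ?_⟩
    obtain ⟨t, ht⟩ := σ.eq_smul_normal (w := toVec s) hm (fun y hy => by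
      rw [dotProduct_comm _ m, hs1, dotProduct_comm]
      exact hΔ.pairing_le hy.1 hs)
    rw [ht, dotProduct_smul, h2, smul_eq_mul, mul_one] at hs1
    apply toVec_injective
    rw [ht, hs1, one_smul]
  · rintro ⟨h1, h2, h3⟩
    have hc : m ∈ σ.carrier := (σ.mem_carrier_iff hΔ).2 ⟨h1, h2⟩
    refine σ.mem_relint_iff.2 ⟨hc, ?_⟩
    have h4 : ∀ᶠ y in 𝓝 m, ∀ s ∈ dualLat Δ, s ≠ σ.normal → y ⬝ᵥ toVec s ≤ 1 := by
      rw [Filter.eventually_all_finite hΔ.finite_dualLat]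
      intro s hs
      by_cases hsn : s = σ.normal
      · simp [hsn]
      · have hlt : m ⬝ᵥ toVec s < 1 :=
          lt_of_le_of_ne (hΔ.pairing_le h1 hs) fun h => hsn (h3 s hs h)
        have := ((continuous_dotProduct_left (toVec s)).tendsto m).eventually (gt_mem_nhds hlt)
        exact this.mono fun y hy _ => le_of_lt hy
    filter_upwards [h4] with y hy hyn
    rw [dotProduct_comm, dotProduct_comm _ m, h2] at hyn
    refine (σ.mem_carrier_iff hΔ).2 ⟨hΔ.mem_iff.2 fun s hs => ?_, hyn⟩
    by_cases hsn : s = σ.normal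
    · rw [hsn, hyn]
    · exact hy s hs hsn

theorem Facet.carrier_subset_bdA (hΔ : IsReflexive Δ) (σ : Facet Δ) : σ.carrier ⊆ bdA Δ :=
  fun m hm => hΔ.mem_bdA_iff.2 ⟨hm.1, σ.normal, (σ.normal_spec hΔ).1, (σ.normal_spec hΔ).2 m hm⟩

theorem Facet.relint_subset_bdA (hΔ : IsReflexive Δ) (σ : Facet Δ) : σ.relint ⊆ bdA Δ :=
  σ.relint_subset.trans (σ.carrier_subset_bdA hΔ)

theorem Facet.isCompact_carrier (hΔ : IsReflexive Δ) (σ : Facet Δ) : IsCompact σ.carrier := by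
  have : σ.carrier = Δ ∩ {m | m ⬝ᵥ toVec σ.normal = 1} := by
    ext m; exact σ.mem_carrier_iff hΔ
  rw [this]
  exact hΔ.isCompact.inter_right (isClosed_eq (by fun_prop) continuous_const)

theorem Facet.eq_of_mem_relint (hΔ : IsReflexive Δ) {σ σ' : Facet Δ} {m : Vec d}
    (hm : m ∈ σ.relint) (hm' : m ∈ σ'.carrier) : σ' = σ :=
  Facet.normal_injective (((σ.mem_relint hΔ).1 hm).2.2 _ (σ'.normal_spec hΔ).1
    ((σ'.normal_spec hΔ).2 _ hm'))

theorem Facet.exists_isOpen_relint (hΔ : IsReflexive Δ) (σ : Facet Δ) :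
    ∃ O : Set (Vec d), IsOpen O ∧ σ.relint = O ∩ bdA Δ := by
  refine ⟨⋂ s ∈ dualLat Δ \ {σ.normal}, {m | m ⬝ᵥ toVec s ≠ 1}, ?_, ?_⟩
  · exact (hΔ.finite_dualLat.subset sdiff_subset).isOpen_biInter fun s _ =>
      isOpen_ne_fun (by fun_prop) continuous_const
  · ext m
    rw [σ.mem_relint hΔ]
    simp only [mem_inter_iff, mem_iInter, mem_ofPred_eq, Set.mem_sdiff, mem_singleton_iff]
    constructor
    · rintro ⟨h1, h2, h3⟩
      exact ⟨fun s hs h => hs.2 (h3 s hs.1 h),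
        hΔ.mem_bdA_iff.2 ⟨h1, _, (σ.normal_spec hΔ).1, h2⟩⟩
    · rintro ⟨h1, h2⟩
      obtain ⟨h3, s, hs, hs1⟩ := hΔ.mem_bdA_iff.1 h2
      have h4 : ∀ s ∈ dualLat Δ, m ⬝ᵥ toVec s = 1 → s = σ.normal := fun s hs h => by
        by_contra hne
        exact h1 s ⟨hs, hne⟩ h
      have := h4 s hs hs1
      subst this
      exact ⟨h3, hs1, h4⟩

/-- A boundary point lying on a single facet inequality lies in the relative interior of a facet. -/
theorem IsReflexive.exists_facet_of_unique (hΔ : IsReflexive Δ) {m : Vec d} (hm : m ∈ Δ) {s : Lat d}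
    (hs : s ∈ dualLat Δ) (hms : m ⬝ᵥ toVec s = 1)
    (hu : ∀ s' ∈ dualLat Δ, m ⬝ᵥ toVec s' = 1 → s' = s) :
    ∃ σ : Facet Δ, σ.normal = s ∧ m ∈ σ.relint := by
  have hface : ∀ y, y ∈ face Δ (toVec s) ↔ y ∈ Δ ∧ y ⬝ᵥ toVec s = 1 := by
    intro y
    constructor
    · rintro ⟨hy, hy1⟩
      refine ⟨hy, le_antisymm (hΔ.pairing_le hy hs) ?_⟩
      have := hy1 m hm
      rwa [dotProduct_comm, hms, dotProduct_comm] at this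
    · rintro ⟨hy, hy1⟩
      refine ⟨hy, fun z hz => ?_⟩
      rw [dotProduct_comm, dotProduct_comm _ y, hy1]
      exact hΔ.pairing_le hz hs
  obtain ⟨v, hv, hle⟩ := hΔ.isLatticePolytope.exists_lattice_ge (toVec s) hm
  have hsv : toVec s ⬝ᵥ toVec v = 1 := by
    refine le_antisymm ?_ ?_
    · rw [dotProduct_comm]; exact hΔ.pairing_le hv hs
    · rwa [dotProduct_comm, hms] at hle
  have hs0 : toVec s ≠ 0 := by
    intro h0
    rw [h0] at hms
    simp at hms
  have hmf : m ∈ face Δ (toVec s) := (hface m).2 ⟨hm, hms⟩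
  have hspan : vectorSpan ℝ (face Δ (toVec s)) = LinearMap.ker (dotLin (toVec s)) := by
    refine le_antisymm ?_ ?_
    · rw [vectorSpan_def, Submodule.span_le]
      rintro _ ⟨x, hx, y, hy, rfl⟩
      simp only [SetLike.mem_coe, LinearMap.mem_ker, dotLin_apply, vsub_eq_sub, dotProduct_sub]
      rw [dotProduct_comm, dotProduct_comm (toVec s), ((hface x).1 hx).2, ((hface y).1 hy).2,
        sub_self]
    · intro v hv
      have hv0 : v ⬝ᵥ toVec s = 0 := by rw [dotProduct_comm]; exact hv
      have h1 : ∀ᶠ t : ℝ in 𝓝[>] 0, ∀ s' ∈ dualLat Δ, (m + t • v) ⬝ᵥ toVec s' ≤ 1 := by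
        rw [Filter.eventually_all_finite hΔ.finite_dualLat]
        intro s' hs'
        by_cases hss : s' = s
        · refine Eventually.of_forall fun t => ?_
          rw [hss, add_dotProduct, hms, smul_dotProduct, hv0, smul_zero, add_zero]
        · have hlt : m ⬝ᵥ toVec s' < 1 :=
            lt_of_le_of_ne (hΔ.pairing_le hm hs') fun h => hss (hu s' hs' h)
          have hc : Continuous fun t : ℝ => (m + t • v) ⬝ᵥ toVec s' := by fun_prop
          have h2 := hc.tendsto 0
          rw [zero_smul, add_zero] at h2
          exact ((h2.eventually (gt_mem_nhds hlt)).filter_mono nhdsWithin_le_nhds).mono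
            fun t ht => le_of_lt ht
      obtain ⟨t, ht, ht0⟩ := (h1.and self_mem_nhdsWithin).exists
      have h3 : m + t • v ∈ face Δ (toVec s) := (hface _).2 ⟨hΔ.mem_iff.2 ht, by
        rw [add_dotProduct, hms, smul_dotProduct, hv0, smul_zero, add_zero]⟩
      have h4 := vsub_mem_vectorSpan ℝ h3 hmf
      rw [vsub_eq_sub, add_sub_cancel_left] at h4
      have h5 := Submodule.smul_mem _ t⁻¹ h4
      rwa [smul_smul, inv_mul_cancel₀ (ne_of_gt ht0), one_smul] at h5
  let σ : Facet Δ :=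
    { normal := s
      primitive := isPrimitive_of_pairing_eq_one hsv
      nonempty := ⟨m, hmf⟩
      finrank_eq := by rw [hspan, finrank_ker_dotLin hs0] }
  exact ⟨σ, rfl, (σ.mem_relint hΔ).2 ⟨hm, hms, hu⟩⟩

end Reflexive

end

section

variable {d : ℕ} {Δ : Set (Vec d)}

/-! ### The gauge of a reflexive polytope -/

namespace IsReflexive

theorem _root_.ReflexiveMA.dualLat_nonempty : (dualLat Δ).Nonempty := by
  refine ⟨0, fun m _ => ?_⟩
  simp

/-- The gauge is the maximum of finitely many pairings. It serves for the radial projection `y ↦ y /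
g(y)` of the punctured space onto the boundary. -/
theorem exists_gauge (hΔ : IsReflexive Δ) : ∃ g : Vec d → ℝ, Continuous g ∧
    (∀ y, ∀ s ∈ dualLat Δ, y ⬝ᵥ toVec s ≤ g y) ∧ ∀ y, ∃ s ∈ dualLat Δ, g y = y ⬝ᵥ toVec s := by
  have hne : hΔ.finite_dualLat.toFinset.Nonempty := by simpa using dualLat_nonempty
  refine ⟨fun y => hΔ.finite_dualLat.toFinset.sup' hne fun s => y ⬝ᵥ toVec s, ?_, ?_, ?_⟩
  · exact Continuous.finset_sup'_apply hne fun s _ => by fun_prop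
  · intro y s hs
    exact Finset.le_sup' (fun s => y ⬝ᵥ toVec s) (by simpa using hs)
  · intro y
    obtain ⟨s, hs, h⟩ := Finset.exists_mem_eq_sup' hne fun s => y ⬝ᵥ toVec s
    exact ⟨s, by simpa using hs, h⟩

theorem exists_pairing_pos (hΔ : IsReflexive Δ) {y : Vec d} (hy : y ≠ 0) :
    ∃ s ∈ dualLat Δ, 0 < y ⬝ᵥ toVec s := by
  obtain ⟨t, _, _, s, hs, _, h⟩ := hΔ.exists_exit hΔ.zero_mem hy
  exact ⟨s, hs, h⟩

/-- The boundary is the radial projection of the complement of the origin, which is connected in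
real dimension at least two. This is where `1 ≤ d` enters. -/
theorem isPreconnected_bdA (hΔ : IsReflexive Δ) (hd : 1 ≤ d) : IsPreconnected (bdA Δ) := by
  obtain ⟨g, hgc, hge, hga⟩ := hΔ.exists_gauge
  have hgpos : ∀ y : Vec d, y ≠ 0 → 0 < g y := fun y hy => by
    obtain ⟨s, hs, h⟩ := hΔ.exists_pairing_pos hy
    exact h.trans_le (hge y s hs)
  have hconn : IsPreconnected ({0}ᶜ : Set (Vec d)) :=
    (isConnected_compl_singleton_of_one_lt_rank (by
      rw [rank_fin_fun]
      exact_mod_cast (by omega : 1 < d + 1)) 0).isPreconnected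
  have himg : bdA Δ = (fun y => (g y)⁻¹ • y) '' ({0}ᶜ : Set (Vec d)) := by
    ext m
    constructor
    · intro hm
      refine ⟨m, hΔ.ne_zero_of_mem_bdA hm, ?_⟩
      obtain ⟨h1, s, hs, hs1⟩ := hΔ.mem_bdA_iff.1 hm
      have : g m = 1 := by
        obtain ⟨s', hs', h'⟩ := hga m
        refine le_antisymm (h'.trans_le (hΔ.pairing_le h1 hs')) ?_
        rw [← hs1]
        exact hge m s hs
      simp [this]
    · rintro ⟨y, hy, rfl⟩
      have hy0 := hgpos y hy
      rw [hΔ.mem_bdA_iff, hΔ.mem_iff]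
      refine ⟨fun s hs => ?_, ?_⟩
      · rw [smul_dotProduct, smul_eq_mul, inv_mul_le_iff₀ hy0, mul_one]
        exact hge y s hs
      · obtain ⟨s, hs, h⟩ := hga y
        exact ⟨s, hs, by rw [smul_dotProduct, ← h, smul_eq_mul, inv_mul_cancel₀ hy0.ne']⟩
  rw [himg]
  refine hconn.image _ ?_
  exact (hgc.continuousOn.inv₀ fun y hy => (hgpos y hy).ne').smul continuousOn_id

/-- The relative interiors of the facets are dense in the boundary. -/
theorem exists_relint_near (hΔ : IsReflexive Δ) {m : Vec d} (hm : m ∈ bdA Δ) {W : Set (Vec d)}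
    (hW : W ∈ 𝓝 m) : ∃ σ : Facet Δ, ∃ m' ∈ W, m' ∈ σ.relint := by
  obtain ⟨g, hgc, hge, hga⟩ := hΔ.exists_gauge
  obtain ⟨h1, s, hs, hs1⟩ := hΔ.mem_bdA_iff.1 hm
  have hgm : g m = 1 := by
    obtain ⟨s', hs', h'⟩ := hga m
    refine le_antisymm (h'.trans_le (hΔ.pairing_le h1 hs')) ?_
    rw [← hs1]
    exact hge m s hs
  have hcont : Tendsto (fun y => (g y)⁻¹ • y) (𝓝 m) (𝓝 m) := by
    have : ContinuousAt (fun y => (g y)⁻¹ • y) m :=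
      (hgc.continuousAt.inv₀ (by rw [hgm]; exact one_ne_zero)).smul continuousAt_id
    have h2 := this.tendsto
    simpa [hgm] using h2
  have hpos : ∀ᶠ y in 𝓝 m, 0 < g y :=
    (hgc.tendsto m).eventually (lt_mem_nhds (by rw [hgm]; exact one_pos))
  -- Away from finitely many hyperplanes, distinct lattice points of the dual have distinct pairings
  -- with `y`. The radial projection of such a `y` then has a single active inequality.
  have hdense : Dense {y : Vec d | ∀ s ∈ dualLat Δ, ∀ s' ∈ dualLat Δ, s ≠ s' →
      y ⬝ᵥ toVec s ≠ y ⬝ᵥ toVec s'} := by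
    apply Measure.dense_of_ae (μ := (volume : Measure (Vec d)))
    rw [ae_ball_iff hΔ.finite_dualLat.countable]
    intro s hs
    rw [ae_ball_iff hΔ.finite_dualLat.countable]
    intro s' hs'
    by_cases hss : s = s'
    · exact Eventually.of_forall fun y h => absurd hss h
    have hker : volume (LinearMap.ker (dotLin (toVec (s - s'))) : Set (Vec d)) = 0 := by
      apply Measure.addHaar_submodule
      intro htop
      have h3 : toVec (s - s') ∈ LinearMap.ker (dotLin (toVec (s - s'))) := by
        rw [htop]; trivial
      have h4 : toVec (s - s') ⬝ᵥ toVec (s - s') = 0 := h3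
      exact (dotProduct_self_pos_of_ne_zero (toVec_ne_zero (sub_ne_zero.2 hss))).ne' h4
    filter_upwards [measure_eq_zero_iff_ae_notMem.1 hker] with y hy _ h
    apply hy
    show toVec (s - s') ⬝ᵥ y = 0
    rw [toVec_sub, sub_dotProduct, dotProduct_comm, h, dotProduct_comm, sub_self]
  obtain ⟨y, hy, hyg, hyW⟩ := (mem_closure_iff_frequently.1 (hdense m)).and_eventually
    (hpos.and (hcont.eventually hW)) |>.exists
  obtain ⟨s, hs, hsy⟩ := hga y
  have hpair : ∀ s' : Lat d, ((g y)⁻¹ • y) ⬝ᵥ toVec s' = (g y)⁻¹ * (y ⬝ᵥ toVec s') := by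
    intro s'; rw [smul_dotProduct, smul_eq_mul]
  obtain ⟨σ, _, hσ⟩ := hΔ.exists_facet_of_unique (m := (g y)⁻¹ • y) (s := s)
    (hΔ.mem_iff.2 fun s' hs' => by
      rw [hpair, inv_mul_le_iff₀ hyg, mul_one]; exact hge y s' hs') hs
    (by rw [hpair, ← hsy, inv_mul_cancel₀ hyg.ne'])
    (fun s' hs' h => by
      by_contra hne
      rw [hpair, inv_mul_eq_one₀ hyg.ne', hsy] at h
      exact hy s hs s' hs' (Ne.symm hne) h)
  exact ⟨σ, _, hyW, hσ⟩

/-- Every boundary point lies on a facet. -/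
theorem exists_facet_mem (hΔ : IsReflexive Δ) {m : Vec d} (hm : m ∈ bdA Δ) :
    ∃ σ : Facet Δ, m ∈ σ.carrier := by
  have := Facet.finite hΔ
  have hcl : IsClosed (⋃ σ : Facet Δ, σ.carrier) :=
    isClosed_iUnion_of_finite fun σ => (σ.isCompact_carrier hΔ).isClosed
  have hm' : m ∈ closure (⋃ σ : Facet Δ, σ.carrier) := by
    rw [mem_closure_iff_nhds]
    intro W hW
    obtain ⟨σ, m', h1, h2⟩ := hΔ.exists_relint_near hm hW
    exact ⟨m', h1, mem_iUnion.2 ⟨σ, σ.relint_subset h2⟩⟩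
  rw [hcl.closure_eq] at hm'
  exact mem_iUnion.1 hm'

end IsReflexive

theorem Facet.exists_lattice (hΔ : IsReflexive Δ) (σ : Facet Δ) :
    ∃ v : Lat d, toVec v ∈ σ.carrier := by
  obtain ⟨m, hm⟩ : σ.carrier.Nonempty := σ.nonempty
  obtain ⟨v, hv, hle⟩ := hΔ.isLatticePolytope.exists_lattice_ge (toVec σ.normal) hm.1
  exact ⟨v, hv, fun y hy => (hm.2 y hy).trans hle⟩

/-! ### The polytope `Δ_h^∨` -/

variable {h : Lat d → ℤ}

theorem isClosed_dualH : IsClosed (dualH Δ h) := by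
  have : dualH Δ h = ⋂ m : Lat d, ⋂ _ : toVec m ∈ Δ, {n | toVec m ⬝ᵥ n ≤ h m} := by
    ext n; simp [dualH]
  rw [this]
  exact isClosed_iInter fun m => isClosed_iInter fun _ =>
    isClosed_le (by fun_prop) continuous_const

theorem convex_dualH : Convex ℝ (dualH Δ h) := by
  have : dualH Δ h = ⋂ m : Lat d, ⋂ _ : toVec m ∈ Δ, {n | toVec m ⬝ᵥ n ≤ h m} := by
    ext n; simp [dualH]
  rw [this]
  exact convex_iInter fun m => convex_iInter fun _ =>
    convex_halfSpace_le ⟨dotProduct_add _, fun c y => dotProduct_smul c _ y⟩ _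

/-- Pairings of `n` with lattice points of `Δ`, hence with all of `Δ`, are bounded by the maximum of
`h`. Since `Δ` contains a ball around the origin, this bounds every coordinate of `n`. -/
theorem isCompact_dualH (hΔ : IsReflexive Δ) : IsCompact (dualH Δ h) := by
  refine Metric.isCompact_of_isClosed_isBounded isClosed_dualH ?_
  obtain ⟨ε, hε, hball⟩ := hΔ.ball_subset
  obtain ⟨H, hH⟩ := (hΔ.finite_lattice.image h).bddAbove
  have hle : ∀ n ∈ dualH Δ h, ∀ x ∈ Δ, n ⬝ᵥ x ≤ H := by
    intro n hn x hx
    obtain ⟨v, hv, hle⟩ := hΔ.isLatticePolytope.exists_lattice_ge n hx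
    refine hle.trans ?_
    rw [dotProduct_comm]
    refine (hn v hv).trans ?_
    exact_mod_cast hH ⟨v, hv, rfl⟩
  have hs : ∀ (i : Fin (d + 1)) (c : ℝ), |c| < ε → Pi.single i c ∈ Δ := by
    intro i c hc
    refine hball ?_
    rw [mem_ball_zero_iff]
    rw [show ‖(Pi.single i c : Vec d)‖ = ‖c‖ from Pi.norm_single _]
    exact hc
  rw [isBounded_iff_forall_norm_le]
  refine ⟨max 0 (H / (ε / 2)), fun n hn => ?_⟩
  rw [pi_norm_le_iff_of_nonneg (le_max_left _ _)]
  intro i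
  refine le_trans ?_ (le_max_right _ _)
  rw [le_div_iff₀ (by positivity), Real.norm_eq_abs]
  have h1 := hle n hn _ (hs i (ε / 2) (by rw [abs_of_pos (by positivity)]; linarith))
  have h2 := hle n hn _ (hs i (-(ε / 2)) (by rw [abs_neg, abs_of_pos (by positivity)]; linarith))
  rw [dotProduct_single] at h1 h2
  rcases abs_cases (n i) with ⟨h3, _⟩ | ⟨h3, _⟩ <;> rw [h3] <;> linarith

theorem mem_interior_dualH (hΔ : IsReflexive Δ) (hh : IsHeight Δ h) {n : Vec d}
    (hn : ∀ m : Lat d, toVec m ∈ Δ → m ≠ 0 → toVec m ⬝ᵥ n < h m) : n ∈ interior (dualH Δ h) := by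
  rw [mem_interior]
  refine ⟨⋂ m ∈ {m : Lat d | toVec m ∈ Δ}, {n | m ≠ 0 → toVec m ⬝ᵥ n < h m}, ?_, ?_, ?_⟩
  · intro n' hn' m hm
    simp only [mem_iInter, mem_ofPred_eq] at hn'
    by_cases h0 : m = 0
    · simp [h0, hh.1]
    · exact (hn' m hm h0).le
  · refine hΔ.finite_lattice.isOpen_biInter fun m _ => ?_
    by_cases h0 : m = 0
    · simp [h0]
    · simpa [h0] using isOpen_lt (by fun_prop : Continuous fun n => toVec m ⬝ᵥ n) continuous_const
  · simpa using hn

theorem zero_mem_interior_dualH (hΔ : IsReflexive Δ) (hh : IsHeight Δ h) :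
    (0 : Vec d) ∈ interior (dualH Δ h) :=
  mem_interior_dualH hΔ hh fun m hm h0 => by
    rw [dotProduct_zero]; exact_mod_cast hh.2 m hm h0

theorem zero_mem_dualH (hΔ : IsReflexive Δ) (hh : IsHeight Δ h) :
    (0 : Vec d) ∈ dualH Δ h := interior_subset (zero_mem_interior_dualH hΔ hh)

theorem mem_bdB_iff (hΔ : IsReflexive Δ) (hh : IsHeight Δ h) {n : Vec d} :
    n ∈ bdB Δ h ↔ n ∈ dualH Δ h ∧ ∃ m : Lat d, toVec m ∈ bdA Δ ∧ toVec m ⬝ᵥ n = h m := by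
  unfold bdB
  rw [isClosed_dualH.frontier_eq]
  constructor
  · rintro ⟨h1, h2⟩
    refine ⟨h1, ?_⟩
    by_contra! hcon
    exact h2 (mem_interior_dualH hΔ hh fun m hm h0 =>
      lt_of_le_of_ne (h1 m hm) (hcon m (hΔ.lattice_mem_bdA hm h0)))
  · rintro ⟨h1, m, hm, hmn⟩
    refine ⟨h1, fun h2 => ?_⟩
    have hmΔ := hΔ.bdA_subset hm
    have hm0 : m ≠ 0 := by
      rintro rfl
      exact hΔ.ne_zero_of_mem_bdA hm (by simp)
    have h3 : ∀ᶠ t : ℝ in 𝓝[>] 1, t • n ∈ dualH Δ h := by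
      have : Tendsto (fun t : ℝ => t • n) (𝓝 1) (𝓝 ((1 : ℝ) • n)) :=
        (continuous_id.smul continuous_const).tendsto 1
      rw [one_smul] at this
      exact (this.eventually (mem_interior_iff_mem_nhds.1 h2)).filter_mono nhdsWithin_le_nhds
    obtain ⟨t, ht, ht1⟩ := (h3.and self_mem_nhdsWithin).exists
    have h4 := ht m hmΔ
    have hpos : (0 : ℝ) < h m := by exact_mod_cast hh.2 m hmΔ hm0
    rw [dotProduct_smul, hmn, smul_eq_mul] at h4
    have : (1 : ℝ) < t := ht1
    nlinarith

theorem bdB_subset : bdB Δ h ⊆ dualH Δ h := isClosed_dualH.frontier_subset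

theorem isCompact_bdB (hΔ : IsReflexive Δ) : IsCompact (bdB Δ h) :=
  (isCompact_dualH hΔ).of_isClosed_subset isClosed_frontier bdB_subset

theorem bdB_nonempty (hΔ : IsReflexive Δ) (hh : IsHeight Δ h) : (bdB Δ h).Nonempty := by
  refine nonempty_frontier_iff.2 ⟨⟨0, zero_mem_dualH hΔ hh⟩, fun huniv => ?_⟩
  have h1 := (isCompact_dualH (h := h) hΔ).isBounded
  rw [huniv] at h1
  exact NormedSpace.unbounded_univ ℝ (Vec d) h1

theorem bdA_nonempty (hΔ : IsReflexive Δ) : (bdA Δ).Nonempty := by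
  refine nonempty_frontier_iff.2 ⟨⟨0, hΔ.zero_mem⟩, fun huniv => ?_⟩
  have h1 := hΔ.isCompact.isBounded
  rw [huniv] at h1
  exact NormedSpace.unbounded_univ ℝ (Vec d) h1

/-- Near a point no further inequalities become active. -/
theorem eventually_active (hΔ : IsReflexive Δ) {n : Vec d} (hn : n ∈ dualH Δ h) :
    ∀ᶠ n' in 𝓝 n, ∀ m ∈ {m : Lat d | toVec m ∈ Δ}, toVec m ⬝ᵥ n ≠ h m → toVec m ⬝ᵥ n' < h m := by
  rw [Filter.eventually_all_finite hΔ.finite_lattice]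
  intro m hm
  by_cases hmn : toVec m ⬝ᵥ n = h m
  · exact Eventually.of_forall fun n' h' => absurd hmn h'
  · have hlt := lt_of_le_of_ne (hn m hm) hmn
    exact (((continuous_dotProduct_right (toVec m)).tendsto n).eventually
      (gt_mem_nhds hlt)).mono fun n' h' _ => h'

/-! ### Facets of `Δ_h^∨` -/

theorem Facet.relint_nonempty_dualH (τ : Facet (dualH Δ h)) : τ.relint.Nonempty := by
  refine Set.Nonempty.intrinsicInterior ?_ τ.nonempty
  intro x hx y hy a b ha hb hab
  refine ⟨convex_dualH hx.1 hy.1 ha hb hab, fun z hz => ?_⟩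
  rw [dotProduct_add, dotProduct_smul, dotProduct_smul, smul_eq_mul, smul_eq_mul,
    ← τ.pairing_eq hx hy, ← add_mul, hab, one_mul]
  exact hx.2 z hz

theorem Facet.relint_dualH_subset_bdB (τ : Facet (dualH Δ h)) : τ.carrier ⊆ bdB Δ h := by
  intro n hn
  unfold bdB
  rw [isClosed_dualH.frontier_eq]
  refine ⟨hn.1, fun h2 => ?_⟩
  have h3 : ∀ᶠ t : ℝ in 𝓝[>] 0, n + t • toVec τ.normal ∈ dualH Δ h := by
    have : Tendsto (fun t : ℝ => n + t • toVec τ.normal) (𝓝 0)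
        (𝓝 (n + (0 : ℝ) • toVec τ.normal)) :=
      (by fun_prop : Continuous fun t : ℝ => n + t • toVec τ.normal).tendsto 0
    rw [zero_smul, add_zero] at this
    exact (this.eventually (mem_interior_iff_mem_nhds.1 h2)).filter_mono nhdsWithin_le_nhds
  obtain ⟨t, ht, ht1⟩ := (h3.and self_mem_nhdsWithin).exists
  have h4 := hn.2 _ ht
  rw [dotProduct_add, dotProduct_smul, smul_eq_mul] at h4
  have h5 := mul_pos ht1 (dotProduct_self_pos_of_ne_zero τ.toVec_normal_ne_zero)
  linarith

/-- The only inequality active at a relative interior point of a facet of `Δ_h^∨` is the one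
given by its normal. -/
theorem Facet.eq_normal_of_active (hΔ : IsReflexive Δ) (hh : IsHeight Δ h)
    (τ : Facet (dualH Δ h)) {n : Vec d} (hn : n ∈ τ.relint) {m : Lat d} (hm : toVec m ∈ bdA Δ)
    (hmn : toVec m ⬝ᵥ n = h m) : m = τ.normal := by
  have hmΔ := hΔ.bdA_subset hm
  have hm0 : m ≠ 0 := by
    rintro rfl
    exact hΔ.ne_zero_of_mem_bdA hm (by simp)
  obtain ⟨t, ht⟩ := τ.eq_smul_normal hn (w := toVec m) (fun y hy => by
    rw [hmn]; exact hy.1 m hmΔ)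
  have hpos : (0 : ℝ) < h m := by exact_mod_cast hh.2 m hmΔ hm0
  have h1 : 0 ≤ toVec τ.normal ⬝ᵥ n := by
    have := (τ.relint_subset hn).2 0 (zero_mem_dualH hΔ hh)
    simpa using this
  have htpos : 0 < t := by
    rw [ht, smul_dotProduct, smul_eq_mul] at hmn
    by_contra! hcon
    have := mul_nonpos_of_nonpos_of_nonneg hcon h1
    linarith
  -- Pairing with an `s` at height one on `m` shows that `t` is the inverse of a positive integer,
  -- so the primitive normal is a positive integral multiple of `m`.
  obtain ⟨_, s, hs, hs1⟩ := hΔ.mem_bdA_iff.1 hm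
  have h2 : t * ((τ.normal ⬝ᵥ s : ℤ) : ℝ) = 1 := by
    rw [← toVec_dotProduct, ← smul_eq_mul, ← smul_dotProduct, ← ht, hs1]
  have hk : 0 < (τ.normal ⬝ᵥ s : ℤ) := by
    have : (0 : ℝ) < ((τ.normal ⬝ᵥ s : ℤ) : ℝ) := by
      by_contra! hcon
      have := mul_nonpos_of_nonneg_of_nonpos htpos.le hcon
      linarith
    exact_mod_cast this
  refine (τ.primitive.eq_of_smul_eq hk (w := m) ?_).symm
  apply toVec_injective
  rw [toVec_smul, ht, smul_smul, mul_comm, h2, one_smul]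

theorem Facet.normal_mem_bdA (hΔ : IsReflexive Δ) (hh : IsHeight Δ h) (τ : Facet (dualH Δ h)) :
    toVec τ.normal ∈ bdA Δ ∧ ∀ n ∈ τ.carrier, toVec τ.normal ⬝ᵥ n = h τ.normal := by
  obtain ⟨n, hn⟩ := τ.relint_nonempty_dualH
  obtain ⟨_, m, hm, hmn⟩ := (mem_bdB_iff hΔ hh).1 (τ.relint_dualH_subset_bdB (τ.relint_subset hn))
  have h1 := τ.eq_normal_of_active hΔ hh hn hm hmn
  subst h1
  exact ⟨hm, fun n' hn' => by rw [τ.pairing_eq hn' (τ.relint_subset hn), hmn]⟩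

theorem Facet.finite_dualH (hΔ : IsReflexive Δ) (hh : IsHeight Δ h) : Finite (Facet (dualH Δ h)) := by
  have : Finite {m : Lat d | toVec m ∈ Δ} := hΔ.finite_lattice
  exact Finite.of_injective (fun τ : Facet (dualH Δ h) =>
    (⟨τ.normal, hΔ.bdA_subset (τ.normal_mem_bdA hΔ hh).1⟩ : {m : Lat d | toVec m ∈ Δ}))
    fun σ σ' h => Facet.normal_injective (congrArg Subtype.val h)

theorem Facet.isClosed_carrier_dualH (τ : Facet (dualH Δ h)) : IsClosed τ.carrier := by
  obtain ⟨n, hn⟩ : τ.carrier.Nonempty := τ.nonempty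
  have : τ.carrier = dualH Δ h ∩ {y | toVec τ.normal ⬝ᵥ n ≤ toVec τ.normal ⬝ᵥ y} := by
    ext y
    exact ⟨fun hy => ⟨hy.1, hy.2 n hn.1⟩, fun hy => ⟨hy.1, fun z hz => (hn.2 z hz).trans hy.2⟩⟩
  rw [this]
  exact isClosed_dualH.inter (isClosed_le continuous_const (by fun_prop))

theorem Facet.measurableSet_relint_dualH (τ : Facet (dualH Δ h)) : MeasurableSet τ.relint := by
  obtain ⟨n, hn⟩ : τ.carrier.Nonempty := τ.nonempty
  have : τ.relint = τ.carrier ∩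
      {x | ∀ᶠ y in 𝓝 x, toVec τ.normal ⬝ᵥ y = toVec τ.normal ⬝ᵥ n → y ∈ τ.carrier} := by
    ext x
    rw [τ.mem_relint_iff]
    refine and_congr_right fun hx => ?_
    rw [τ.pairing_eq hx hn]
    rfl
  rw [this]
  exact τ.isClosed_carrier_dualH.measurableSet.inter isOpen_setOfPred_eventually_nhds.measurableSet

theorem Facet.measurableSet_relint (hΔ : IsReflexive Δ) (σ : Facet Δ) :
    MeasurableSet σ.relint := by
  obtain ⟨O, hO, h1⟩ := σ.exists_isOpen_relint hΔ
  rw [h1]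
  exact hO.measurableSet.inter hΔ.isCompact_bdA.measurableSet

/-! ### Integral affine coordinates -/

/-- The linear part of the parametrization of the affine span of `σ`. -/
noncomputable def Facet.lin (σ : Facet Δ) : (Fin d → ℝ) →ₗ[ℝ] Vec d where
  toFun x := ∑ i, x i • toVec (σ.basis i : Lat d)
  map_add' x y := by simp [add_smul, Finset.sum_add_distrib]
  map_smul' c x := by simp [mul_smul, Finset.smul_sum]

theorem Facet.param_eq (σ : Facet Δ) (x : Fin d → ℝ) : σ.param x = σ.nonempty.some + σ.lin x := rfl

theorem Facet.lin_dotProduct (σ : Facet Δ) (x : Fin d → ℝ) (n : Vec d) :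
    σ.lin x ⬝ᵥ n = x ⬝ᵥ σ.chart n := by
  show (∑ i, x i • toVec (σ.basis i : Lat d)) ⬝ᵥ n = _
  rw [sum_dotProduct]
  simp only [smul_dotProduct, smul_eq_mul]
  rfl

theorem orthLattice_pairing {u : Lat d} (v : orthLattice u) : (v : Lat d) ⬝ᵥ u = 0 := v.2

theorem Facet.chart_normal (σ : Facet Δ) : σ.chart (toVec σ.normal) = 0 := by
  funext i
  show toVec (σ.basis i : Lat d) ⬝ᵥ toVec σ.normal = 0
  rw [toVec_dotProduct, orthLattice_pairing]
  simp

theorem Facet.lin_normal (σ : Facet Δ) (x : Fin d → ℝ) : σ.lin x ⬝ᵥ toVec σ.normal = 0 := by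
  rw [σ.lin_dotProduct, σ.chart_normal, dotProduct_zero]

theorem Facet.exists_lin_of_lattice (σ : Facet Δ) {u : Lat d} (hu : u ⬝ᵥ σ.normal = 0) :
    toVec u = σ.lin fun i => (σ.basis.repr ⟨u, hu⟩ i : ℝ) := by
  have h1 := congrArg (Subtype.val) (σ.basis.sum_repr ⟨u, hu⟩)
  simp only [AddSubmonoidClass.coe_finsetSum, SetLike.val_smul] at h1
  show toVec u = ∑ i, (σ.basis.repr ⟨u, hu⟩ i : ℝ) • toVec (σ.basis i : Lat d)
  simp only [← toVec_smul]
  conv_lhs => rw [← h1]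
  funext j
  simp [toVec]

/-- A lattice point `w` of `σ` has height one, so `M` splits as `n_σ^⊥ ⊕ ℤ w`. Decomposing the
standard basis vectors integrally and extending linearly shows that the lattice basis of `n_σ^⊥`
spans the real hyperplane. -/
theorem Facet.exists_lin (hΔ : IsReflexive Δ) (σ : Facet Δ) {v : Vec d}
    (hv : v ⬝ᵥ toVec σ.normal = 0) : ∃ x, σ.lin x = v := by
  obtain ⟨w, hw⟩ := σ.exists_lattice hΔ
  have hw1 := (σ.normal_spec hΔ).2 _ hw
  have hw1' : w ⬝ᵥ σ.normal = 1 := by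
    rw [toVec_dotProduct] at hw1
    exact_mod_cast hw1
  have h1 : ∀ j, ∃ x, toVec (Pi.single j 1 : Lat d) =
      σ.lin x + (((Pi.single j 1 : Lat d) ⬝ᵥ σ.normal : ℤ) : ℝ) • toVec w := by
    intro j
    have h2 : ((Pi.single j 1 : Lat d) - ((Pi.single j 1 : Lat d) ⬝ᵥ σ.normal) • w) ⬝ᵥ σ.normal
        = 0 := by
      rw [sub_dotProduct, smul_dotProduct, hw1', smul_eq_mul, mul_one, sub_self]
    obtain ⟨x, hx⟩ : ∃ x, toVec _ = σ.lin x := ⟨_, σ.exists_lin_of_lattice h2⟩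
    exact ⟨x, by rw [← hx, toVec_sub, toVec_smul, sub_add_cancel]⟩
  choose x hx using h1
  refine ⟨∑ j, v j • x j, ?_⟩
  have h3 : v = ∑ j, v j • toVec (Pi.single j 1 : Lat d) := by
    funext k
    simp [toVec, Pi.single_apply, Finset.sum_apply]
  have h4 : v = σ.lin (∑ j, v j • x j) + (v ⬝ᵥ toVec σ.normal) • toVec w := by
    conv_lhs => rw [h3]
    rw [map_sum]
    simp only [hx, smul_add, Finset.sum_add_distrib, map_smul, smul_smul, ← Finset.sum_smul]
    congr 2
    simp only [single_one_dotProduct]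
    rfl
  rw [hv, zero_smul, add_zero] at h4
  exact h4.symm

theorem Facet.lin_injective (hΔ : IsReflexive Δ) (σ : Facet Δ) : Function.Injective σ.lin := by
  have h1 : LinearMap.range σ.lin = LinearMap.ker (dotLin (toVec σ.normal)) := by
    ext v
    simp only [LinearMap.mem_range, LinearMap.mem_ker, dotLin_apply]
    constructor
    · rintro ⟨x, rfl⟩
      rw [dotProduct_comm]; exact σ.lin_normal x
    · intro hv
      rw [dotProduct_comm] at hv
      exact σ.exists_lin hΔ hv
  have h2 := LinearMap.finrank_range_add_finrank_ker σ.lin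
  rw [h1, finrank_ker_dotLin σ.toVec_normal_ne_zero] at h2
  simp at h2
  exact LinearMap.ker_eq_bot.1 h2

theorem Facet.param_normal (hΔ : IsReflexive Δ) (σ : Facet Δ) (x : Fin d → ℝ) :
    σ.param x ⬝ᵥ toVec σ.normal = 1 := by
  rw [σ.param_eq, add_dotProduct, σ.lin_normal, add_zero]
  exact (σ.normal_spec hΔ).2 _ σ.nonempty.some_mem

theorem Facet.exists_param (hΔ : IsReflexive Δ) (σ : Facet Δ) {m : Vec d}
    (hm : m ⬝ᵥ toVec σ.normal = 1) : ∃ x, σ.param x = m := by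
  obtain ⟨x, hx⟩ := σ.exists_lin hΔ (v := m - σ.nonempty.some) (by
    rw [sub_dotProduct, hm, (σ.normal_spec hΔ).2 _ σ.nonempty.some_mem, sub_self])
  exact ⟨x, by rw [σ.param_eq, hx, add_sub_cancel]⟩

theorem Facet.continuous_param (σ : Facet Δ) : Continuous σ.param := by
  unfold Facet.param
  fun_prop

theorem Facet.param_injective (hΔ : IsReflexive Δ) (σ : Facet Δ) :
    Function.Injective σ.param := fun x y hxy => by
  rw [σ.param_eq, σ.param_eq] at hxy
  exact σ.lin_injective hΔ (add_left_cancel hxy)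

theorem Facet.measurableEmbedding_param (hΔ : IsReflexive Δ) (σ : Facet Δ) :
    MeasurableEmbedding σ.param := σ.continuous_param.measurableEmbedding (σ.param_injective hΔ)

/-- Points with equal coordinates differ by a multiple of the normal. -/
theorem Facet.eq_add_smul_of_chart_eq (hΔ : IsReflexive Δ) (σ : Facet Δ) {n n' : Vec d}
    (hc : σ.chart n = σ.chart n') : ∃ t : ℝ, n' = n + t • toVec σ.normal := by
  obtain ⟨t, ht⟩ := eq_smul_of_ker_le (u := toVec σ.normal) (w := n' - n)
    σ.toVec_normal_ne_zero (fun v hv => by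
      rw [dotProduct_comm] at hv
      obtain ⟨x, rfl⟩ := σ.exists_lin hΔ hv
      rw [dotProduct_comm, dotProduct_sub, σ.lin_dotProduct, σ.lin_dotProduct, hc, sub_self])
  exact ⟨t, by rw [← ht, add_sub_cancel]⟩

/-- Points with the same coordinates differ by `t n_σ`, and lattice points of `σ` pair to one with
`n_σ`. The inequality of a point active at `n`, tested at `n'`, gives `t ≤ 0`; exchanging the roles
gives `t ≥ 0`. -/
theorem Facet.chart_injOn (hΔ : IsReflexive Δ) (σ : Facet Δ) :
    InjOn σ.chart (chartDomain Δ h σ) := by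
  intro n hn n' hn' hc
  obtain ⟨t, rfl⟩ := σ.eq_add_smul_of_chart_eq hΔ hc
  simp only [chartDomain, mem_iUnion, mem_ofPred_eq] at hn hn'
  obtain ⟨m, hm, hmn⟩ := hn
  obtain ⟨m', hm', hmn'⟩ := hn'
  have h1 := hmn'.1 m hm.1
  have h2 := hmn.1 m' hm'.1
  have h3 := hmn'.2
  rw [dotProduct_add, dotProduct_smul, (σ.normal_spec hΔ).2 _ hm, hmn.2, smul_eq_mul] at h1
  rw [dotProduct_add, dotProduct_smul, (σ.normal_spec hΔ).2 _ hm', smul_eq_mul] at h3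
  have : t = 0 := by linarith
  rw [this, zero_smul, add_zero]

end

section

variable {d : ℕ} {Δ : Set (Vec d)} {h : Lat d → ℤ}

/-! ### The `c`-transforms -/

theorem abs_dotProduct_le (x y : Vec d) : |x ⬝ᵥ y| ≤ (d + 1) * ‖x‖ * ‖y‖ := by
  calc |x ⬝ᵥ y| ≤ ∑ i, |x i * y i| := Finset.abs_sum_le_sum_abs _ _
    _ ≤ ∑ _i : Fin (d + 1), ‖x‖ * ‖y‖ := by
        refine Finset.sum_le_sum fun i _ => ?_
        rw [abs_mul]
        exact mul_le_mul (norm_le_pi_norm x i) (norm_le_pi_norm y i) (abs_nonneg _)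
          (norm_nonneg _)
    _ = (d + 1) * ‖x‖ * ‖y‖ := by simp; ring

/-- Suprema of affine functions with bounded slopes are Lipschitz. -/
theorem lipschitz_of_ciSup_dotProduct {K : Set (Vec d)} {R : ℝ} (hR : 0 ≤ R)
    (hK : ∀ x ∈ K, ‖x‖ ≤ R) {f g : Vec d → ℝ} (hle : ∀ y, ∀ x ∈ K, x ⬝ᵥ y - f x ≤ g y)
    (hge : ∀ y (r : ℝ), (∀ x ∈ K, x ⬝ᵥ y - f x ≤ r) → g y ≤ r) :
    LipschitzWith (((d : ℝ) + 1) * R).toNNReal g := by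
  refine LipschitzWith.of_le_add_mul _ fun y y' => hge y _ fun x hx => ?_
  have h1 := hle y' x hx
  have h2 : x ⬝ᵥ y - x ⬝ᵥ y' ≤ (d + 1) * R * dist y y' := by
    rw [← dotProduct_sub, dist_eq_norm]
    refine (le_abs_self _).trans ((abs_dotProduct_le _ _).trans ?_)
    gcongr
    exact hK x hx
  rw [Real.coe_toNNReal _ (by positivity)]
  linarith

section TransB

variable {Ψ : Vec d → ℝ}

theorem le_cTransB (hΔ : IsReflexive Δ) (hΨ : ContinuousOn Ψ (bdB Δ h)) (m : Vec d) {n : Vec d}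
    (hn : n ∈ bdB Δ h) : m ⬝ᵥ n - Ψ n ≤ cTransB Δ h Ψ m := by
  have hc : ContinuousOn (fun n => m ⬝ᵥ n - Ψ n) (bdB Δ h) :=
    (continuous_dotProduct_right m).continuousOn.sub hΨ
  obtain ⟨C, hC⟩ := ((isCompact_bdB hΔ).image_of_continuousOn hc).bddAbove
  exact le_ciSup (f := fun n : bdB Δ h => m ⬝ᵥ n.1 - Ψ n.1)
    ⟨C, by rintro _ ⟨n, rfl⟩; exact hC ⟨n, n.2, rfl⟩⟩ ⟨n, hn⟩

theorem cTransB_le (hΔ : IsReflexive Δ) (hh : IsHeight Δ h) {m : Vec d} {r : ℝ}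
    (hr : ∀ n ∈ bdB Δ h, m ⬝ᵥ n - Ψ n ≤ r) : cTransB Δ h Ψ m ≤ r := by
  have : Nonempty (bdB Δ h) := (bdB_nonempty hΔ hh).to_subtype
  exact ciSup_le fun n => hr n n.2

/-- The slopes range over the bounded set `B`. The Lipschitz property is what makes Rademacher's
theorem available for `Ψ^c` on the facets of `Δ`. -/
theorem exists_lipschitz_cTransB (hΔ : IsReflexive Δ) (hh : IsHeight Δ h) :
    ∃ K, ∀ Ψ : Vec d → ℝ, ContinuousOn Ψ (bdB Δ h) → LipschitzWith K (cTransB Δ h Ψ) := by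
  obtain ⟨R, hR⟩ := (isCompact_bdB (h := h) hΔ).isBounded.exists_norm_le
  obtain ⟨n₀, hn₀⟩ := bdB_nonempty hΔ hh
  refine ⟨_, fun Ψ hΨ => lipschitz_of_ciSup_dotProduct (f := Ψ)
    ((norm_nonneg _).trans (hR _ hn₀)) hR ?_ ?_⟩
  · intro m n hn
    rw [dotProduct_comm]
    exact le_cTransB hΔ hΨ m hn
  · intro m r hr
    refine cTransB_le hΔ hh fun n hn => ?_
    rw [dotProduct_comm]
    exact hr n hn

theorem continuous_cTransB (hΔ : IsReflexive Δ) (hh : IsHeight Δ h)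
    (hΨ : ContinuousOn Ψ (bdB Δ h)) : Continuous (cTransB Δ h Ψ) := by
  obtain ⟨K, hK⟩ := exists_lipschitz_cTransB hΔ hh
  exact (hK Ψ hΨ).continuous

end TransB

section TransA

variable {Φ : Vec d → ℝ}

theorem le_cTransA (hΔ : IsReflexive Δ) (hΦ : ContinuousOn Φ (bdA Δ)) {m : Vec d} (n : Vec d)
    (hm : m ∈ bdA Δ) : m ⬝ᵥ n - Φ m ≤ cTransA Δ Φ n := by
  have hc : ContinuousOn (fun m => m ⬝ᵥ n - Φ m) (bdA Δ) :=
    (continuous_dotProduct_left n).continuousOn.sub hΦ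
  obtain ⟨C, hC⟩ := (hΔ.isCompact_bdA.image_of_continuousOn hc).bddAbove
  exact le_ciSup (f := fun m : bdA Δ => m.1 ⬝ᵥ n - Φ m.1)
    ⟨C, by rintro _ ⟨m, rfl⟩; exact hC ⟨m, m.2, rfl⟩⟩ ⟨m, hm⟩

theorem cTransA_le (hΔ : IsReflexive Δ) {n : Vec d} {r : ℝ}
    (hr : ∀ m ∈ bdA Δ, m ⬝ᵥ n - Φ m ≤ r) : cTransA Δ Φ n ≤ r := by
  have : Nonempty (bdA Δ) := (bdA_nonempty hΔ).to_subtype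
  exact ciSup_le fun m => hr m m.2

theorem exists_cTransA (hΔ : IsReflexive Δ) (hΦ : ContinuousOn Φ (bdA Δ)) (n : Vec d) :
    ∃ m ∈ bdA Δ, cTransA Δ Φ n = m ⬝ᵥ n - Φ m := by
  have hc : ContinuousOn (fun m => m ⬝ᵥ n - Φ m) (bdA Δ) :=
    (continuous_dotProduct_left n).continuousOn.sub hΦ
  obtain ⟨m, hm, hmax⟩ := hΔ.isCompact_bdA.exists_isMaxOn (bdA_nonempty hΔ) hc
  exact ⟨m, hm, le_antisymm (cTransA_le hΔ fun m' hm' => hmax hm') (le_cTransA hΔ hΦ n hm)⟩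

/-- The constant depends only on `A`; its uniformity in `Φ` supplies the equicontinuity in the
existence proof for potentials. -/
theorem exists_lipschitz_cTransA (hΔ : IsReflexive Δ) :
    ∃ K, ∀ Φ : Vec d → ℝ, ContinuousOn Φ (bdA Δ) → LipschitzWith K (cTransA Δ Φ) := by
  obtain ⟨R, hR⟩ := hΔ.isCompact_bdA.isBounded.exists_norm_le
  obtain ⟨m₀, hm₀⟩ := bdA_nonempty hΔ
  exact ⟨_, fun Φ hΦ => lipschitz_of_ciSup_dotProduct (f := Φ)
    ((norm_nonneg _).trans (hR _ hm₀)) hR (fun n m hm => le_cTransA hΔ hΦ n hm)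
    fun n r hr => cTransA_le hΔ hr⟩

theorem continuous_cTransA (hΔ : IsReflexive Δ) (hΦ : ContinuousOn Φ (bdA Δ)) :
    Continuous (cTransA Δ Φ) := by
  obtain ⟨K, hK⟩ := exists_lipschitz_cTransA hΔ
  exact (hK Φ hΦ).continuous

theorem convexOn_cTransA (hΔ : IsReflexive Δ) (hΦ : ContinuousOn Φ (bdA Δ)) :
    ConvexOn ℝ univ (cTransA Δ Φ) := by
  refine ⟨convex_univ, fun x _ y _ a b ha hb hab => cTransA_le hΔ fun m hm => ?_⟩
  have h1 := mul_le_mul_of_nonneg_left (le_cTransA hΔ hΦ x hm) ha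
  have h2 := mul_le_mul_of_nonneg_left (le_cTransA hΔ hΦ y hm) hb
  rw [dotProduct_add, dotProduct_smul, dotProduct_smul]
  simp only [smul_eq_mul]
  have h3 : Φ m = a * Φ m + b * Φ m := by rw [← add_mul, hab, one_mul]
  linarith

end TransA

/-- The support function in the definition of `𝒫(Δ)` dominates all pairings. -/
theorem dotProduct_le_iSup (hΔ : IsReflexive Δ) {m : Vec d} (hm : m ∈ Δ) (n : Vec d) :
    m ⬝ᵥ n ≤ ⨆ m : {m : Lat d // toVec m ∈ Δ}, toVec m.1 ⬝ᵥ n := by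
  have : Finite {m : Lat d // toVec m ∈ Δ} := hΔ.finite_lattice
  obtain ⟨v, hv, hle⟩ := hΔ.isLatticePolytope.exists_lattice_ge n hm
  rw [dotProduct_comm n, dotProduct_comm n] at hle
  exact hle.trans (le_ciSup (f := fun m : {m : Lat d // toVec m ∈ Δ} => toVec m.1 ⬝ᵥ n)
    (Set.finite_range _).bddAbove ⟨v, hv⟩)

theorem inP_cTransA (hΔ : IsReflexive Δ) {Φ : Vec d → ℝ} (hΦ : ContinuousOn Φ (bdA Δ)) :
    InP Δ (cTransA Δ Φ) := by
  refine ⟨convexOn_cTransA hΔ hΦ, ?_⟩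
  obtain ⟨C, hC⟩ := (hΔ.isCompact_bdA.image_of_continuousOn hΦ).isBounded.exists_norm_le
  have hC' : ∀ m ∈ bdA Δ, |Φ m| ≤ C := fun m hm => hC _ ⟨m, hm, rfl⟩
  refine ⟨C, fun n => abs_le.2 ⟨?_, ?_⟩⟩
  · have : Nonempty {m : Lat d // toVec m ∈ Δ} := ⟨⟨0, by simpa using hΔ.zero_mem⟩⟩
    suffices (⨆ m : {m : Lat d // toVec m ∈ Δ}, toVec m.1 ⬝ᵥ n) ≤ cTransA Δ Φ n + C by linarith
    refine ciSup_le fun m => ?_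
    -- Lattice points of `Δ` need not lie on `A` (the origin does not). Walking from one in the
    -- direction `n` reaches `A` without decreasing the pairing with `n`.
    obtain ⟨m', hm', hle⟩ : ∃ m' ∈ bdA Δ, toVec m.1 ⬝ᵥ n ≤ m' ⬝ᵥ n := by
      by_cases hn : n = 0
      · obtain ⟨m₀, hm₀⟩ := bdA_nonempty hΔ
        exact ⟨m₀, hm₀, by simp [hn]⟩
      · obtain ⟨t, ht, hA, _⟩ := hΔ.exists_exit m.2 hn
        refine ⟨_, hA, ?_⟩
        rw [add_dotProduct, smul_dotProduct, smul_eq_mul]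
        have := mul_nonneg ht (dotProduct_self_pos_of_ne_zero hn).le
        linarith
    have h1 := le_cTransA hΔ hΦ n hm'
    have h2 := (abs_le.1 (hC' m' hm')).2
    linarith
  · suffices cTransA Δ Φ n ≤ (⨆ m : {m : Lat d // toVec m ∈ Δ}, toVec m.1 ⬝ᵥ n) + C by linarith
    refine cTransA_le hΔ fun m hm => ?_
    have h1 := dotProduct_le_iSup hΔ (hΔ.bdA_subset hm) n
    have h2 := (abs_le.1 (hC' m hm)).1
    linarith

/-! ### Elements of `𝒫(Δ)`: slopes of affine minorants and `c`-convexity -/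

namespace InP

variable {Ψ : Vec d → ℝ}

theorem continuous (hΨ : InP Δ Ψ) : Continuous Ψ := by
  rw [← continuousOn_univ]
  exact hΨ.1.continuousOn isOpen_univ

/-- The slopes of the affine minorants of elements of `𝒫(Δ)` lie in `Δ`. -/
theorem slope_mem (hΔ : IsReflexive Δ) (hΨ : InP Δ Ψ) {w : Vec d} {c : ℝ}
    (hw : ∀ n, w ⬝ᵥ n + c ≤ Ψ n) : w ∈ Δ := by
  obtain ⟨_, C, hC⟩ := hΨ
  rw [hΔ.mem_iff]
  intro s hs
  by_contra! hcon
  have : Nonempty {m : Lat d // toVec m ∈ Δ} := ⟨⟨0, by simpa using hΔ.zero_mem⟩⟩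
  have key : ∀ t : ℝ, 0 ≤ t → t * (w ⬝ᵥ toVec s) + c ≤ C + t := by
    intro t ht
    have h1 := hw (t • toVec s)
    have h2 := (abs_le.1 (hC (t • toVec s))).2
    have h3 : (⨆ m : {m : Lat d // toVec m ∈ Δ}, toVec m.1 ⬝ᵥ (t • toVec s)) ≤ t := by
      refine ciSup_le fun m => ?_
      rw [dotProduct_smul, smul_eq_mul]
      have := mul_le_mul_of_nonneg_left (hΔ.pairing_le m.2 hs) ht
      linarith
    rw [dotProduct_smul, smul_eq_mul] at h1
    linarith
  -- `key` bounds `t (⟨w, s⟩ - 1)` by `C - c`; this `t` makes that product equal to `|C - c| + 1`.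
  have h4 := key ((|C - c| + 1) / (w ⬝ᵥ toVec s - 1)) (by
    have : 0 < w ⬝ᵥ toVec s - 1 := by linarith
    positivity)
  have h5 : (|C - c| + 1) / (w ⬝ᵥ toVec s - 1) * (w ⬝ᵥ toVec s - 1) = |C - c| + 1 :=
    div_mul_cancel₀ _ (by linarith)
  have h6 := le_abs_self (C - c)
  linarith

/-- Affine minorants of `Ψ` that are nearly sharp at `n` have slopes in `Δ`, but perhaps not on `A`.
Adding `t (⟨m, ·⟩ - h(m))` with `t ≥ 0` and `m` active at `n` moves the slope to `A`, lowers the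
function on `B` and leaves its value at `n` unchanged. -/
theorem isCConvex (hΔ : IsReflexive Δ) (hh : IsHeight Δ h) (hΨ : InP Δ Ψ) :
    IsCConvex Δ h Ψ := by
  have hc : ContinuousOn Ψ (bdB Δ h) := hΨ.continuous.continuousOn
  have hΦ := (continuous_cTransB hΔ hh hc).continuousOn (s := bdA Δ)
  refine ⟨hc, fun n hn => le_antisymm (cTransA_le hΔ fun m hm => ?_) ?_⟩
  · have := le_cTransB hΔ hc m hn
    linarith
  · refine le_of_forall_lt_imp_le_of_dense fun a ha => ?_
    obtain ⟨l, c, hlc, hla⟩ := ConvexOn.exists_affine_le_of_lt (𝕜 := ℝ) (mem_univ n) ha isClosed_univ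
      (hΨ.continuous.lowerSemicontinuous.lowerSemicontinuousOn _) hΨ.1
    obtain ⟨w, hw⟩ := exists_eq_dotProduct l
    have hmin : ∀ n', w ⬝ᵥ n' + c ≤ Ψ n' := fun n' => by
      have := hlc ⟨n', mem_univ _⟩
      simpa [hw] using this
    have hwa : w ⬝ᵥ n + c = a := by simpa [hw] using hla
    obtain ⟨hnD, m, hm, hmn⟩ := (mem_bdB_iff hΔ hh).1 hn
    obtain ⟨t, ht, hA, _⟩ := hΔ.exists_exit (hΨ.slope_mem hΔ hmin) (hΔ.ne_zero_of_mem_bdA hm)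
    have h1 : cTransB Δ h Ψ (w + t • toVec m) ≤ -c + t * h m := by
      refine cTransB_le hΔ hh fun n' hn' => ?_
      rw [add_dotProduct, smul_dotProduct, smul_eq_mul]
      have h2 := hmin n'
      have h3 := mul_le_mul_of_nonneg_left (bdB_subset hn' m (hΔ.bdA_subset hm)) ht
      linarith
    have h4 := le_cTransA hΔ hΦ n hA
    rw [add_dotProduct, smul_dotProduct, smul_eq_mul, hmn] at h4
    linarith

end InP

/-! ### The contact set -/

/-- The pairs of points at which the Young inequality between `Ψ` and `Ψ^c` is an equality. -/
def contact (Δ : Set (Vec d)) (h : Lat d → ℤ) (Ψ : Vec d → ℝ) : Set (Vec d × Vec d) :=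
  {p | p.1 ∈ bdA Δ ∧ p.2 ∈ bdB Δ h ∧ cTransB Δ h Ψ p.1 + Ψ p.2 = p.1 ⬝ᵥ p.2}

section Contact

variable {Ψ : Vec d → ℝ}

theorem isCompact_contact (hΔ : IsReflexive Δ) (hh : IsHeight Δ h)
    (hΨ : ContinuousOn Ψ (bdB Δ h)) : IsCompact (contact Δ h Ψ) := by
  have hK : IsCompact (bdA Δ ×ˢ bdB Δ h) := hΔ.isCompact_bdA.prod (isCompact_bdB hΔ)
  have hc : ContinuousOn (fun p : Vec d × Vec d => cTransB Δ h Ψ p.1 + Ψ p.2 - p.1 ⬝ᵥ p.2)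
      (bdA Δ ×ˢ bdB Δ h) := by
    refine (((continuous_cTransB hΔ hh hΨ).comp continuous_fst).continuousOn.add
      (hΨ.comp continuousOn_snd fun p hp => hp.2)).sub ?_
    exact (continuous_fst.dotProduct continuous_snd).continuousOn
  have : contact Δ h Ψ = (bdA Δ ×ˢ bdB Δ h) ∩
      (fun p : Vec d × Vec d => cTransB Δ h Ψ p.1 + Ψ p.2 - p.1 ⬝ᵥ p.2) ⁻¹' {0} := by
    ext p
    simp only [contact, mem_ofPred_eq, mem_inter_iff, mem_prod, mem_preimage, mem_singleton_iff,
      sub_eq_zero, and_assoc]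
  rw [this]
  exact hK.of_isClosed_subset (hc.preimage_isClosed_of_isClosed hK.isClosed isClosed_singleton)
    inter_subset_left

theorem exists_contact_left (hΔ : IsReflexive Δ) (hh : IsHeight Δ h)
    (hΨ : IsCConvex Δ h Ψ) {n : Vec d} (hn : n ∈ bdB Δ h) : ∃ m, (m, n) ∈ contact Δ h Ψ := by
  obtain ⟨m, hm, h1⟩ := exists_cTransA hΔ (continuous_cTransB hΔ hh hΨ.1).continuousOn n
  refine ⟨m, hm, hn, ?_⟩
  rw [hΨ.2 n hn] at h1
  simp only [h1]
  ring

/-- A point `n` is a `c`-subgradient of `Ψ^c` at `m` when `m` maximizes `⟨·, n⟩ - Ψ^c` over `A`. By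
`c`-convexity that maximum is `Ψ(n)`, which is equality in Young's inequality. -/
theorem mem_cGradA_iff (hΔ : IsReflexive Δ) (hh : IsHeight Δ h) (hΨ : IsCConvex Δ h Ψ)
    {m n : Vec d} (hm : m ∈ bdA Δ) :
    n ∈ cGradA Δ h (cTransB Δ h Ψ) m ↔ (m, n) ∈ contact Δ h Ψ := by
  have hΦ := (continuous_cTransB hΔ hh hΨ.1).continuousOn (s := bdA Δ)
  constructor
  · rintro ⟨hn, h1⟩
    refine ⟨hm, hn, ?_⟩
    obtain ⟨m', hm', _, h2⟩ := exists_contact_left hΔ hh hΨ hn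
    have h3 := h1 m' hm'
    have h4 := le_cTransB hΔ hΨ.1 m hn
    rw [sub_dotProduct] at h3
    simp only at h2 ⊢
    linarith
  · rintro ⟨_, hn, h1⟩
    refine ⟨hn, fun m' _ => ?_⟩
    have h4 := le_cTransB hΔ hΨ.1 m' hn
    rw [sub_dotProduct]
    simp only at h1
    linarith

/-- The contact set is stable under moving in the direction of an active lattice point. -/
theorem contact_add_smul (hΔ : IsReflexive Δ) (hh : IsHeight Δ h) (hΨ : ContinuousOn Ψ (bdB Δ h))
    {m₀ n : Vec d} (hc : cTransB Δ h Ψ m₀ + Ψ n = m₀ ⬝ᵥ n) (hn : n ∈ bdB Δ h) {m : Lat d}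
    (hm : toVec m ∈ bdA Δ) (hmn : toVec m ⬝ᵥ n = h m) {t : ℝ} (ht : 0 ≤ t)
    (hA : m₀ + t • toVec m ∈ bdA Δ) : (m₀ + t • toVec m, n) ∈ contact Δ h Ψ := by
  refine ⟨hA, hn, le_antisymm ?_ ?_⟩
  · have h1 : cTransB Δ h Ψ (m₀ + t • toVec m) ≤ cTransB Δ h Ψ m₀ + t * h m := by
      refine cTransB_le hΔ hh fun n' hn' => ?_
      have h2 := le_cTransB hΔ hΨ m₀ hn'
      have h3 := mul_le_mul_of_nonneg_left (bdB_subset hn' m (hΔ.bdA_subset hm)) ht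
      rw [add_dotProduct, smul_dotProduct, smul_eq_mul]
      linarith
    simp only
    rw [add_dotProduct, smul_dotProduct, smul_eq_mul, hmn]
    linarith
  · have := le_cTransB hΔ hΨ (m₀ + t • toVec m) hn
    simp only
    linarith

theorem mem_chartSet_iff (hΔ : IsReflexive Δ) (hh : IsHeight Δ h) (hΨ : IsCConvex Δ h Ψ)
    (σ : Facet Δ) {n : Vec d} :
    n ∈ chartSet Δ h Ψ σ ↔ n ∈ bdB Δ h ∧ ∀ m, (m, n) ∈ contact Δ h Ψ → m ∈ σ.relint := by
  unfold chartSet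
  simp only [Set.mem_sdiff, mem_iUnion, not_exists]
  refine and_congr_right fun hn => ⟨fun h1 m hm => ?_, fun h1 m hm h2 => ?_⟩
  · by_contra hmσ
    exact h1 m ⟨hm.1, hmσ⟩ ((mem_cGradA_iff hΔ hh hΨ hm.1).2 hm)
  · exact hm.2 (h1 m ((mem_cGradA_iff hΔ hh hΨ hm.1).1 h2))

/-- All lattice points that are active at a point of a chart lie on the facet of the chart. -/
theorem mem_carrier_of_mem_chartSet (hΔ : IsReflexive Δ) (hh : IsHeight Δ h)
    (hΨ : IsCConvex Δ h Ψ) {σ : Facet Δ} {n : Vec d} (hn : n ∈ chartSet Δ h Ψ σ) {m : Lat d}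
    (hm : toVec m ∈ bdA Δ) (hmn : toVec m ⬝ᵥ n = h m) : toVec m ∈ σ.carrier := by
  obtain ⟨hnB, h1⟩ := (mem_chartSet_iff hΔ hh hΨ σ).1 hn
  obtain ⟨m₀, hm₀⟩ := exists_contact_left hΔ hh hΨ hnB
  -- Push a contact point along `m` until it leaves `Δ`. The exit point is still in contact with
  -- `n`, so it lies in `σ°`; hence the blocking inequality is that of `σ`, and `m` pairs to one
  -- with it.
  obtain ⟨t, ht, hA, s, hs, hs1, hpos⟩ :=
    hΔ.exists_exit (hΔ.bdA_subset hm₀.1) (hΔ.ne_zero_of_mem_bdA hm)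
  have h2 := h1 _ (contact_add_smul hΔ hh hΨ.1 hm₀.2.2 hnB hm hmn ht hA)
  have h3 := ((σ.mem_relint hΔ).1 h2).2.2 s hs hs1
  subst h3
  exact (σ.mem_carrier_iff hΔ).2 ⟨hΔ.bdA_subset hm,
    hΔ.lattice_pairing_eq_one (hΔ.bdA_subset hm) hs hpos⟩

/-- The complement in `B` is the projection of the compact set of contacts whose first component is
outside `σ°`. -/
theorem exists_isOpen_chartSet (hΔ : IsReflexive Δ) (hh : IsHeight Δ h) (hΨ : IsCConvex Δ h Ψ)
    (σ : Facet Δ) : ∃ O : Set (Vec d), IsOpen O ∧ chartSet Δ h Ψ σ = O ∩ bdB Δ h := by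
  obtain ⟨O, hO, hσ⟩ := σ.exists_isOpen_relint hΔ
  have hK : IsCompact (contact Δ h Ψ ∩ Prod.fst ⁻¹' Oᶜ) :=
    (isCompact_contact hΔ hh hΨ.1).inter_right (hO.isClosed_compl.preimage continuous_fst)
  refine ⟨(Prod.snd '' (contact Δ h Ψ ∩ Prod.fst ⁻¹' Oᶜ))ᶜ,
    (hK.image continuous_snd).isClosed.isOpen_compl, ?_⟩
  ext n
  rw [mem_chartSet_iff hΔ hh hΨ, and_comm]
  refine and_congr_left fun hn => ⟨?_, fun h1 m hm => ?_⟩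
  · rintro h1 ⟨⟨m, n'⟩, ⟨h2, h3⟩, rfl⟩
    have h4 := h1 m h2
    rw [hσ] at h4
    exact h3 h4.1
  · rw [hσ]
    refine ⟨?_, hm.1⟩
    by_contra hmO
    exact h1 ⟨(m, n), ⟨hm, hmO⟩, rfl⟩

theorem isChartCollection_chartSet (hΔ : IsReflexive Δ) (hh : IsHeight Δ h)
    (hΨ : IsCConvex Δ h Ψ) : IsChartCollection Δ h (chartSet Δ h Ψ) where
  subset_domain σ n hn := by
    obtain ⟨hD, m, hm, hmn⟩ := (mem_bdB_iff hΔ hh).1 hn.1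
    exact mem_biUnion (mem_carrier_of_mem_chartSet hΔ hh hΨ hn hm hmn) ⟨hD, hmn⟩
  isOpen σ := exists_isOpen_chartSet hΔ hh hΨ σ
  disjoint σ σ' hne := by
    refine Set.disjoint_left.2 fun n hn hn' => ?_
    obtain ⟨hnB, h1⟩ := (mem_chartSet_iff hΔ hh hΨ σ).1 hn
    obtain ⟨_, h1'⟩ := (mem_chartSet_iff hΔ hh hΨ σ').1 hn'
    obtain ⟨m, hm⟩ := exists_contact_left hΔ hh hΨ hnB
    exact hne ((Facet.eq_of_mem_relint hΔ (h1' m hm) (σ.relint_subset (h1 m hm))))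

end Contact

end

section

variable {d : ℕ} {Δ : Set (Vec d)} {h : Lat d → ℤ}

/-! ### The measure on the boundary -/

/-- Valid for arbitrary `S`, because the parametrizations are measurable embeddings and the open
facets are measurable. This matters because stable images are only known to be null measurable. -/
theorem muM_apply (hΔ : IsReflexive Δ) (S : Set (Vec d)) :
    muM Δ S = ∑' σ : Facet Δ, volume (σ.param ⁻¹' (S ∩ σ.relint)) := by
  have := Facet.finite hΔ
  unfold muM
  rw [Measure.sum_apply_of_countable]
  refine tsum_congr fun σ => ?_
  rw [Measure.restrict_apply' (σ.measurableSet_relint hΔ),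
    (σ.measurableEmbedding_param hΔ).map_apply]

theorem Facet.isOpen_preimage_relint (hΔ : IsReflexive Δ) (σ : Facet Δ) :
    IsOpen (σ.param ⁻¹' σ.relint) := by
  rw [isOpen_iff_mem_nhds]
  intro x hx
  have h1 := (σ.continuous_param.tendsto x).eventually
    (eventually_eventually_nhds.2 (σ.mem_relint_iff.1 hx).2)
  have hn : ∀ y, toVec σ.normal ⬝ᵥ σ.param y = toVec σ.normal ⬝ᵥ σ.param x := fun y => by
    rw [dotProduct_comm, σ.param_normal hΔ, dotProduct_comm, σ.param_normal hΔ]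
  filter_upwards [h1] with y hy
  refine σ.mem_relint_iff.2 ⟨hy.self_of_nhds (hn y), hy.mono fun z hz hzn => hz (hzn.trans (hn y))⟩

theorem Facet.isCompact_preimage_carrier (hΔ : IsReflexive Δ) (σ : Facet Δ) :
    IsCompact (σ.param ⁻¹' σ.carrier) := by
  have h1 : Topology.IsClosedEmbedding σ.lin :=
    LinearMap.isClosedEmbedding_of_injective (LinearMap.ker_eq_bot.2 (σ.lin_injective hΔ))
  have h2 : Topology.IsClosedEmbedding σ.param :=
    (Homeomorph.addLeft σ.nonempty.some).isClosedEmbedding.comp h1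
  exact h2.isCompact_preimage (σ.isCompact_carrier hΔ)

theorem isFiniteMeasure_muM (hΔ : IsReflexive Δ) : IsFiniteMeasure (muM Δ) := by
  have := Facet.finite hΔ
  have := Fintype.ofFinite (Facet Δ)
  refine ⟨?_⟩
  rw [muM_apply hΔ, tsum_fintype, ENNReal.sum_lt_top]
  intro σ _
  refine (measure_mono ?_).trans_lt (σ.isCompact_preimage_carrier hΔ).measure_lt_top
  exact preimage_mono (inter_subset_right.trans σ.relint_subset)

theorem muM_eq_zero_iff (hΔ : IsReflexive Δ) {S : Set (Vec d)} :
    muM Δ S = 0 ↔ ∀ σ : Facet Δ, volume (σ.param ⁻¹' (S ∩ σ.relint)) = 0 := by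
  rw [muM_apply hΔ, ENNReal.tsum_eq_zero]

theorem muM_compl_bdA (hΔ : IsReflexive Δ) : muM Δ (bdA Δ)ᶜ = 0 := by
  rw [muM_eq_zero_iff hΔ]
  intro σ
  have : (bdA Δ)ᶜ ∩ σ.relint = ∅ := by
    rw [eq_empty_iff_forall_notMem]
    rintro m ⟨h1, h2⟩
    exact h1 (σ.relint_subset_bdA hΔ h2)
  rw [this, preimage_empty, measure_empty]

theorem ae_muM_iff (hΔ : IsReflexive Δ) {p : Vec d → Prop} :
    (∀ᵐ m ∂muM Δ, p m) ↔ ∀ σ : Facet Δ, ∀ᵐ x : Fin d → ℝ, σ.param x ∈ σ.relint → p (σ.param x) := by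
  rw [ae_iff, muM_eq_zero_iff hΔ]
  refine forall_congr' fun σ => ?_
  rw [ae_iff]
  refine Eq.congr (congrArg _ ?_) rfl
  ext x
  simp only [mem_preimage, mem_inter_iff, mem_ofPred_eq]
  tauto

/-- Relatively open nonempty subsets of the boundary have positive measure. -/
theorem muM_pos (hΔ : IsReflexive Δ) {m : Vec d} (hm : m ∈ bdA Δ) {W : Set (Vec d)}
    (hW : W ∈ 𝓝 m) : 0 < muM Δ W := by
  obtain ⟨V, hVW, hV, hmV⟩ := mem_nhds_iff.1 hW
  obtain ⟨σ, m', hm'V, hm'⟩ := hΔ.exists_relint_near hm (hV.mem_nhds hmV)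
  have hpos : 0 < volume (σ.param ⁻¹' (V ∩ σ.relint)) := by
    refine IsOpen.measure_pos _ ?_ ?_
    · rw [preimage_inter]
      exact (hV.preimage σ.continuous_param).inter (σ.isOpen_preimage_relint hΔ)
    · obtain ⟨x, rfl⟩ := σ.exists_param hΔ ((σ.mem_relint hΔ).1 hm').2.1
      exact ⟨x, hm'V, hm'⟩
  refine lt_of_lt_of_le ?_ (measure_mono hVW)
  rw [muM_apply hΔ]
  exact hpos.trans_le (ENNReal.le_tsum σ)

theorem muM_bdA (hΔ : IsReflexive Δ) : muM Δ (bdA Δ) = muM Δ univ := by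
  refine le_antisymm (measure_mono (subset_univ _)) ?_
  have := measure_union_le (μ := muM Δ) (bdA Δ) (bdA Δ)ᶜ
  rwa [union_compl_self, muM_compl_bdA hΔ, add_zero] at this

/-! ### The stable part of the contact set -/

theorem isClosed_closedStar (hΔ : IsReflexive Δ) (m : Vec d) : IsClosed (closedStar Δ m) := by
  by_cases hm : m ∈ Δ
  · have : closedStar Δ m = ⋃ s ∈ {s ∈ dualLat Δ | m ⬝ᵥ toVec s = 1},
        Δ ∩ {x | x ⬝ᵥ toVec s = 1} := by
      ext x
      rw [hΔ.mem_closedStar_iff]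
      simp only [mem_ofPred_eq, mem_iUnion, mem_inter_iff, exists_prop]
      constructor
      · rintro ⟨_, h1, s, hs, h2, h3⟩
        exact ⟨s, ⟨hs, h2⟩, h1, h3⟩
      · rintro ⟨s, ⟨hs, h2⟩, h1, h3⟩
        exact ⟨hm, h1, s, hs, h2, h3⟩
    rw [this]
    exact (hΔ.finite_dualLat.subset fun s hs => hs.1).isClosed_biUnion fun s _ =>
      hΔ.isClosed.inter (isClosed_eq (by fun_prop) continuous_const)
  · have : closedStar Δ m = ∅ := by
      rw [eq_empty_iff_forall_notMem]
      intro x hx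
      exact hm (hΔ.mem_closedStar_iff.1 hx).1
    rw [this]
    exact isClosed_empty

theorem isClosed_dualFace (m : Lat d) : IsClosed (dualFace Δ h m) :=
  isClosed_dualH.inter (isClosed_eq (by fun_prop) continuous_const)

theorem isClosed_stableSet (hΔ : IsReflexive Δ) : IsClosed (stableSet Δ h) :=
  (hΔ.finite_lattice.subset fun _ hm => hΔ.bdA_subset hm).isClosed_biUnion fun m _ =>
    (isClosed_closedStar hΔ _).prod (isClosed_dualFace m)

theorem mem_stableSet_iff {p : Vec d × Vec d} : p ∈ stableSet Δ h ↔
    ∃ m : Lat d, toVec m ∈ bdA Δ ∧ p.1 ∈ closedStar Δ (toVec m) ∧ p.2 ∈ dualFace Δ h m := by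
  simp only [stableSet, mem_iUnion, mem_ofPred_eq, exists_prop, mem_prod]

/-- Over the relative interior of a facet, the stable pairs are those in the chart domain. -/
theorem mem_stableSet_iff_of_relint (hΔ : IsReflexive Δ) {σ : Facet Δ} {m n : Vec d}
    (hm : m ∈ σ.relint) : (m, n) ∈ stableSet Δ h ↔ n ∈ chartDomain Δ h σ := by
  rw [mem_stableSet_iff]
  simp only [chartDomain, mem_iUnion, mem_ofPred_eq, exists_prop]
  refine exists_congr fun m' => ?_
  constructor
  · rintro ⟨hm', hst, hn⟩
    obtain ⟨h1, _, s, hs, h2, h3⟩ := hΔ.mem_closedStar_iff.1 hst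
    have := ((σ.mem_relint hΔ).1 hm).2.2 s hs h3
    subst this
    exact ⟨(σ.mem_carrier_iff hΔ).2 ⟨h1, h2⟩, hn⟩
  · rintro ⟨hm', hn⟩
    obtain ⟨h1, h2⟩ := (σ.mem_carrier_iff hΔ).1 hm'
    obtain ⟨h3, h4, _⟩ := (σ.mem_relint hΔ).1 hm
    exact ⟨σ.carrier_subset_bdA hΔ hm',
      hΔ.mem_closedStar_iff.2 ⟨h1, h3, σ.normal, (σ.normal_spec hΔ).1, h2, h4⟩, hn⟩

/-- The pairs in the contact set that are stable. -/
def stableContact (Δ : Set (Vec d)) (h : Lat d → ℤ) (Ψ : Vec d → ℝ) : Set (Vec d × Vec d) :=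
  contact Δ h Ψ ∩ stableSet Δ h

/-- The points of `A` that are in stable contact with some point of `E`. -/
def stableImage (Δ : Set (Vec d)) (h : Lat d → ℤ) (Ψ : Vec d → ℝ) (E : Set (Vec d)) :
    Set (Vec d) :=
  {m | ∃ n ∈ E, (m, n) ∈ stableContact Δ h Ψ}

/-! ### Stable images: almost everywhere uniqueness, additivity and measurability -/

section Stable

variable {Ψ : Vec d → ℝ}

theorem isCompact_stableContact (hΔ : IsReflexive Δ) (hh : IsHeight Δ h)
    (hΨ : ContinuousOn Ψ (bdB Δ h)) : IsCompact (stableContact Δ h Ψ) :=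
  (isCompact_contact hΔ hh hΨ).inter_right (isClosed_stableSet hΔ)

/-- The contact set determines the derivative of `Ψ^c` along facets, hence almost all points are
in stable contact with at most one point. -/
theorem ae_stableContact_unique (hΔ : IsReflexive Δ) (hh : IsHeight Δ h)
    (hΨ : ContinuousOn Ψ (bdB Δ h)) : ∀ᵐ m ∂muM Δ, ∀ n n', (m, n) ∈ stableContact Δ h Ψ →
      (m, n') ∈ stableContact Δ h Ψ → n = n' := by
  rw [ae_muM_iff hΔ]
  intro σ
  obtain ⟨K, hK⟩ := exists_lipschitz_cTransB hΔ hh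
  have hlip : LipschitzWith (K * (1 * ‖LinearMap.toContinuousLinearMap σ.lin‖₊))
      (cTransB Δ h Ψ ∘ σ.param) := by
    refine (hK Ψ hΨ).comp ?_
    refine ((isometry_add_left σ.nonempty.some).lipschitz).comp ?_
    exact (LinearMap.toContinuousLinearMap σ.lin).lipschitz
  filter_upwards [hlip.ae_differentiableAt (μ := volume)] with x hx hrel n n' hn hn'
  refine σ.chart_injOn hΔ ((mem_stableSet_iff_of_relint hΔ hrel).1 hn.2)
    ((mem_stableSet_iff_of_relint hΔ hrel).1 hn'.2) ?_
  -- Young's inequality holds everywhere and is an equality at `σ.param x`, so `Ψ^c` minus the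
  -- pairing with `n` has a minimum there along the facet. The derivative, which exists for almost
  -- all `x` by Rademacher's theorem, must be `σ.chart n`.
  have key : ∀ n, (σ.param x, n) ∈ contact Δ h Ψ → ∀ y,
      fderiv ℝ (cTransB Δ h Ψ ∘ σ.param) x y = y ⬝ᵥ σ.chart n := by
    intro n hn y
    let ℓ : (Fin d → ℝ) →L[ℝ] ℝ :=
      LinearMap.toContinuousLinearMap ((dotLin n).comp σ.lin)
    have hℓ : ∀ y, ℓ y = y ⬝ᵥ σ.chart n := fun y => by
      show n ⬝ᵥ σ.lin y = _
      rw [dotProduct_comm, σ.lin_dotProduct]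
    have hmin : IsLocalMin (fun y => (cTransB Δ h Ψ ∘ σ.param) y - ℓ y) x := by
      refine Eventually.of_forall fun y => ?_
      have h1 := le_cTransB hΔ hΨ (σ.param y) hn.2.1
      have h2 := hn.2.2
      simp only [Function.comp, hℓ, ← σ.lin_dotProduct] at h2 ⊢
      simp only [σ.param_eq, add_dotProduct] at h1 h2 ⊢
      linarith
    have h3 := hmin.hasFDerivAt_eq_zero (hx.hasFDerivAt.sub ℓ.hasFDerivAt)
    rw [sub_eq_zero.1 h3, hℓ]
  funext i
  have h1 := (key n hn.1 (Pi.single i 1)).symm.trans (key n' hn'.1 (Pi.single i 1))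
  simpa using h1

/-- A point in both images has two distinct stable partners. -/
theorem stableImage_ae_disjoint (hΔ : IsReflexive Δ) (hh : IsHeight Δ h)
    (hΨ : ContinuousOn Ψ (bdB Δ h)) {E E' : Set (Vec d)} (hE : Disjoint E E') :
    muM Δ (stableImage Δ h Ψ E ∩ stableImage Δ h Ψ E') = 0 := by
  refine measure_mono_null ?_ (ae_iff.1 (ae_stableContact_unique hΔ hh hΨ))
  rintro m ⟨⟨n, hn, h1⟩, ⟨n', hn', h2⟩⟩ hcon
  have := hcon n n' h1 h2
  subst this
  exact Set.disjoint_left.1 hE hn hn'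

theorem stableImage_union (E E' : Set (Vec d)) :
    stableImage Δ h Ψ (E ∪ E') = stableImage Δ h Ψ E ∪ stableImage Δ h Ψ E' := by
  ext m
  simp only [stableImage, mem_ofPred_eq, mem_union, or_and_right, exists_or]

theorem stableImage_iUnion {ι : Type*} (E : ι → Set (Vec d)) :
    stableImage Δ h Ψ (⋃ i, E i) = ⋃ i, stableImage Δ h Ψ (E i) := by
  ext m
  simp only [stableImage, mem_ofPred_eq, mem_iUnion]
  constructor
  · rintro ⟨n, ⟨i, hi⟩, hn⟩
    exact ⟨i, n, hi, hn⟩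
  · rintro ⟨i, n, hi, hn⟩
    exact ⟨n, ⟨i, hi⟩, hn⟩

theorem isClosed_stableImage (hΔ : IsReflexive Δ) (hh : IsHeight Δ h)
    (hΨ : ContinuousOn Ψ (bdB Δ h)) {E : Set (Vec d)} (hE : IsClosed E) :
    IsClosed (stableImage Δ h Ψ E) := by
  have : stableImage Δ h Ψ E = Prod.fst '' (stableContact Δ h Ψ ∩ Prod.snd ⁻¹' E) := by
    ext m
    constructor
    · rintro ⟨n, hn, h1⟩
      exact ⟨(m, n), ⟨h1, hn⟩, rfl⟩
    · rintro ⟨⟨m, n⟩, ⟨h1, hn⟩, rfl⟩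
      exact ⟨n, hn, h1⟩
  rw [this]
  exact (((isCompact_stableContact hΔ hh hΨ).inter_right
    (hE.preimage continuous_snd)).image continuous_fst).isClosed

/-- Closed sets have closed images and generate the Borel sets. Complements are respected only up to
the null set of points with several partners, hence null measurability rather than measurability. -/
theorem nullMeasurableSet_stableImage (hΔ : IsReflexive Δ) (hh : IsHeight Δ h)
    (hΨ : ContinuousOn Ψ (bdB Δ h)) {E : Set (Vec d)} (hE : MeasurableSet E) :
    NullMeasurableSet (stableImage Δ h Ψ E) (muM Δ) := by
  have heq : (inferInstance : MeasurableSpace (Vec d)) =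
      MeasurableSpace.generateFrom {s : Set (Vec d) | IsClosed s} := by
    rw [← borel_eq_generateFrom_isClosed]
    exact BorelSpace.measurable_eq
  induction E, hE using MeasurableSpace.induction_on_inter heq isPiSystem_isClosed with
  | empty =>
    have : stableImage Δ h Ψ ∅ = ∅ := by
      ext m; simp [stableImage]
    rw [this]
    exact MeasurableSet.empty.nullMeasurableSet
  | basic E hE => exact (isClosed_stableImage hΔ hh hΨ hE).measurableSet.nullMeasurableSet
  | compl E hE ih =>
    have huniv : NullMeasurableSet (stableImage Δ h Ψ univ) (muM Δ) :=
      (isClosed_stableImage hΔ hh hΨ isClosed_univ).measurableSet.nullMeasurableSet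
    refine (huniv.diff ih).congr ?_
    have h0 := stableImage_ae_disjoint hΔ hh hΨ (disjoint_compl_right (a := E))
    filter_upwards [measure_eq_zero_iff_ae_notMem.1 h0] with m hm
    have h1 : m ∈ stableImage Δ h Ψ univ ↔
        m ∈ stableImage Δ h Ψ E ∨ m ∈ stableImage Δ h Ψ Eᶜ := by
      rw [← union_compl_self E, stableImage_union]; rfl
    have h2 : ¬(m ∈ stableImage Δ h Ψ E ∧ m ∈ stableImage Δ h Ψ Eᶜ) := hm
    refine propext ?_
    show (m ∈ stableImage Δ h Ψ univ ∧ m ∉ stableImage Δ h Ψ E) ↔ m ∈ stableImage Δ h Ψ Eᶜ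
    tauto
  | iUnion E _ _ ih =>
    rw [stableImage_iUnion]
    exact NullMeasurableSet.iUnion ih

end Stable

end

section

variable {d : ℕ} {Δ : Set (Vec d)} {h : Lat d → ℤ} {Ψ : Vec d → ℝ}

/-! ### The Monge-Ampère measure on the charts -/

theorem inter_frontier_nonempty_of_isPreconnected {X : Type*} [TopologicalSpace X] {s t : Set X}
    (hs : IsPreconnected s) (h1 : (s ∩ t).Nonempty) (h2 : (s ∩ tᶜ).Nonempty) :
    (s ∩ frontier t).Nonempty := by
  by_contra hcon
  have hmem : ∀ x ∈ s, x ∈ closure t → x ∈ interior t := fun x hx hc => by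
    by_contra hi
    exact hcon ⟨x, hx, hc, hi⟩
  obtain ⟨x, hx, hxt⟩ := h1
  obtain ⟨y, hy, hyt⟩ := h2
  obtain ⟨z, _, hz1, hz2⟩ := hs (interior t) (closure t)ᶜ isOpen_interior
    isClosed_closure.isOpen_compl
    (fun z hz => by
      by_cases hc : z ∈ closure t
      · exact Or.inl (hmem z hz hc)
      · exact Or.inr hc)
    ⟨x, hx, hmem x hx (subset_closure hxt)⟩
    ⟨y, hy, fun hc => hyt (interior_subset (hmem y hy hc))⟩
  exact hz2 (interior_subset_closure hz1)

/-- Near a point of a chart, lines in the direction of the normal meet the chart. -/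
theorem eventually_exists_mem_chartSet (hΔ : IsReflexive Δ) (hh : IsHeight Δ h)
    (hΨ : IsCConvex Δ h Ψ) {σ : Facet Δ} {n : Vec d} (hn : n ∈ chartSet Δ h Ψ σ) :
    ∀ᶠ y in 𝓝 n, ∃ t : ℝ, y + t • toVec σ.normal ∈ chartSet Δ h Ψ σ := by
  obtain ⟨O, hO, hU⟩ := exists_isOpen_chartSet hΔ hh hΨ σ
  have hnO : n ∈ O := by rw [hU] at hn; exact hn.1
  have hnD : n ∈ dualH Δ h := bdB_subset hn.1
  obtain ⟨r, hr, hball⟩ := Metric.isOpen_iff.1 hO n hnO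
  set u := toVec σ.normal with hu
  -- moving inwards one enters the interior
  have hin : ∀ᶠ ε : ℝ in 𝓝[>] 0, n - ε • u ∈ interior (dualH Δ h) := by
    have h1 : Tendsto (fun ε : ℝ => n - ε • u) (𝓝 0) (𝓝 (n - (0 : ℝ) • u)) :=
      (by fun_prop : Continuous fun ε : ℝ => n - ε • u).tendsto 0
    rw [zero_smul, sub_zero] at h1
    filter_upwards [(h1.eventually (eventually_active hΔ hnD)).filter_mono nhdsWithin_le_nhds,
      self_mem_nhdsWithin] with ε hε hε0
    refine mem_interior_dualH hΔ hh fun m hm hm0 => ?_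
    by_cases hmn : toVec m ⬝ᵥ n = h m
    · have h2 := mem_carrier_of_mem_chartSet hΔ hh hΨ hn (hΔ.lattice_mem_bdA hm hm0) hmn
      rw [dotProduct_sub, dotProduct_smul, (σ.normal_spec hΔ).2 _ h2, hmn, smul_eq_mul, mul_one]
      have : (0 : ℝ) < ε := hε0
      linarith
    · exact hε m hm hmn
  have hsmall : ∀ᶠ ε : ℝ in 𝓝[>] 0, ε * ‖u‖ < r / 2 := by
    have h1 : Tendsto (fun ε : ℝ => ε * ‖u‖) (𝓝 0) (𝓝 (0 * ‖u‖)) :=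
      (by fun_prop : Continuous fun ε : ℝ => ε * ‖u‖).tendsto 0
    rw [zero_mul] at h1
    exact (h1.eventually (gt_mem_nhds (by positivity))).filter_mono nhdsWithin_le_nhds
  obtain ⟨ε, ⟨hεin, hεr⟩, hε0⟩ := ((hin.and hsmall).and self_mem_nhdsWithin).exists
  have hε0 : 0 < ε := hε0
  have hout : n + ε • u ∉ dualH Δ h := by
    obtain ⟨_, m, hm, hmn⟩ := (mem_bdB_iff hΔ hh).1 hn.1
    have h2 := mem_carrier_of_mem_chartSet hΔ hh hΨ hn hm hmn
    intro h3
    have h4 := h3 m (hΔ.bdA_subset hm)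
    rw [dotProduct_add, dotProduct_smul, (σ.normal_spec hΔ).2 _ h2, hmn, smul_eq_mul] at h4
    linarith
  have h1 : ∀ᶠ y in 𝓝 n, y - ε • u ∈ interior (dualH Δ h) :=
    ((by fun_prop : Continuous fun y : Vec d => y - ε • u).tendsto n).eventually
      (isOpen_interior.mem_nhds hεin)
  have h2 : ∀ᶠ y in 𝓝 n, y + ε • u ∈ (dualH Δ h)ᶜ :=
    ((by fun_prop : Continuous fun y : Vec d => y + ε • u).tendsto n).eventually
      (isClosed_dualH.isOpen_compl.mem_nhds hout)
  filter_upwards [h1, h2, Metric.ball_mem_nhds n (half_pos hr)] with y hy1 hy2 hy3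
  -- The segment from `y - ε • u`, inside `Δ_h^∨`, to `y + ε • u`, outside, crosses `B`. Both `ε *
  -- ‖u‖` and the distance from `y` to `n` are below `r / 2`, so the crossing point stays in the
  -- ball contained in `O`.
  have hconn : IsPreconnected ((fun t : ℝ => y + t • u) '' Icc (-ε) ε) :=
    isPreconnected_Icc.image _ (by fun_prop)
  obtain ⟨_, ⟨t, ht, rfl⟩, hfr⟩ := inter_frontier_nonempty_of_isPreconnected hconn (t := dualH Δ h)
    ⟨_, ⟨-ε, ⟨le_rfl, by linarith⟩, rfl⟩, by
      have := interior_subset hy1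
      simpa [sub_eq_add_neg] using this⟩
    ⟨_, ⟨ε, ⟨by linarith, le_rfl⟩, rfl⟩, hy2⟩
  refine ⟨t, ?_⟩
  rw [hU]
  refine ⟨hball ?_, hfr⟩
  rw [Metric.mem_ball, dist_eq_norm] at hy3 ⊢
  have h3 : ‖t • u‖ ≤ ε * ‖u‖ := by
    rw [norm_smul, Real.norm_eq_abs]
    exact mul_le_mul_of_nonneg_right (abs_le.2 ht) (norm_nonneg _)
  calc ‖y + t • u - n‖ = ‖(y - n) + t • u‖ := by congr 1; abel
    _ ≤ ‖y - n‖ + ‖t • u‖ := norm_add_le _ _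
    _ < r := by linarith

/-- A global supporting slope lying on the boundary of `Δ` is in contact. -/
theorem add_eq_of_forall_le (hΔ : IsReflexive Δ) (hh : IsHeight Δ h)
    (hΨ : ContinuousOn Ψ (bdB Δ h)) {w n : Vec d} (hn : n ∈ bdB Δ h)
    (hw : ∀ n' ∈ bdB Δ h, Ψ n + w ⬝ᵥ (n' - n) ≤ Ψ n') : cTransB Δ h Ψ w + Ψ n = w ⬝ᵥ n := by
  have h1 := le_cTransB hΔ hΨ w hn
  have h2 : cTransB Δ h Ψ w ≤ w ⬝ᵥ n - Ψ n := cTransB_le hΔ hh fun n' hn' => by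
    have := hw n' hn'
    rw [dotProduct_sub] at this
    linarith
  linarith

/-- In a chart, the subgradients of `Ψ - m` correspond to the points in contact. -/
theorem mem_subgradient_chartSet_iff (hΔ : IsReflexive Δ) (hh : IsHeight Δ h)
    (hΨ : InP Δ Ψ) {σ : Facet Δ} {n : Vec d} (hn : n ∈ chartSet Δ h Ψ σ) {m : Vec d}
    (hm : m ∈ σ.carrier) (x : Fin d → ℝ) :
    x ∈ subgradient (chartSet Δ h Ψ σ) σ.chart (fun n => Ψ n - m ⬝ᵥ n) n ↔
      (m + σ.lin x, n) ∈ contact Δ h Ψ := by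
  have hcc := hΨ.isCConvex hΔ hh
  have hΦ := (continuous_cTransB hΔ hh hcc.1).continuousOn (s := bdA Δ)
  set w := m + σ.lin x with hw
  -- Undoing the subtraction of `m` turns the subgradient condition in coordinates into support of
  -- `Ψ` on the chart by the ambient slope `w`, which has height one on `n_σ`.
  have hsub : x ∈ subgradient (chartSet Δ h Ψ σ) σ.chart (fun n => Ψ n - m ⬝ᵥ n) n ↔
      ∀ n' ∈ chartSet Δ h Ψ σ, Ψ n + w ⬝ᵥ (n' - n) ≤ Ψ n' := by
    refine forall₂_congr fun n' _ => ?_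
    rw [dotProduct_sub, ← σ.lin_dotProduct, ← σ.lin_dotProduct, hw, add_dotProduct,
      dotProduct_sub, dotProduct_sub]
    constructor <;> intro h1 <;> linarith
  rw [hsub]
  constructor
  · intro h1
    have hwn : w ⬝ᵥ toVec σ.normal = 1 := by
      rw [hw, add_dotProduct, σ.lin_normal, add_zero, (σ.normal_spec hΔ).2 _ hm]
    set Ψ' := cTransA Δ (cTransB Δ h Ψ) with hΨ'
    have hΨ'P : InP Δ Ψ' := inP_cTransA hΔ hΦ
    -- Off `B` the values of `Ψ` are not controlled, so the double transform `Ψ'` replaces it. A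
    -- nearby `y` is shifted along `n_σ` into the chart; the contact slope there lies in `σ°` and
    -- has the same height as `w`, so the supporting inequality carries back to `y`. Convexity then
    -- makes the local minimum global.
    have hloc : IsLocalMin (fun y => Ψ' y + -(w ⬝ᵥ y)) n := by
      filter_upwards [eventually_exists_mem_chartSet hΔ hh hcc hn] with y hy
      obtain ⟨t, ht⟩ := hy
      have hB : y + t • toVec σ.normal ∈ bdB Δ h := ht.1
      obtain ⟨m', hm'⟩ := exists_contact_left hΔ hh hcc hB
      have hm'σ := ((mem_chartSet_iff hΔ hh hcc σ).1 ht).2 m' hm'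
      have h2 := le_cTransA hΔ hΦ y hm'.1
      have h3 := hm'.2.2
      have h4 := h1 _ ht
      have h5 : Ψ' n = Ψ n := hcc.2 n hn.1
      simp only [dotProduct_sub, dotProduct_add, dotProduct_smul, smul_eq_mul, hwn,
        ((σ.mem_relint hΔ).1 hm'σ).2.1] at h3 h4
      simp only [h5]
      linarith
    have hconv : ConvexOn ℝ univ (fun y => Ψ' y + -(w ⬝ᵥ y)) := by
      refine hΨ'P.1.add ?_
      exact (-(dotLin w)).convexOn convex_univ
    have hglob := IsMinOn.of_isLocalMin_of_convex_univ hloc hconv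
    have h6 : ∀ y, Ψ' n + w ⬝ᵥ (y - n) ≤ Ψ' y := fun y => by
      have : Ψ' n + -(w ⬝ᵥ n) ≤ Ψ' y + -(w ⬝ᵥ y) := hglob y
      rw [dotProduct_sub]
      linarith
    have hwΔ : w ∈ Δ := hΨ'P.slope_mem hΔ (c := Ψ' n - w ⬝ᵥ n) fun y => by
      have := h6 y
      rw [dotProduct_sub] at this
      linarith
    refine ⟨σ.carrier_subset_bdA hΔ ((σ.mem_carrier_iff hΔ).2 ⟨hwΔ, hwn⟩), hn.1, ?_⟩
    refine add_eq_of_forall_le hΔ hh hcc.1 hn.1 fun n' hn' => ?_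
    have := h6 n'
    rwa [hΨ', hcc.2 n hn.1, hcc.2 n' hn'] at this
  · rintro ⟨_, _, h1⟩ n' hn'
    have h2 := le_cTransB hΔ hcc.1 w hn'.1
    simp only at h1
    rw [dotProduct_sub]
    linarith

theorem muM_of_subset_relint (hΔ : IsReflexive Δ) (σ : Facet Δ) {S : Set (Vec d)}
    (hS : S ⊆ σ.relint) : muM Δ S = volume (σ.param ⁻¹' S) := by
  rw [muM_apply hΔ, tsum_eq_single σ, inter_eq_left.2 hS]
  intro σ' hσ'
  have : S ∩ σ'.relint = ∅ := by
    rw [eq_empty_iff_forall_notMem]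
    rintro m ⟨h1, h2⟩
    exact hσ' (Facet.eq_of_mem_relint hΔ (hS h1) (σ'.relint_subset h2))
  rw [this, preimage_empty, measure_empty]

/-- Every contact with a point of the chart lies in `σ°` and is stable. Hence the union of the
subgradients is the stable image in the coordinates of `σ`, translated by the coordinates of the
base point `m`. -/
theorem volume_subgradient_chartSet (hΔ : IsReflexive Δ) (hh : IsHeight Δ h)
    (hΨ : InP Δ Ψ) {σ : Facet Δ} {m : Vec d} (hm : m ∈ σ.carrier) {E : Set (Vec d)}
    (hE : E ⊆ chartSet Δ h Ψ σ) :
    volume (⋃ n ∈ E, subgradient (chartSet Δ h Ψ σ) σ.chart (fun n => Ψ n - m ⬝ᵥ n) n) =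
      muM Δ (stableImage Δ h Ψ E) := by
  have hcc := hΨ.isCConvex hΔ hh
  have hrel : ∀ n ∈ E, ∀ m, (m, n) ∈ contact Δ h Ψ →
      m ∈ σ.relint ∧ (m, n) ∈ stableContact Δ h Ψ := fun n hn m hc => by
    have h1 := ((mem_chartSet_iff hΔ hh hcc σ).1 (hE hn)).2 m hc
    exact ⟨h1, hc, (mem_stableSet_iff_of_relint hΔ h1).2
      ((isChartCollection_chartSet hΔ hh hcc).subset_domain σ (hE hn))⟩
  obtain ⟨x₀, hx₀⟩ := σ.exists_param hΔ ((σ.normal_spec hΔ).2 _ hm)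
  have hset : (⋃ n ∈ E, subgradient (chartSet Δ h Ψ σ) σ.chart (fun n => Ψ n - m ⬝ᵥ n) n) =
      (fun x => x₀ + x) ⁻¹' (σ.param ⁻¹' stableImage Δ h Ψ E) := by
    ext x
    have hp : σ.param (x₀ + x) = m + σ.lin x := by
      rw [← hx₀, σ.param_eq, σ.param_eq, map_add, add_assoc]
    simp only [mem_iUnion, mem_preimage, hp, exists_prop]
    constructor
    · rintro ⟨n, hn, hx⟩
      exact ⟨n, hn, (hrel n hn _ ((mem_subgradient_chartSet_iff hΔ hh hΨ (hE hn) hm x).1 hx)).2⟩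
    · rintro ⟨n, hn, hx⟩
      exact ⟨n, hn, (mem_subgradient_chartSet_iff hΔ hh hΨ (hE hn) hm x).2 hx.1⟩
  rw [hset, measure_preimage_add, muM_of_subset_relint hΔ σ]
  rintro m' ⟨n, hn, hc⟩
  exact (hrel n hn m' hc.1).1

/-! ### The Monge-Ampère measure on the open facets of `Δ_h^∨` -/

/-- A convex function whose restriction to a hyperplane `⟨u, y⟩ = ⟨u, n⟩` is minimal at `n` has a
supporting slope at `n` that is proportional to `u`. -/
theorem exists_slope_of_min_on_hyperplane {f : Vec d → ℝ} (hf : ConvexOn ℝ univ f)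
    (hfc : Continuous f) {u n : Vec d} (hu : u ≠ 0)
    (hmin : ∀ y, u ⬝ᵥ y = u ⬝ᵥ n → f n ≤ f y) :
    ∃ s : ℝ, ∀ y, f n + s * (u ⬝ᵥ (y - n)) ≤ f y := by
  have hs1 : Convex ℝ {p : Vec d × ℝ | f p.1 < p.2} := by
    simpa using hf.convex_strict_epigraph
  have hs2 : IsOpen {p : Vec d × ℝ | f p.1 < p.2} := isOpen_lt (by fun_prop) continuous_snd
  have ht : Convex ℝ {p : Vec d × ℝ | u ⬝ᵥ p.1 = u ⬝ᵥ n ∧ p.2 = f n} := by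
    rintro ⟨x, r⟩ ⟨h1, h2⟩ ⟨y, r'⟩ ⟨h3, h4⟩ a b _ _ hab
    simp only [Prod.smul_mk, Prod.mk_add_mk, mem_ofPred_eq, dotProduct_add, dotProduct_smul,
      smul_eq_mul] at h1 h2 h3 h4 ⊢
    rw [h1, h2, h3, h4, ← add_mul, ← add_mul, hab, one_mul, one_mul]
    exact ⟨rfl, rfl⟩
  have hdisj : Disjoint {p : Vec d × ℝ | f p.1 < p.2}
      {p : Vec d × ℝ | u ⬝ᵥ p.1 = u ⬝ᵥ n ∧ p.2 = f n} := by
    rw [Set.disjoint_left]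
    rintro ⟨x, r⟩ h1 ⟨h2, h3⟩
    simp only [mem_ofPred_eq] at h1 h2 h3
    have := hmin x h2
    linarith
  -- Separate the open strict epigraph of `f` from the hyperplane placed at constant height `f n`.
  obtain ⟨F, c, hF1, hF2⟩ := geometric_hahn_banach_open hs1 hs2 ht hdisj
  obtain ⟨w, hw⟩ := exists_eq_dotProduct (F.comp (ContinuousLinearMap.inl ℝ (Vec d) ℝ))
  set a := F (0, 1) with ha
  have hF : ∀ y r, F (y, r) = w ⬝ᵥ y + a * r := by
    intro y r
    have h1 : ((y, r) : Vec d × ℝ) = (y, 0) + r • (0, 1) := by simp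
    rw [h1, map_add, map_smul, smul_eq_mul, ← ha, mul_comm r, ← hw]
    rfl
  have hup : ∀ y, u ⬝ᵥ y = u ⬝ᵥ n → c ≤ w ⬝ᵥ y + a * f n := fun y hy => by
    rw [← hF]; exact hF2 (y, f n) ⟨hy, rfl⟩
  have hlow : ∀ y r, f y < r → w ⬝ᵥ y + a * r < c := fun y r hr => by
    rw [← hF]; exact hF1 (y, r) hr
  have hw0 : ∀ v, u ⬝ᵥ v = 0 → w ⬝ᵥ v = 0 := by
    intro v hv
    by_contra hne
    -- The separating functional is bounded below on the whole hyperplane, so it cannot vary along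
    -- `v`. The multiple of `v` is chosen to give it the value `c - 1`.
    have h1 := hup (n + ((c - w ⬝ᵥ n - a * f n - 1) / (w ⬝ᵥ v)) • v) (by
      rw [dotProduct_add, dotProduct_smul, hv, smul_zero, add_zero])
    rw [dotProduct_add, dotProduct_smul, smul_eq_mul, div_mul_cancel₀ _ hne] at h1
    linarith
  obtain ⟨b, hb⟩ := eq_smul_of_ker_le hu hw0
  have hn1 := hup n rfl
  have ha0 : a < 0 := by
    have := hlow n (f n + 1) (by linarith)
    linarith
  refine ⟨b / (-a), fun y => ?_⟩
  have h2 : w ⬝ᵥ y + a * f y ≤ w ⬝ᵥ n + a * f n := by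
    refine le_of_forall_pos_le_add fun ε hε => ?_
    have h3 := hlow y (f y + ε / (-a)) (by
      have : 0 < ε / (-a) := div_pos hε (by linarith)
      linarith)
    have h4 : a * (ε / (-a)) = -ε := by
      rw [div_neg, mul_neg, mul_div_cancel₀ _ ha0.ne]
    rw [mul_add, h4] at h3
    linarith
  rw [hb, smul_dotProduct, smul_dotProduct, smul_eq_mul, smul_eq_mul] at h2
  have h5 : b / (-a) * (u ⬝ᵥ (y - n)) ≤ f y - f n := by
    rw [div_mul_eq_mul_div, div_le_iff₀ (by linarith), dotProduct_sub]
    linarith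
  linarith

/-- On an open facet `τ°` of `Δ_h^∨`, the subgradients correspond to the lines in the direction of
the normal that meet the stable contact points. -/
theorem mem_subgradient_relint_iff (hΔ : IsReflexive Δ) (hh : IsHeight Δ h)
    (hΨ : InP Δ Ψ) {τ : Facet (dualH Δ h)} (σ : Facet Δ) {n : Vec d} (hn : n ∈ τ.relint)
    (x : Fin d → ℝ) : x ∈ subgradient τ.relint σ.chart Ψ n ↔
      ∃ r : ℝ, (σ.lin x + r • toVec τ.normal, n) ∈ stableContact Δ h Ψ := by
  have hcc := hΨ.isCConvex hΔ hh
  obtain ⟨hmA, hmτ⟩ := τ.normal_mem_bdA hΔ hh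
  have hnB := τ.relint_dualH_subset_bdB (τ.relint_subset hn)
  set u := toVec τ.normal with hu
  constructor
  · intro hx
    have hx' : ∀ y ∈ τ.relint, Ψ n - σ.lin x ⬝ᵥ n ≤ Ψ y - σ.lin x ⬝ᵥ y := fun y hy => by
      have := hx y hy
      rw [dotProduct_sub, ← σ.lin_dotProduct, ← σ.lin_dotProduct] at this
      linarith
    have hconv : ConvexOn ℝ univ (fun y => Ψ y + -(σ.lin x ⬝ᵥ y)) :=
      hΨ.1.add ((-(dotLin (σ.lin x))).convexOn convex_univ)
    -- Minimality on `τ°` extends to the full hyperplane: a small step from `n` towards `y` stays in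
    -- `τ°`, and convexity along the segment compares `n` with `y`.
    have hmin : ∀ y, u ⬝ᵥ y = u ⬝ᵥ n → Ψ n + -(σ.lin x ⬝ᵥ n) ≤ Ψ y + -(σ.lin x ⬝ᵥ y) := by
      intro y hy
      have hev := eventually_eventually_nhds.2 (τ.mem_relint_iff.1 hn).2
      have h1 : Tendsto (fun t : ℝ => (1 - t) • n + t • y) (𝓝 0) (𝓝 n) := by
        have := (by fun_prop : Continuous fun t : ℝ => (1 - t) • n + t • y).tendsto 0
        simpa using this
      obtain ⟨t, ⟨ht, ht1⟩, ht0⟩ := ((((h1.eventually hev).and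
        (gt_mem_nhds one_pos)).filter_mono nhdsWithin_le_nhds).and
          (self_mem_nhdsWithin (s := Ioi (0 : ℝ)))).exists
      have ht0 : 0 < t := ht0
      have hpt : u ⬝ᵥ ((1 - t) • n + t • y) = u ⬝ᵥ n := by
        rw [dotProduct_add, dotProduct_smul, dotProduct_smul, hy, smul_eq_mul, smul_eq_mul]
        ring
      have hrel : (1 - t) • n + t • y ∈ τ.relint :=
        τ.mem_relint_iff.2 ⟨ht.self_of_nhds hpt, ht.mono fun z hz hzu => hz (hzu.trans hpt)⟩
      have h2 := hx' _ hrel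
      have h3 := hconv.2 (mem_univ n) (mem_univ y) (sub_nonneg.2 ht1.le) ht0.le (by ring)
      simp only [smul_eq_mul] at h3
      have h4 : t * (Ψ n + -(σ.lin x ⬝ᵥ n)) ≤ t * (Ψ y + -(σ.lin x ⬝ᵥ y)) := by linarith
      exact le_of_mul_le_mul_left h4 ht0
    obtain ⟨s, hs⟩ := exists_slope_of_min_on_hyperplane hconv
      (by have := hΨ.continuous; fun_prop) τ.toVec_normal_ne_zero hmin
    have hglob : ∀ y, Ψ n + (σ.lin x + s • u) ⬝ᵥ (y - n) ≤ Ψ y := fun y => by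
      have := hs y
      rw [add_dotProduct, smul_dotProduct, smul_eq_mul, dotProduct_sub (σ.lin x)]
      linarith
    have hwΔ : σ.lin x + s • u ∈ Δ :=
      hΨ.slope_mem hΔ (c := Ψ n - (σ.lin x + s • u) ⬝ᵥ n) fun y => by
        have := hglob y
        rw [dotProduct_sub] at this
        linarith
    have heq := add_eq_of_forall_le hΔ hh hcc.1 hnB fun n' _ => hglob n'
    -- Pushing the slope along `m_τ` to the boundary of `Δ` preserves contact with `n`. The blocking
    -- inequality increases along the lattice point `m_τ`, so `m_τ` lies on the exit face and the
    -- exit point lies in `St(m_τ)`.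
    obtain ⟨t, ht, hA, s', hs', hs1, hpos⟩ := hΔ.exists_exit hwΔ τ.toVec_normal_ne_zero
    have hmn := hmτ n (τ.relint_subset hn)
    refine ⟨s + t, ?_⟩
    rw [add_smul, ← add_assoc]
    refine ⟨contact_add_smul hΔ hh hcc.1 heq hnB hmA hmn ht hA, ?_⟩
    refine mem_stableSet_iff.2 ⟨τ.normal, hmA, ?_, bdB_subset hnB, hmn⟩
    exact hΔ.mem_closedStar_iff.2 ⟨hΔ.bdA_subset hmA, hΔ.bdA_subset hA, s', hs',
      hΔ.lattice_pairing_eq_one (hΔ.bdA_subset hmA) hs' hpos, hs1⟩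
  -- On `τ` the pairing with `m_τ` is constant, so the component `r` drops out of the comparison.
  · rintro ⟨r, ⟨hA, _, h1⟩, _⟩ n' hn'
    have h2 := le_cTransB hΔ hcc.1 (σ.lin x + r • u)
      (τ.relint_dualH_subset_bdB (τ.relint_subset hn'))
    simp only at h1
    rw [add_dotProduct, smul_dotProduct] at h1 h2
    rw [hmτ n' (τ.relint_subset hn')] at h2
    rw [hmτ n (τ.relint_subset hn)] at h1
    rw [dotProduct_sub, ← σ.lin_dotProduct, ← σ.lin_dotProduct]
    linarith

end

section

variable {d : ℕ} {Δ : Set (Vec d)} {h : Lat d → ℤ} {Ψ : Vec d → ℝ}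

/-! ### Projections along lattice vectors -/

/-- The shear `v ↦ v - ⟨v, u'⟩ m` from `u^⊥` to `u'^⊥`. -/
def shear {u u' m : Lat d} (hm' : m ⬝ᵥ u' = 1) : orthLattice u →ₗ[ℤ] orthLattice u' where
  toFun v := ⟨(v : Lat d) - ((v : Lat d) ⬝ᵥ u') • m, by
    show ((v : Lat d) - ((v : Lat d) ⬝ᵥ u') • m) ⬝ᵥ u' = 0
    rw [sub_dotProduct, smul_dotProduct, hm', smul_eq_mul, mul_one, sub_self]⟩
  map_add' v w := by
    apply Subtype.ext
    show ((v : Lat d) + (w : Lat d)) - (((v : Lat d) + (w : Lat d)) ⬝ᵥ u') • m =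
      ((v : Lat d) - ((v : Lat d) ⬝ᵥ u') • m) + ((w : Lat d) - ((w : Lat d) ⬝ᵥ u') • m)
    rw [add_dotProduct, add_smul]
    abel
  map_smul' c v := by
    apply Subtype.ext
    show (c • (v : Lat d)) - ((c • (v : Lat d)) ⬝ᵥ u') • m =
      c • ((v : Lat d) - ((v : Lat d) ⬝ᵥ u') • m)
    rw [smul_dotProduct, smul_sub, smul_assoc]

theorem shear_coe {u u' m : Lat d} (hm' : m ⬝ᵥ u' = 1) (v : orthLattice u) :
    (shear hm' v : Lat d) = (v : Lat d) - ((v : Lat d) ⬝ᵥ u') • m := rfl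

/-- The shears in both directions along the common lattice point `m` are mutually inverse. In
lattice bases they are therefore integer matrices of determinant `±1`, which is the source of volume
preservation. -/
theorem shear_comp_shear {u u' m : Lat d} (hm : m ⬝ᵥ u = 1) (hm' : m ⬝ᵥ u' = 1) :
    (shear hm : orthLattice u' →ₗ[ℤ] orthLattice u) ∘ₗ shear hm' = LinearMap.id := by
  ext v : 2
  rw [LinearMap.comp_apply, shear_coe, shear_coe, sub_dotProduct, orthLattice_pairing,
    smul_dotProduct, hm]
  simp

theorem abs_det_map_eq_one {A B : Matrix (Fin d) (Fin d) ℤ} (hAB : A * B = 1) :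
    |(A.map ((↑) : ℤ → ℝ)).det| = 1 := by
  have h1 : IsUnit A.det := by
    have := congrArg Matrix.det hAB
    rw [Matrix.det_mul, Matrix.det_one] at this
    exact IsUnit.of_mul_eq_one _ this
  have h2 : (A.map ((↑) : ℤ → ℝ)).det = ((A.det : ℤ) : ℝ) := by
    have := (Int.castRingHom ℝ).map_det A
    simpa using this.symm
  rw [h2]
  rcases Int.isUnit_iff.1 h1 with h3 | h3 <;> rw [h3] <;> simp

/-- The projection of the hyperplane of `σ` to that of `σ'` along a common lattice point `m`, in
the linear coordinates of `σ`. -/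
noncomputable def proj (σ σ' : Facet Δ) (m : Lat d) (x : Fin d → ℝ) : Vec d :=
  σ.lin x + (1 - σ.lin x ⬝ᵥ toVec σ'.normal) • toVec m

theorem continuous_proj (σ σ' : Facet Δ) (m : Lat d) : Continuous (proj σ σ' m) := by
  have : Continuous σ.lin := σ.lin.continuous_of_finiteDimensional
  unfold proj
  fun_prop

/-- In coordinates the projection is an affine map whose linear part is the integral shear matrix,
of determinant `±1`. The set `S` is arbitrary, as it will be a stable image. -/
theorem volume_preimage_proj (hΔ : IsReflexive Δ) {σ σ' : Facet Δ} {m : Lat d}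
    (hm : toVec m ∈ σ.carrier) (hm' : toVec m ∈ σ'.carrier) (S : Set (Vec d)) :
    volume (proj σ σ' m ⁻¹' S) = volume (σ'.param ⁻¹' S) := by
  have hp : m ⬝ᵥ σ.normal = 1 := by
    have := (σ.normal_spec hΔ).2 _ hm
    rw [toVec_dotProduct] at this
    exact_mod_cast this
  have hp' : m ⬝ᵥ σ'.normal = 1 := by
    have := (σ'.normal_spec hΔ).2 _ hm'
    rw [toVec_dotProduct] at this
    exact_mod_cast this
  let ℓ : orthLattice σ.normal →ₗ[ℤ] orthLattice σ'.normal := shear hp'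
  let ℓ' : orthLattice σ'.normal →ₗ[ℤ] orthLattice σ.normal := shear hp
  set M := LinearMap.toMatrix σ.basis σ'.basis ℓ with hM
  have hMM : M * LinearMap.toMatrix σ'.basis σ.basis ℓ' = 1 := by
    rw [hM, ← LinearMap.toMatrix_comp, shear_comp_shear hp' hp, LinearMap.toMatrix_id]
  set L := Matrix.toLin' (M.map ((↑) : ℤ → ℝ)) with hL
  have hdet : |LinearMap.det L| = 1 := by
    rw [hL, LinearMap.det_toLin']
    exact abs_det_map_eq_one hMM
  obtain ⟨y₀, hy₀⟩ := σ'.exists_param hΔ ((σ'.normal_spec hΔ).2 _ hm')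
  have hlin : ∀ x, σ'.lin (L x) = σ.lin x - (σ.lin x ⬝ᵥ toVec σ'.normal) • toVec m := by
    intro x
    have hcomp : σ'.lin ∘ₗ L = σ.lin -
        ((dotLin (toVec σ'.normal)).comp σ.lin).smulRight (toVec m) := by
      refine LinearMap.pi_ext' fun i => LinearMap.ext_ring ?_
      have hb : σ.lin (Pi.single i 1) = toVec (σ.basis i : Lat d) := by
        show ∑ j, (Pi.single i 1 : Fin d → ℝ) j • toVec (σ.basis j : Lat d) = _
        rw [Finset.sum_eq_single i]
        · simp
        · intro j _ hj
          simp [hj]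
        · simp
      have hb' : L (Pi.single i 1) = fun j => (σ'.basis.repr (ℓ (σ.basis i)) j : ℝ) := by
        funext j
        simp [hL, Matrix.toLin'_apply, hM, LinearMap.toMatrix_apply]
      simp only [LinearMap.comp_apply, LinearMap.sub_apply, LinearMap.smulRight_apply,
        LinearMap.single_apply, hb, hb', dotLin_apply]
      have h1 := σ'.exists_lin_of_lattice (orthLattice_pairing (ℓ (σ.basis i)))
      rw [← h1]
      show toVec (shear hp' (σ.basis i) : Lat d) = _
      rw [shear_coe, toVec_sub, toVec_smul, ← toVec_dotProduct, dotProduct_comm]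
    have := LinearMap.congr_fun hcomp x
    simpa [dotProduct_comm] using this
  have hproj : ∀ x, proj σ σ' m x = σ'.param (y₀ + L x) := by
    intro x
    rw [σ'.param_eq, map_add, ← add_assoc, ← σ'.param_eq, hy₀, hlin]
    unfold proj
    rw [sub_smul, one_smul]
    abel
  have hset : proj σ σ' m ⁻¹' S = L ⁻¹' ((fun y => y₀ + y) ⁻¹' (σ'.param ⁻¹' S)) := by
    ext x
    simp only [mem_preimage, hproj]
  have hdet0 : LinearMap.det L ≠ 0 := fun h0 => by
    rw [h0] at hdet; simp at hdet
  rw [hset, Measure.addHaar_preimage_linearMap _ hdet0, abs_inv, hdet, inv_one,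
    ENNReal.ofReal_one, one_mul, measure_preimage_add]

theorem volume_affine_hyperplane {k : ℕ} (c : ℝ) {v : Fin k → ℝ} (hv : v ≠ 0) :
    volume {x : Fin k → ℝ | c + x ⬝ᵥ v = 0} = 0 := by
  by_cases hne : ∃ x₁ : Fin k → ℝ, c + x₁ ⬝ᵥ v = 0
  · obtain ⟨x₁, hx₁⟩ := hne
    let ℓ : (Fin k → ℝ) →ₗ[ℝ] ℝ :=
      { toFun := fun x => x ⬝ᵥ v
        map_add' := fun x y => add_dotProduct x y v
        map_smul' := fun c x => smul_dotProduct c x v }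
    have hset : {x : Fin k → ℝ | c + x ⬝ᵥ v = 0} =
        (fun x => -x₁ + x) ⁻¹' (LinearMap.ker ℓ : Set (Fin k → ℝ)) := by
      ext x
      show c + x ⬝ᵥ v = 0 ↔ (-x₁ + x) ⬝ᵥ v = 0
      rw [add_dotProduct, neg_dotProduct]
      constructor <;> intro _ <;> linarith
    rw [hset, measure_preimage_add]
    refine Measure.addHaar_submodule _ _ fun htop => hv ?_
    have : v ∈ LinearMap.ker ℓ := by rw [htop]; trivial
    exact dotProduct_self_eq_zero.1 this
  · have : {x : Fin k → ℝ | c + x ⬝ᵥ v = 0} = ∅ := by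
      rw [eq_empty_iff_forall_notMem]
      exact fun x hx => hne ⟨x, hx⟩
    rw [this, measure_empty]

/-- Points whose projection lies on two facet inequalities form a null set. -/
theorem volume_two_active (hΔ : IsReflexive Δ) (σ : Facet Δ) {m : Lat d}
    (hm : toVec m ∈ σ.carrier) {s s' : Lat d} (hms : toVec m ⬝ᵥ toVec s = 1) (hss : s' ≠ s) :
    volume {x : Fin d → ℝ | (σ.lin x + (1 - σ.lin x ⬝ᵥ toVec s) • toVec m) ⬝ᵥ toVec s' = 1} = 0 := by
  set k := toVec m ⬝ᵥ toVec s' with hk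
  have hset : {x : Fin d → ℝ | (σ.lin x + (1 - σ.lin x ⬝ᵥ toVec s) • toVec m) ⬝ᵥ toVec s' = 1} =
      {x : Fin d → ℝ | (k - 1) + x ⬝ᵥ σ.chart (toVec s' - k • toVec s) = 0} := by
    ext x
    simp only [mem_ofPred_eq]
    rw [← σ.lin_dotProduct, add_dotProduct, smul_dotProduct, dotProduct_sub, dotProduct_smul,
      ← hk, smul_eq_mul, smul_eq_mul]
    constructor <;> intro _ <;> linarith
  rw [hset]
  -- If the linear part vanishes, the condition reduces to `k = 1`. In that case `s' - s` is a
  -- multiple of `n_σ` that pairs to zero with `m`, which has height one, so `s' = s`.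
  by_cases hv : σ.chart (toVec s' - k • toVec s) = 0
  · rw [hv]
    simp only [dotProduct_zero, add_zero]
    by_cases hk1 : k - 1 = 0
    · exfalso
      have hk1 : k = 1 := by linarith
      have h0 : σ.chart 0 = 0 := by
        funext i; simp [Facet.chart]
      obtain ⟨t, ht⟩ := σ.eq_add_smul_of_chart_eq hΔ (h0.trans hv.symm)
      have h1 := congrArg (fun y => toVec m ⬝ᵥ y) ht
      simp only [dotProduct_sub, dotProduct_smul, zero_add, hms, ← hk, hk1,
        (σ.normal_spec hΔ).2 _ hm, smul_eq_mul] at h1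
      have ht0 : t = 0 := by linarith
      rw [ht0, hk1, zero_smul, one_smul, add_zero, sub_eq_zero] at ht
      exact hss (toVec_injective ht)
    · simp [hk1]
  · exact volume_affine_hyperplane _ hv

theorem mem_closedStar_of_stableContact (hΔ : IsReflexive Δ) (hh : IsHeight Δ h)
    {τ : Facet (dualH Δ h)} {m n : Vec d} (hn : n ∈ τ.relint)
    (hmn : (m, n) ∈ stableContact Δ h Ψ) : m ∈ closedStar Δ (toVec τ.normal) := by
  obtain ⟨m', hm', hst, hdf⟩ := mem_stableSet_iff.1 hmn.2
  rw [← τ.eq_normal_of_active hΔ hh hn hm' hdf.2]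
  exact hst

/-- The union of the subgradients is the shadow of the stable image along `m_τ` in the hyperplane of
`σ`. A line in direction `m_τ` meets the star of `m_τ` in at most one point, so the shadow splits,
up to a null set, according to the facet around `m_τ` through which the line exits, and on each
piece projection along `m_τ` preserves volume. -/
theorem volume_subgradient_relint (hΔ : IsReflexive Δ) (hh : IsHeight Δ h)
    (hΨ : InP Δ Ψ) {τ : Facet (dualH Δ h)} {σ : Facet Δ} (hσ : toVec τ.normal ∈ σ.carrier)
    {E : Set (Vec d)} (hE : E ⊆ τ.relint) :
    volume (⋃ n ∈ E, subgradient τ.relint σ.chart Ψ n) = muM Δ (stableImage Δ h Ψ E) := by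
  have := Facet.finite hΔ
  set m := τ.normal with hm
  set S := stableImage Δ h Ψ E with hS
  have hstar : ∀ z ∈ S, z ∈ Δ ∧ ∃ s ∈ dualLat Δ, toVec m ⬝ᵥ toVec s = 1 ∧ z ⬝ᵥ toVec s = 1 := by
    rintro z ⟨n, hn, hc⟩
    exact (hΔ.mem_closedStar_iff.1 (mem_closedStar_of_stableContact hΔ hh (hE hn) hc)).2
  have hX : (⋃ n ∈ E, subgradient τ.relint σ.chart Ψ n) =
      {x | ∃ r : ℝ, σ.lin x + r • toVec m ∈ S} := by
    ext x
    simp only [mem_iUnion, exists_prop, mem_ofPred_eq]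
    constructor
    · rintro ⟨n, hn, hx⟩
      obtain ⟨r, hr⟩ := (mem_subgradient_relint_iff hΔ hh hΨ σ (hE hn) x).1 hx
      exact ⟨r, n, hn, hr⟩
    · rintro ⟨r, n, hn, hr⟩
      exact ⟨n, hn, (mem_subgradient_relint_iff hΔ hh hΨ σ (hE hn) x).2 ⟨r, hr⟩⟩
  rw [hX]
  set X := {x | ∃ r : ℝ, σ.lin x + r • toVec m ∈ S} with hXdef
  -- two points of `Δ` on a line in the direction of `m`, both lying on exit facets
  have hexit : ∀ (z : Vec d) (r r' : ℝ) (s s' : Lat d), s ∈ dualLat Δ → s' ∈ dualLat Δ →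
      toVec m ⬝ᵥ toVec s = 1 → toVec m ⬝ᵥ toVec s' = 1 → z + r • toVec m ∈ Δ →
      z + r' • toVec m ∈ Δ → (z + r • toVec m) ⬝ᵥ toVec s = 1 →
      (z + r' • toVec m) ⬝ᵥ toVec s' = 1 → r = r' := by
    intro z r r' s s' hs hs' h1 h2 h3 h4 h5 h6
    have h7 := hΔ.pairing_le h3 hs'
    have h8 := hΔ.pairing_le h4 hs
    rw [add_dotProduct, smul_dotProduct, smul_eq_mul] at h5 h6 h7 h8
    rw [h1] at h5 h8
    rw [h2] at h6 h7
    linarith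
  -- The piece of parameters whose line leaves `Δ` through the relative interior of `σ'`, a facet
  -- containing `m_τ`.
  let W : Facet Δ → Set (Fin d → ℝ) := fun σ' =>
    {x | toVec m ∈ σ'.carrier ∧ proj σ σ' m x ∈ σ'.relint}
  have hWmeas : ∀ σ', MeasurableSet (W σ') := by
    intro σ'
    by_cases hc : toVec m ∈ σ'.carrier
    · have : W σ' = proj σ σ' m ⁻¹' σ'.relint := by
        ext x; simp [W, hc]
      rw [this]
      exact (continuous_proj σ σ' m).measurable (σ'.measurableSet_relint hΔ)
    · have : W σ' = ∅ := by
        ext x; simp [W, hc]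
      rw [this]
      exact MeasurableSet.empty
  have hWdisj : Pairwise (Function.onFun Disjoint W) := by
    intro σ₁ σ₂ hne
    refine Set.disjoint_left.2 ?_
    rintro x ⟨h1, h2⟩ ⟨h3, h4⟩
    obtain ⟨h5, h6, _⟩ := (σ₁.mem_relint hΔ).1 h2
    obtain ⟨h7, h8, _⟩ := (σ₂.mem_relint hΔ).1 h4
    have hr := hexit _ _ _ _ _ (σ₁.normal_spec hΔ).1 (σ₂.normal_spec hΔ).1
      ((σ₁.normal_spec hΔ).2 _ h1) ((σ₂.normal_spec hΔ).2 _ h3) h5 h7 h6 h8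
    have heq : proj σ σ₁ m x = proj σ σ₂ m x := by
      unfold proj; rw [hr]
    rw [heq] at h2
    exact hne (Facet.eq_of_mem_relint hΔ h4 (σ₁.relint_subset h2))
  -- What is missed are lines whose exit point has a second active inequality, a finite union of
  -- null sets.
  have hnull : volume (X \ ⋃ σ', W σ') = 0 := by
    refine measure_mono_null (t := ⋃ s ∈ dualLat Δ, ⋃ s' ∈ dualLat Δ,
      {x | (toVec m ⬝ᵥ toVec s = 1 ∧ s' ≠ s) ∧
        (σ.lin x + (1 - σ.lin x ⬝ᵥ toVec s) • toVec m) ⬝ᵥ toVec s' = 1}) ?_ ?_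
    · rintro x ⟨⟨r, hr⟩, hxW⟩
      obtain ⟨hzΔ, s, hs, h1, h2⟩ := hstar _ hr
      have hr' : r = 1 - σ.lin x ⬝ᵥ toVec s := by
        rw [add_dotProduct, smul_dotProduct, h1, smul_eq_mul, mul_one] at h2
        linarith
      simp only [mem_iUnion, exists_prop, mem_ofPred_eq]
      by_contra! hcon
      obtain ⟨σ', hσ's, hσ'⟩ := hΔ.exists_facet_of_unique hzΔ hs h2 (fun s' hs' h3 => by
        by_contra hne
        rw [hr'] at h3
        exact hcon s hs s' hs' ⟨h1, hne⟩ h3)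
      refine hxW (mem_iUnion.2 ⟨σ', ?_, ?_⟩)
      · rw [σ'.mem_carrier_iff hΔ, hσ's]
        exact ⟨hΔ.bdA_subset (τ.normal_mem_bdA hΔ hh).1, h1⟩
      · unfold proj
        rw [hσ's, ← hr']
        exact hσ'
    · rw [measure_biUnion_null_iff hΔ.finite_dualLat.countable]
      intro s _
      rw [measure_biUnion_null_iff hΔ.finite_dualLat.countable]
      intro s' _
      by_cases hc : toVec m ⬝ᵥ toVec s = 1 ∧ s' ≠ s
      · exact measure_mono_null (fun x hx => hx.2) (volume_two_active hΔ σ hσ hc.1 hc.2)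
      · have : {x : Fin d → ℝ | (toVec m ⬝ᵥ toVec s = 1 ∧ s' ≠ s) ∧
            (σ.lin x + (1 - σ.lin x ⬝ᵥ toVec s) • toVec m) ⬝ᵥ toVec s' = 1} = ∅ := by
          rw [eq_empty_iff_forall_notMem]
          exact fun x hx => hc hx.1
        rw [this, measure_empty]
  have hsplit : volume X = ∑' σ', volume (X ∩ W σ') := by
    have hm1 : MeasurableSet (⋃ σ', W σ') := MeasurableSet.iUnion hWmeas
    have h1 := measure_inter_add_sdiff (μ := volume) X hm1
    rw [hnull, add_zero] at h1
    rw [← h1, ← Measure.restrict_apply' hm1, Measure.restrict_iUnion hWdisj hWmeas,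
      Measure.sum_apply_of_countable]
    exact tsum_congr fun σ' => Measure.restrict_apply' (hWmeas σ')
  rw [hsplit, muM_apply hΔ]
  refine tsum_congr fun σ' => ?_
  by_cases hc : toVec m ∈ σ'.carrier
  · rw [← volume_preimage_proj hΔ hσ hc]
    congr 1
    ext x
    constructor
    · rintro ⟨⟨r, hr⟩, _, hrel⟩
      refine ⟨?_, hrel⟩
      obtain ⟨hzΔ, s, hs, h1, h2⟩ := hstar _ hr
      obtain ⟨h5, h6, _⟩ := (σ'.mem_relint hΔ).1 hrel
      have := hexit _ _ _ _ _ hs (σ'.normal_spec hΔ).1 h1 ((σ'.normal_spec hΔ).2 _ hc) hzΔ h5 h2 h6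
      unfold proj
      rwa [← this]
    · rintro ⟨h1, h2⟩
      exact ⟨⟨_, h1⟩, hc, h2⟩
  · have h1 : X ∩ W σ' = ∅ := by
      rw [eq_empty_iff_forall_notMem]
      rintro x ⟨_, h1, _⟩
      exact hc h1
    -- Stable contacts of `τ°` lie in `St(m_τ)`, which misses the relative interiors of the facets
    -- not containing `m_τ`.
    have h2 : S ∩ σ'.relint = ∅ := by
      rw [eq_empty_iff_forall_notMem]
      rintro z ⟨h1, h2⟩
      obtain ⟨_, s, hs, h3, h4⟩ := hstar z h1
      have := ((σ'.mem_relint hΔ).1 h2).2.2 s hs h4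
      subst this
      exact hc ((σ'.mem_carrier_iff hΔ).2 ⟨hΔ.bdA_subset (τ.normal_mem_bdA hΔ hh).1, h3⟩)
    rw [h1, h2, preimage_empty, measure_empty]

/-- The extended Monge-Ampère equation in terms of the stable part of the contact set. -/
theorem solvesExtendedMA_iff (hΔ : IsReflexive Δ) (hh : IsHeight Δ h) (hΨ : InP Δ Ψ)
    {ν : Measure (Vec d)} : SolvesExtendedMA Δ h ν (chartSet Δ h Ψ) Ψ ↔
      (∀ τ : Facet (dualH Δ h), ∀ E ⊆ τ.relint, MeasurableSet E →
        muM Δ (stableImage Δ h Ψ E) = ν E) ∧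
      ∀ σ : Facet Δ, ∀ E ⊆ chartSet Δ h Ψ σ, MeasurableSet E →
        muM Δ (stableImage Δ h Ψ E) = ν E := by
  constructor
  · rintro ⟨_, h1, h2⟩
    refine ⟨fun τ E hE hEm => ?_, fun σ E hE hEm => ?_⟩
    · obtain ⟨σ, hσ⟩ := hΔ.exists_facet_mem (τ.normal_mem_bdA hΔ hh).1
      rw [← volume_subgradient_relint hΔ hh hΨ hσ hE]
      exact h1 τ σ hσ E hEm hE
    · obtain ⟨m, hm⟩ : σ.carrier.Nonempty := σ.nonempty
      rw [← volume_subgradient_chartSet hΔ hh hΨ hm hE]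
      exact h2 σ m hm E hEm hE
  · rintro ⟨h1, h2⟩
    refine ⟨hΨ, fun τ σ hσ E hEm hE => ?_, fun σ m hm E hEm hE => ?_⟩
    · rw [volume_subgradient_relint hΔ hh hΨ hσ hE]
      exact h1 τ E hE hEm
    · rw [volume_subgradient_chartSet hΔ hh hΨ hm hE]
      exact h2 σ E hE hEm

end

section

/-! ### Kantorovich duality on compact spaces -/

section Duality

variable {X Y : Type*} [MetricSpace X] [CompactSpace X] [MeasurableSpace X] [BorelSpace X]
  [MetricSpace Y] [CompactSpace Y] [MeasurableSpace Y] [BorelSpace Y]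

/-- A positive linear functional on the continuous functions on a compact metric space is
integration against a finite measure. -/
theorem exists_measure_of_positive (Λ : C(X, ℝ) →ₗ[ℝ] ℝ) (hΛ : ∀ u : C(X, ℝ), 0 ≤ u → 0 ≤ Λ u) :
    ∃ γ : Measure X, IsFiniteMeasure γ ∧ ∀ u : C(X, ℝ), ∫ x, u x ∂γ = Λ u := by
  let Λ₁ : CompactlySupportedContinuousMap X ℝ →ₗ[ℝ] ℝ :=
    { toFun := fun f => Λ f.toContinuousMap
      map_add' := fun f g => Λ.map_add f.toContinuousMap g.toContinuousMap
      map_smul' := fun c f => Λ.map_smul c f.toContinuousMap }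
  let Λ₂ : CompactlySupportedContinuousMap X ℝ →ₚ[ℝ] ℝ :=
    PositiveLinearMap.mk₀ Λ₁ fun f hf => hΛ f.toContinuousMap hf
  refine ⟨RealRMK.rieszMeasure Λ₂, ?_, fun u => ?_⟩
  · exact ⟨isCompact_univ.measure_lt_top⟩
  · exact RealRMK.integral_rieszMeasure Λ₂
      (CompactlySupportedContinuousMap.continuousMapEquiv u)

theorem integrable_continuousMap (μ : Measure X) [IsFiniteMeasure μ] (φ : C(X, ℝ)) :
    Integrable φ μ := by
  have := φ.continuous.continuousOn.integrableOn_compact (μ := μ) isCompact_univ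
  rwa [integrableOn_univ] at this

/-- If a pair of continuous functions minimizes the dual Kantorovich problem, then there is a
coupling that is concentrated on the set where the constraint is an equality. -/
theorem exists_coupling (μ : Measure X) (ν : Measure Y) [IsFiniteMeasure μ] [IsFiniteMeasure ν]
    (hmass : μ univ = ν univ) (c : C(X × Y, ℝ)) (φ₀ : C(X, ℝ)) (ψ₀ : C(Y, ℝ))
    (hge : ∀ x y, c (x, y) ≤ φ₀ x + ψ₀ y)
    (hmin : ∀ (φ : C(X, ℝ)) (ψ : C(Y, ℝ)), (∀ x y, c (x, y) ≤ φ x + ψ y) →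
      ∫ x, φ₀ x ∂μ + ∫ y, ψ₀ y ∂ν ≤ ∫ x, φ x ∂μ + ∫ y, ψ y ∂ν) :
    ∃ γ : Measure (X × Y), γ.map Prod.fst = μ ∧ γ.map Prod.snd = ν ∧
      ∀ᵐ p ∂γ, c p = φ₀ p.1 + ψ₀ p.2 := by
  by_cases hμ0 : μ univ = 0
  · refine ⟨0, ?_, ?_, by simp⟩
    · rw [Measure.map_zero, Measure.measure_univ_eq_zero.1 hμ0]
    · rw [Measure.map_zero, Measure.measure_univ_eq_zero.1 (hmass.symm.trans hμ0)]
  have hXne : Nonempty X := by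
    by_contra hX
    rw [not_nonempty_iff] at hX
    exact hμ0 (by rw [univ_eq_empty_iff.2 hX, measure_empty])
  have hYne : Nonempty Y := by
    by_contra hY
    rw [not_nonempty_iff] at hY
    exact hμ0 (by rw [hmass, univ_eq_empty_iff.2 hY, measure_empty])
  set M := μ.real univ with hM
  have hMpos : 0 < M := by
    rw [hM, measureReal_def]
    exact ENNReal.toReal_pos hμ0 (measure_ne_top _ _)
  have hiX := fun φ : C(X, ℝ) => integrable_continuousMap μ φ
  have hiY := fun ψ : C(Y, ℝ) => integrable_continuousMap ν ψ
  set I := ∫ x, φ₀ x ∂μ + ∫ y, ψ₀ y ∂ν with hI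
  -- The wanted measure has prescribed marginals and should integrate `c` to the optimal value `I`.
  -- This prescribes its integrals, recorded by `ℓ`, on the functions `φ(x) + ψ(y) + t c(x, y)` in
  -- the range of `T`; a positive extension is sought.
  let T : (C(X, ℝ) × C(Y, ℝ) × ℝ) →ₗ[ℝ] C(X × Y, ℝ) :=
    { toFun := fun v => v.1.comp ⟨Prod.fst, continuous_fst⟩ +
        v.2.1.comp ⟨Prod.snd, continuous_snd⟩ + v.2.2 • c
      map_add' := fun v w => by
        ext p
        simp only [Prod.fst_add, Prod.snd_add, ContinuousMap.add_apply, ContinuousMap.comp_apply,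
          ContinuousMap.coe_mk, ContinuousMap.smul_apply, smul_eq_mul]
        ring
      map_smul' := fun r v => by
        ext p
        simp only [Prod.smul_fst, Prod.smul_snd, ContinuousMap.add_apply,
          ContinuousMap.comp_apply, ContinuousMap.coe_mk, ContinuousMap.smul_apply, smul_eq_mul,
          RingHom.id_apply]
        ring }
  have hT : ∀ φ ψ t x y, T (φ, ψ, t) (x, y) = φ x + ψ y + t * c (x, y) := fun _ _ _ _ _ => rfl
  let ℓ : (C(X, ℝ) × C(Y, ℝ) × ℝ) →ₗ[ℝ] ℝ :=
    { toFun := fun v => ∫ x, v.1 x ∂μ + ∫ y, v.2.1 y ∂ν + v.2.2 * I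
      map_add' := fun v w => by
        simp only [Prod.fst_add, Prod.snd_add, ContinuousMap.add_apply]
        rw [integral_add (hiX _) (hiX _), integral_add (hiY _) (hiY _)]
        ring
      map_smul' := fun r v => by
        simp only [Prod.smul_fst, Prod.smul_snd, ContinuousMap.smul_apply, smul_eq_mul,
          RingHom.id_apply]
        rw [integral_const_mul, integral_const_mul]
        ring }
  have hℓ : ∀ φ ψ t, ℓ (φ, ψ, t) = ∫ x, φ x ∂μ + ∫ y, ψ y ∂ν + t * I := fun _ _ _ => rfl
  -- positivity
  have hpos0 : ∀ (φ : C(X, ℝ)) (ψ : C(Y, ℝ)), (∀ x y, 0 ≤ φ x + ψ y) →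
      0 ≤ ∫ x, φ x ∂μ + ∫ y, ψ y ∂ν := by
    intro φ ψ hφψ
    have h1 := hmin (φ₀ + φ) (ψ₀ + ψ) fun x y => by
      have := hge x y
      have := hφψ x y
      simp only [ContinuousMap.add_apply]
      linarith
    simp only [ContinuousMap.add_apply] at h1
    rw [integral_add (hiX _) (hiX _), integral_add (hiY _) (hiY _)] at h1
    linarith
  have hpos : ∀ v, 0 ≤ T v → 0 ≤ ℓ v := by
    rintro ⟨φ, ψ, t⟩ hv
    have hv' : ∀ x y, 0 ≤ φ x + ψ y + t * c (x, y) := fun x y => by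
      rw [← hT]; exact hv (x, y)
    rw [hℓ]
    -- For `t ≥ 0` replace `c` by the larger `φ₀ + ψ₀`. For `t < 0` the pair `(φ, ψ)` divided by
    -- `-t` is admissible, and minimality of `(φ₀, ψ₀)` applies.
    rcases le_or_gt 0 t with ht | ht
    · have h1 := hpos0 (φ + t • φ₀) (ψ + t • ψ₀) fun x y => by
        have h2 := hv' x y
        have h3 := mul_le_mul_of_nonneg_left (hge x y) ht
        simp only [ContinuousMap.add_apply, ContinuousMap.smul_apply, smul_eq_mul]
        linarith
      simp only [ContinuousMap.add_apply, ContinuousMap.smul_apply, smul_eq_mul] at h1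
      rw [integral_add (hiX _) ((hiX _).const_mul _), integral_add (hiY _) ((hiY _).const_mul _),
        integral_const_mul, integral_const_mul] at h1
      rw [hI]
      linarith
    · have h1 := hmin ((-t)⁻¹ • φ) ((-t)⁻¹ • ψ) fun x y => by
        have h2 := hv' x y
        simp only [ContinuousMap.smul_apply, smul_eq_mul]
        rw [← mul_add, ← div_eq_inv_mul, le_div_iff₀ (by linarith)]
        linarith
      simp only [ContinuousMap.smul_apply, smul_eq_mul] at h1
      rw [integral_const_mul, integral_const_mul, ← mul_add, ← div_eq_inv_mul,
        le_div_iff₀ (by linarith)] at h1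
      linarith
  have hstrict : ∀ v, (∀ p, 0 < T v p) → 0 < ℓ v := by
    rintro ⟨φ, ψ, t⟩ hv
    obtain ⟨p₀, _, hp₀⟩ := isCompact_univ.exists_isMinOn univ_nonempty
      (T (φ, ψ, t)).continuous.continuousOn
    set δ := T (φ, ψ, t) p₀ with hδ
    have h1 := hpos (φ - ContinuousMap.const X δ, ψ, t) (by
      rintro ⟨x, y⟩
      have h2 : δ ≤ T (φ, ψ, t) (x, y) := hp₀ (mem_univ (x, y))
      show (0 : ℝ) ≤ T (φ - ContinuousMap.const X δ, ψ, t) (x, y)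
      rw [hT] at h2 ⊢
      simp only [ContinuousMap.sub_apply, ContinuousMap.const_apply]
      linarith)
    rw [hℓ] at h1 ⊢
    simp only [ContinuousMap.sub_apply, ContinuousMap.const_apply] at h1
    rw [integral_sub (hiX _) (integrable_const _), integral_const, smul_eq_mul] at h1
    have h3 := mul_pos hMpos (hv p₀)
    linarith
  -- separation
  have hPopen : IsOpen {u : C(X × Y, ℝ) | ∀ p, 0 < u p} := by
    have := ContinuousMap.isOpen_setOfPred_mapsTo (X := X × Y) (Y := ℝ) isCompact_univ
      (isOpen_Ioi (a := (0 : ℝ)))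
    convert this using 1
    ext u
    simp [MapsTo]
  have hPconv : Convex ℝ {u : C(X × Y, ℝ) | ∀ p, 0 < u p} := by
    intro u hu v hv a b ha hb hab p
    simp only [ContinuousMap.add_apply, ContinuousMap.smul_apply, smul_eq_mul]
    rcases ha.eq_or_lt with rfl | ha'
    · have : b = 1 := by linarith
      simpa [this] using hv p
    · exact add_pos_of_pos_of_nonneg (mul_pos ha' (hu p)) (mul_nonneg hb (hv p).le)
  -- The image of the kernel of `ℓ` contains no strictly positive function. A functional separating
  -- it from the positive cone vanishes on it, hence is proportional to `ℓ` on the range of `T`.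
  let F : Submodule ℝ C(X × Y, ℝ) := (LinearMap.ker ℓ).map T
  have hdisj : Disjoint {u : C(X × Y, ℝ) | ∀ p, 0 < u p} (F : Set C(X × Y, ℝ)) := by
    rw [Set.disjoint_left]
    rintro _ hu ⟨v, hv, rfl⟩
    exact (hstrict v hu).ne' hv
  obtain ⟨f, r, hf1, hf2⟩ := geometric_hahn_banach_open hPconv hPopen F.convex hdisj
  have hr0 : r ≤ 0 := by simpa using hf2 0 F.zero_mem
  have hfF : ∀ u ∈ F, f u = 0 := by
    intro u hu
    by_contra hne
    have h1 := hf2 (((r - 1) / f u) • u) (F.smul_mem _ hu)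
    rw [map_smul, smul_eq_mul, div_mul_cancel₀ _ hne] at h1
    linarith
  have hf1' : f 1 < 0 := (hf1 1 fun p => by simp).trans_le hr0
  have hfnn : ∀ u : C(X × Y, ℝ), 0 ≤ u → f u ≤ 0 := by
    intro u hu
    refine le_of_forall_pos_le_add fun ε hε => ?_
    have h1 := hf1 (u + (ε / (-f 1)) • 1) fun p => by
      have h2 : 0 < ε / (-f 1) := div_pos hε (by linarith)
      have h3 : (0 : ℝ) ≤ u p := hu p
      simp only [ContinuousMap.add_apply, ContinuousMap.smul_apply, smul_eq_mul,
        ContinuousMap.one_apply]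
      linarith
    rw [map_add, map_smul, smul_eq_mul] at h1
    have h4 : ε / (-f 1) * f 1 = -ε := by
      rw [div_neg, neg_mul, div_mul_cancel₀ _ hf1'.ne]
    linarith
  have hfT : ∀ v, f (T v) = ℓ v / M * f 1 := by
    rintro ⟨φ, ψ, t⟩
    -- Subtracting the constant `κ` from `φ` lands in the kernel of `ℓ`, since a constant integrates
    -- to `M` times its value.
    set κ := ℓ (φ, ψ, t) / M with hκ
    have h1 : (φ - ContinuousMap.const X κ, ψ, t) ∈ LinearMap.ker ℓ := by
      rw [LinearMap.mem_ker, hℓ]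
      simp only [ContinuousMap.sub_apply, ContinuousMap.const_apply]
      rw [integral_sub (hiX _) (integrable_const _), integral_const, smul_eq_mul]
      have h2 : M * κ = ℓ (φ, ψ, t) := by rw [hκ, mul_div_cancel₀ _ hMpos.ne']
      rw [hℓ] at h2
      rw [← hM, h2]
      ring
    have h3 := hfF _ ⟨_, h1, rfl⟩
    have h4 : T (φ, ψ, t) = T (φ - ContinuousMap.const X κ, ψ, t) + κ • 1 := by
      ext ⟨x, y⟩
      rw [ContinuousMap.add_apply, hT, hT]
      simp only [ContinuousMap.sub_apply, ContinuousMap.const_apply, ContinuousMap.smul_apply,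
        ContinuousMap.one_apply, smul_eq_mul]
      ring
    rw [h4, map_add, h3, map_smul, zero_add, smul_eq_mul]
  -- The factor `M / f 1` is negative, so it turns `f` into a positive functional; it also gives `γ`
  -- total mass `M`.
  obtain ⟨γ, hγfin, hγ⟩ := exists_measure_of_positive ((M / f 1) • f.toLinearMap) fun u hu =>
    mul_nonneg_of_nonpos_of_nonpos (div_nonpos_of_nonneg_of_nonpos hMpos.le hf1'.le) (hfnn u hu)
  have hγT : ∀ v, ∫ p, T v p ∂γ = ℓ v := by
    intro v
    rw [hγ]
    show (M / f 1) * f (T v) = ℓ v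
    rw [hfT]
    have := hf1'.ne
    have := hMpos.ne'
    field_simp
  refine ⟨γ, ?_, ?_, ?_⟩
  · refine ext_of_forall_integral_eq_of_IsFiniteMeasure fun φ => ?_
    rw [integral_map measurable_fst.aemeasurable φ.continuous.aestronglyMeasurable]
    have h1 := hγT (φ.toContinuousMap, 0, 0)
    rw [hℓ] at h1
    simpa [hT, T] using h1
  · refine ext_of_forall_integral_eq_of_IsFiniteMeasure fun ψ => ?_
    rw [integral_map measurable_snd.aemeasurable ψ.continuous.aestronglyMeasurable]
    have h1 := hγT (0, ψ.toContinuousMap, 0)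
    rw [hℓ] at h1
    simpa [hT, T] using h1
  -- The nonnegative function `φ₀ + ψ₀ - c` has integral `I - I = 0` against `γ`.
  · have h1 := hγT (φ₀, ψ₀, -1)
    rw [hℓ, ← hI, neg_one_mul, add_neg_cancel] at h1
    have hnn : 0 ≤ fun p => T (φ₀, ψ₀, -1) p := by
      rintro ⟨x, y⟩
      simp only [Pi.zero_apply]
      rw [hT]
      have := hge x y
      linarith
    rw [integral_eq_zero_iff_of_nonneg hnn (integrable_continuousMap γ _)] at h1
    filter_upwards [h1] with p hp
    have h2 : φ₀ p.1 + ψ₀ p.2 + -1 * c (p.1, p.2) = 0 := hp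
    have h3 : c (p.1, p.2) = c p := rfl
    linarith

end Duality

end

section

variable {d : ℕ} {Δ : Set (Vec d)} {h : Lat d → ℤ} {ν : Measure (Vec d)}

/-! ### Existence of Kantorovich potentials -/

theorem isFiniteMeasure_target (hΔ : IsReflexive Δ) (hνB : ν (bdB Δ h)ᶜ = 0)
    (hνmass : ν (bdB Δ h) = muM Δ (bdA Δ)) : IsFiniteMeasure ν := by
  have := isFiniteMeasure_muM hΔ
  refine ⟨?_⟩
  rw [← union_compl_self (bdB Δ h)]
  refine (measure_union_le _ _).trans_lt ?_
  rw [hνB, add_zero, hνmass]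
  exact measure_lt_top _ _

theorem integrableOn_bdA (hΔ : IsReflexive Δ) {φ : Vec d → ℝ} (hφ : ContinuousOn φ (bdA Δ)) :
    IntegrableOn φ (bdA Δ) (muM Δ) := by
  have := isFiniteMeasure_muM hΔ
  exact hφ.integrableOn_compact hΔ.isCompact_bdA

theorem integrableOn_bdB (hΔ : IsReflexive Δ) [IsFiniteMeasure ν] {ψ : Vec d → ℝ}
    (hψ : ContinuousOn ψ (bdB Δ h)) : IntegrableOn ψ (bdB Δ h) ν :=
  hψ.integrableOn_compact (isCompact_bdB hΔ)

theorem cTransB_congr {Ψ Ψ' : Vec d → ℝ} (hE : EqOn Ψ Ψ' (bdB Δ h)) :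
    cTransB Δ h Ψ = cTransB Δ h Ψ' := by
  funext m
  unfold cTransB
  exact congrArg _ (funext fun n => by rw [hE n.2])

theorem measurableSet_bdB (hΔ : IsReflexive Δ) : MeasurableSet (bdB Δ h) :=
  (isCompact_bdB hΔ).measurableSet

theorem dualJ_congr (hΔ : IsReflexive Δ) {Ψ Ψ' : Vec d → ℝ} (hE : EqOn Ψ Ψ' (bdB Δ h)) :
    dualJ Δ h ν Ψ = dualJ Δ h ν Ψ' := by
  unfold dualJ
  rw [cTransB_congr hE, setIntegral_congr_fun (measurableSet_bdB hΔ) hE]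

/-- The double transform improves any admissible pair for the dual problem. -/
theorem le_dualJ_double (hΔ : IsReflexive Δ) (hh : IsHeight Δ h) [IsFiniteMeasure ν]
    {φ ψ : Vec d → ℝ} (hφ : ContinuousOn φ (bdA Δ)) (hψ : ContinuousOn ψ (bdB Δ h))
    (hle : ∀ m ∈ bdA Δ, ∀ n ∈ bdB Δ h, m ⬝ᵥ n ≤ φ m + ψ n) :
    -(∫ m in bdA Δ, φ m ∂(muM Δ)) - ∫ n in bdB Δ h, ψ n ∂ν ≤
      dualJ Δ h ν (cTransA Δ (cTransB Δ h ψ)) := by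
  have hc1 := continuous_cTransB hΔ hh hψ
  have hc2 := continuous_cTransA hΔ hc1.continuousOn
  have hc3 := continuous_cTransB hΔ hh (hc2.continuousOn (s := bdB Δ h))
  unfold dualJ
  have h1 : ∫ m in bdA Δ, cTransB Δ h (cTransA Δ (cTransB Δ h ψ)) m ∂(muM Δ) ≤
      ∫ m in bdA Δ, φ m ∂(muM Δ) := by
    refine setIntegral_mono_on (integrableOn_bdA hΔ hc3.continuousOn) (integrableOn_bdA hΔ hφ)
      hΔ.isCompact_bdA.measurableSet fun m hm => ?_
    have h2 : cTransB Δ h (cTransA Δ (cTransB Δ h ψ)) m ≤ cTransB Δ h ψ m :=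
      cTransB_le hΔ hh fun n _ => by
        have := le_cTransA hΔ hc1.continuousOn n hm
        linarith
    refine h2.trans (cTransB_le hΔ hh fun n hn => ?_)
    have := hle m hm n hn
    linarith
  have h2 : ∫ n in bdB Δ h, cTransA Δ (cTransB Δ h ψ) n ∂ν ≤ ∫ n in bdB Δ h, ψ n ∂ν := by
    refine setIntegral_mono_on (integrableOn_bdB hΔ hc2.continuousOn) (integrableOn_bdB hΔ hψ)
      (measurableSet_bdB hΔ) fun n hn => cTransA_le hΔ fun m _ => ?_
    have := le_cTransB hΔ hψ m hn
    linarith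
  linarith

/-- Functions on the subspaces `A` and `B` are extended by the default value 0; transforms and
integrals only see the values on the subspace. -/
theorem continuousOn_extend {X : Type*} [TopologicalSpace X] {s : Set X} {f : s → ℝ}
    (hf : Continuous f) : ContinuousOn (Function.extend Subtype.val f 0) s := by
  rw [continuousOn_iff_continuous_domRestrict]
  convert hf using 1
  funext x
  exact Subtype.val_injective.extend_apply f 0 x

theorem extend_val_apply {X : Type*} {s : Set X} (f : s → ℝ) {x : X} (hx : x ∈ s) :
    Function.extend Subtype.val f 0 x = f ⟨x, hx⟩ :=
  Subtype.val_injective.extend_apply f 0 ⟨x, hx⟩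

open BoundedContinuousFunction in
-- A uniform change of the function by at most `ε` changes its transform by at most `ε`, so the
-- functional is Lipschitz with constant the sum of the two masses.
theorem continuous_dualJ_extend (hΔ : IsReflexive Δ) (hh : IsHeight Δ h) [IsFiniteMeasure ν] :
    Continuous fun f : bdB Δ h →ᵇ ℝ => dualJ Δ h ν (Function.extend Subtype.val f 0) := by
  have hfin := isFiniteMeasure_muM hΔ
  have hlip : LipschitzWith ((muM Δ).real (bdA Δ) + ν.real (bdB Δ h)).toNNReal
      fun f : bdB Δ h →ᵇ ℝ => dualJ Δ h ν (Function.extend Subtype.val f 0) := by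
    refine LipschitzWith.of_le_add_mul _ fun f g => ?_
    rw [Real.coe_toNNReal _ (by positivity)]
    have hf := continuousOn_extend f.continuous
    have hg := continuousOn_extend g.continuous
    have hdist : ∀ n ∈ bdB Δ h, |Function.extend Subtype.val f 0 n -
        Function.extend Subtype.val g 0 n| ≤ dist f g := fun n hn => by
      rw [extend_val_apply f hn, extend_val_apply g hn, ← Real.dist_eq]
      exact BoundedContinuousFunction.dist_coe_le_dist _
    have h1 : ∫ m in bdA Δ, cTransB Δ h (Function.extend Subtype.val g 0) m ∂(muM Δ) ≤
        ∫ m in bdA Δ, (cTransB Δ h (Function.extend Subtype.val f 0) m + dist f g) ∂(muM Δ) := by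
      have hcf := continuous_cTransB hΔ hh hf
      refine setIntegral_mono_on
        (integrableOn_bdA hΔ (continuous_cTransB hΔ hh hg).continuousOn)
        (integrableOn_bdA hΔ (by fun_prop))
        hΔ.isCompact_bdA.measurableSet fun m _ => cTransB_le hΔ hh fun n hn => ?_
      have h2 := le_cTransB hΔ hf m hn
      have h3 := (abs_le.1 (hdist n hn)).2
      linarith
    have h2 : ∫ n in bdB Δ h, Function.extend Subtype.val g 0 n ∂ν ≤
        ∫ n in bdB Δ h, (Function.extend Subtype.val f 0 n + dist f g) ∂ν := by
      refine setIntegral_mono_on (integrableOn_bdB hΔ hg)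
        (integrableOn_bdB hΔ (hf.add continuousOn_const)) (measurableSet_bdB hΔ) fun n hn => ?_
      have h3 := (abs_le.1 (hdist n hn)).1
      linarith
    rw [integral_add (integrableOn_bdA hΔ (continuous_cTransB hΔ hh hf).continuousOn)
      (integrable_const _), setIntegral_const, smul_eq_mul] at h1
    rw [integral_add (integrableOn_bdB hΔ hf) (integrable_const _), setIntegral_const,
      smul_eq_mul] at h2
    unfold dualJ
    linarith
  exact hlip.continuous

/-- Adding `c` lowers the transform by `c`, and the two masses agree. Potentials may therefore be
normalized to vanish at a point. -/
theorem dualJ_add_const (hΔ : IsReflexive Δ) (hh : IsHeight Δ h) [IsFiniteMeasure ν]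
    (hνmass : ν (bdB Δ h) = muM Δ (bdA Δ)) {Ψ : Vec d → ℝ} (hΨ : ContinuousOn Ψ (bdB Δ h))
    (c : ℝ) : dualJ Δ h ν (fun n => Ψ n + c) = dualJ Δ h ν Ψ := by
  have hfin := isFiniteMeasure_muM hΔ
  have h1 : ∀ m, cTransB Δ h (fun n => Ψ n + c) m = cTransB Δ h Ψ m + -c := by
    intro m
    refine le_antisymm (cTransB_le hΔ hh fun n hn => ?_) ?_
    · have := le_cTransB hΔ hΨ m hn
      linarith
    · have : cTransB Δ h Ψ m ≤ cTransB Δ h (fun n => Ψ n + c) m + c :=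
        cTransB_le hΔ hh fun n hn => by
          have := le_cTransB (Ψ := fun n => Ψ n + c) hΔ (hΨ.add continuousOn_const) m hn
          linarith
      linarith
  have hmass : (muM Δ).real (bdA Δ) = ν.real (bdB Δ h) := by
    rw [measureReal_def, measureReal_def, hνmass]
  unfold dualJ
  simp only [h1]
  rw [integral_add (integrableOn_bdA hΔ (continuous_cTransB hΔ hh hΨ).continuousOn)
    (integrable_const _), integral_add (integrableOn_bdB hΔ hΨ) (integrable_const _),
    setIntegral_const, setIntegral_const, hmass, smul_eq_mul, smul_eq_mul]
  ring

open BoundedContinuousFunction in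
-- Direct method. A `c`-convex function is a transform on `B`, hence Lipschitz with a universal
-- constant, and can be normalized at `p₀`. By Arzelà-Ascoli the normalized Lipschitz functions form
-- a compact set, on which `J` has a maximizer; its double transform lies in `𝒫(Δ)` and does not
-- decrease `J`.
theorem exists_kantorovichPotential (hΔ : IsReflexive Δ) (hh : IsHeight Δ h) [IsFiniteMeasure ν]
    (hνmass : ν (bdB Δ h) = muM Δ (bdA Δ)) : ∃ Ψ, IsKantorovichPotential Δ h ν Ψ := by
  have hcomp : CompactSpace (bdB Δ h) := isCompact_iff_compactSpace.1 (isCompact_bdB hΔ)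
  obtain ⟨K, hK⟩ := exists_lipschitz_cTransA hΔ
  obtain ⟨n₀, hn₀⟩ := bdB_nonempty hΔ hh
  let p₀ : bdB Δ h := ⟨n₀, hn₀⟩
  let 𝒦 : Set (bdB Δ h →ᵇ ℝ) := {f | LipschitzWith K f ∧ f p₀ = 0}
  have hclosed : IsClosed 𝒦 := by
    have hset : 𝒦 = (⋂ x, ⋂ y, {f : bdB Δ h →ᵇ ℝ | dist (f x) (f y) ≤ K * dist x y}) ∩
        {f | f p₀ = 0} := by
      ext f
      simp only [𝒦, mem_ofPred_eq, mem_inter_iff, mem_iInter, lipschitzWith_iff_dist_le_mul]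
    rw [hset]
    refine IsClosed.inter (isClosed_iInter fun x => isClosed_iInter fun y => ?_) ?_
    · exact isClosed_le (by fun_prop) continuous_const
    · exact isClosed_eq (by fun_prop) continuous_const
  have hcompact : IsCompact 𝒦 := by
    refine BoundedContinuousFunction.arzela_ascoli₂
      (Metric.closedBall 0 (K * Metric.diam (univ : Set (bdB Δ h)))) (isCompact_closedBall _ _) 𝒦
      hclosed ?_ ?_
    · rintro f x ⟨hf, hf0⟩
      rw [Metric.mem_closedBall, ← hf0]
      refine (hf.dist_le_mul x p₀).trans ?_
      gcongr
      exact Metric.dist_le_diam_of_mem isCompact_univ.isBounded (mem_univ _) (mem_univ _)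
    · exact (LipschitzWith.uniformEquicontinuous _ K fun f => f.2.1).equicontinuous
  have hne : 𝒦.Nonempty := ⟨0, by
    refine ⟨?_, rfl⟩
    exact LipschitzWith.const' 0⟩
  obtain ⟨f₀, _, hmax⟩ := hcompact.exists_isMaxOn hne
    (continuous_dualJ_extend (ν := ν) hΔ hh).continuousOn
  set Ψ₀ : Vec d → ℝ := Function.extend Subtype.val f₀ 0 with hΨ₀
  have hc0 : ContinuousOn Ψ₀ (bdB Δ h) := continuousOn_extend f₀.continuous
  have hc1 := continuous_cTransB hΔ hh hc0
  have hP := inP_cTransA hΔ (hc1.continuousOn (s := bdA Δ))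
  refine ⟨cTransA Δ (cTransB Δ h Ψ₀), hP, hP.isCConvex hΔ hh, fun Ψ' hΨ' => ?_⟩
  have hstep : dualJ Δ h ν Ψ₀ ≤ dualJ Δ h ν (cTransA Δ (cTransB Δ h Ψ₀)) :=
    le_dualJ_double hΔ hh hc1.continuousOn hc0 fun m _ n hn => by
      have := le_cTransB hΔ hc0 m hn
      linarith
  refine le_trans ?_ hstep
  have hlip : LipschitzWith K fun n : bdB Δ h => Ψ' n + -Ψ' n₀ := by
    have h1 := hK _ ((continuous_cTransB hΔ hh hΨ'.1).continuousOn (s := bdA Δ))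
    refine LipschitzWith.of_dist_le_mul fun x y => ?_
    rw [dist_add_right, ← hΨ'.2 x x.2, ← hΨ'.2 y y.2]
    exact h1.dist_le_mul x y
  let f' : bdB Δ h →ᵇ ℝ := BoundedContinuousFunction.mkOfCompact
    ⟨fun n : bdB Δ h => Ψ' n + -Ψ' n₀, hlip.continuous⟩
  have hf' : f' ∈ 𝒦 := ⟨hlip, add_neg_cancel _⟩
  have h2 := hmax hf'
  rw [← dualJ_add_const hΔ hh hνmass hΨ'.1 (-Ψ' n₀)]
  refine le_trans (le_of_eq (dualJ_congr hΔ fun n hn => ?_)) h2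
  rw [extend_val_apply f' hn]
  rfl

/-- Kantorovich potentials minimize over all admissible pairs of the dual problem. -/
theorem IsKantorovichPotential.le_dualJ (hΔ : IsReflexive Δ) (hh : IsHeight Δ h)
    [IsFiniteMeasure ν] {Ψ : Vec d → ℝ} (hΨ : IsKantorovichPotential Δ h ν Ψ)
    {φ ψ : Vec d → ℝ} (hφ : ContinuousOn φ (bdA Δ)) (hψ : ContinuousOn ψ (bdB Δ h))
    (hle : ∀ m ∈ bdA Δ, ∀ n ∈ bdB Δ h, m ⬝ᵥ n ≤ φ m + ψ n) :
    -(∫ m in bdA Δ, φ m ∂(muM Δ)) - ∫ n in bdB Δ h, ψ n ∂ν ≤ dualJ Δ h ν Ψ :=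
  (le_dualJ_double hΔ hh hφ hψ hle).trans (hΨ.2.2 _ ((inP_cTransA hΔ
    ((continuous_cTransB hΔ hh hψ).continuousOn)).isCConvex hΔ hh))

/-! ### Transport plans and the contact set -/

theorem muM_restrict_bdA (hΔ : IsReflexive Δ) : (muM Δ).restrict (bdA Δ) = muM Δ :=
  Measure.restrict_eq_self_of_ae_mem (by
    rw [ae_iff]; exact muM_compl_bdA hΔ)

theorem restrict_bdB (hνB : ν (bdB Δ h)ᶜ = 0) : ν.restrict (bdB Δ h) = ν :=
  Measure.restrict_eq_self_of_ae_mem (by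
    rw [ae_iff]; exact hνB)

/-- The optimality gap of a plan with respect to a potential. -/
theorem IsPlan.cost_sub_dualJ (hΔ : IsReflexive Δ) (hh : IsHeight Δ h) (hνB : ν (bdB Δ h)ᶜ = 0)
    [IsFiniteMeasure ν] {γ : Measure (Vec d × Vec d)} (hγ : IsPlan Δ ν γ) {Ψ : Vec d → ℝ}
    (hΨ : Continuous Ψ) :
    dualJ Δ h ν Ψ ≤ cost γ ∧ (cost γ = dualJ Δ h ν Ψ ↔ ∀ᵐ p ∂γ, p ∈ contact Δ h Ψ) := by
  have hfin := isFiniteMeasure_muM hΔ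
  have hγfin : IsFiniteMeasure γ := by
    refine ⟨?_⟩
    have h1 : γ univ = muM Δ univ := by
      rw [← hγ.1, Measure.map_apply measurable_fst MeasurableSet.univ, preimage_univ]
    rw [h1]
    exact measure_lt_top _ _
  have hΦ := continuous_cTransB hΔ hh (hΨ.continuousOn (s := bdB Δ h))
  have hAB : ∀ᵐ p ∂γ, p.1 ∈ bdA Δ ∧ p.2 ∈ bdB Δ h := by
    have h1 : ∀ᵐ m ∂(γ.map Prod.fst), m ∈ bdA Δ := by
      rw [hγ.1, ae_iff]; exact muM_compl_bdA hΔ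
    have h2 : ∀ᵐ n ∂(γ.map Prod.snd), n ∈ bdB Δ h := by
      rw [hγ.2, ae_iff]; exact hνB
    exact (ae_of_ae_map measurable_fst.aemeasurable h1).and
      (ae_of_ae_map measurable_snd.aemeasurable h2)
  have hint : ∀ {f : Vec d × Vec d → ℝ}, Continuous f → Integrable f γ := by
    intro f hf
    have h1 := hf.continuousOn.integrableOn_compact (μ := γ)
      (hΔ.isCompact_bdA.prod (isCompact_bdB (h := h) hΔ))
    rwa [IntegrableOn, Measure.restrict_eq_self_of_ae_mem (s := bdA Δ ×ˢ bdB Δ h) hAB] at h1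
  have hdot : Continuous fun p : Vec d × Vec d => p.1 ⬝ᵥ p.2 :=
    continuous_fst.dotProduct continuous_snd
  have h1 : ∫ p, cTransB Δ h Ψ p.1 ∂γ = ∫ m in bdA Δ, cTransB Δ h Ψ m ∂(muM Δ) := by
    rw [muM_restrict_bdA hΔ, ← hγ.1, integral_map measurable_fst.aemeasurable
      hΦ.aestronglyMeasurable]
  have h2 : ∫ p, Ψ p.2 ∂γ = ∫ n in bdB Δ h, Ψ n ∂ν := by
    rw [restrict_bdB hνB]
    conv_rhs => rw [← hγ.2]
    rw [integral_map measurable_snd.aemeasurable hΨ.aestronglyMeasurable]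
  have hi1 : Integrable (fun p : Vec d × Vec d => cTransB Δ h Ψ p.1) γ :=
    hint (hΦ.comp continuous_fst)
  have hi2 : Integrable (fun p : Vec d × Vec d => Ψ p.2) γ := hint (hΨ.comp continuous_snd)
  have hi3 : Integrable (fun p : Vec d × Vec d => -(p.1 ⬝ᵥ p.2)) γ := hint hdot.neg
  have hi12 : Integrable (fun p : Vec d × Vec d => cTransB Δ h Ψ p.1 + Ψ p.2) γ := hi1.add hi2
  -- The marginals turn the two terms of `J` into integrals against `γ`, so the gap is the integral
  -- of the Young defect, nonnegative on `A × B` and zero there exactly on the contact set.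
  have hgap : ∫ p, (cTransB Δ h Ψ p.1 + Ψ p.2 + -(p.1 ⬝ᵥ p.2)) ∂γ = cost γ - dualJ Δ h ν Ψ := by
    rw [integral_add hi12 hi3, integral_add hi1 hi2, h1, h2]
    unfold cost dualJ
    ring
  have hnn : 0 ≤ᵐ[γ] fun p => cTransB Δ h Ψ p.1 + Ψ p.2 + -(p.1 ⬝ᵥ p.2) := by
    filter_upwards [hAB] with p hp
    have := le_cTransB hΔ hΨ.continuousOn p.1 hp.2
    show (0 : ℝ) ≤ _
    linarith
  constructor
  · have := integral_nonneg_of_ae hnn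
    rw [hgap] at this
    linarith
  · rw [← sub_eq_zero, ← hgap, integral_eq_zero_iff_of_nonneg_ae hnn (hi12.add hi3)]
    constructor
    · intro h3
      filter_upwards [h3, hAB] with p hp hpAB
      have hp' : cTransB Δ h Ψ p.1 + Ψ p.2 + -(p.1 ⬝ᵥ p.2) = 0 := hp
      exact ⟨hpAB.1, hpAB.2, by linarith⟩
    · intro h3
      filter_upwards [h3] with p hp
      have := hp.2.2
      show cTransB Δ h Ψ p.1 + Ψ p.2 + -(p.1 ⬝ᵥ p.2) = 0
      linarith

/-- Strong duality: there is a plan that is concentrated on the contact set of a given Kantorovich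
potential. -/
theorem IsKantorovichPotential.exists_plan (hΔ : IsReflexive Δ) (hh : IsHeight Δ h)
    (hνB : ν (bdB Δ h)ᶜ = 0) (hνmass : ν (bdB Δ h) = muM Δ (bdA Δ)) [IsFiniteMeasure ν]
    {Ψ : Vec d → ℝ} (hΨ : IsKantorovichPotential Δ h ν Ψ) :
    ∃ γ, IsPlan Δ ν γ ∧ ∀ᵐ p ∂γ, p ∈ contact Δ h Ψ := by
  have hfin := isFiniteMeasure_muM hΔ
  have hcA : CompactSpace (bdA Δ) := isCompact_iff_compactSpace.1 hΔ.isCompact_bdA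
  have hcB : CompactSpace (bdB Δ h) := isCompact_iff_compactSpace.1 (isCompact_bdB hΔ)
  have hmA : MeasurableSet (bdA Δ) := hΔ.isCompact_bdA.measurableSet
  have hmB : MeasurableSet (bdB Δ h) := measurableSet_bdB hΔ
  have hΨc := hΨ.1.continuous
  have hΦc := continuous_cTransB hΔ hh (hΨc.continuousOn (s := bdB Δ h))
  -- The duality theorem is applied on the compact spaces `A` and `B`; the resulting coupling is
  -- then pushed forward to the ambient spaces.
  let μ' : Measure (bdA Δ) := (muM Δ).comap Subtype.val
  let ν' : Measure (bdB Δ h) := ν.comap Subtype.val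
  have hμ'map : μ'.map Subtype.val = muM Δ := by
    rw [map_comap_subtype_coe hmA, muM_restrict_bdA hΔ]
  have hν'map : ν'.map Subtype.val = ν := by
    rw [map_comap_subtype_coe hmB, restrict_bdB hνB]
  have hμ'u : μ' univ = muM Δ (bdA Δ) := by
    rw [(MeasurableEmbedding.subtype_coe hmA).comap_apply, image_univ, Subtype.range_coe]
  have hν'u : ν' univ = ν (bdB Δ h) := by
    rw [(MeasurableEmbedding.subtype_coe hmB).comap_apply, image_univ, Subtype.range_coe]
  have : IsFiniteMeasure μ' := ⟨by rw [hμ'u]; exact measure_lt_top _ _⟩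
  have : IsFiniteMeasure ν' := ⟨by rw [hν'u]; exact measure_lt_top _ _⟩
  obtain ⟨γ', h1, h2, h3⟩ := exists_coupling μ' ν' (by rw [hμ'u, hν'u, hνmass])
    ⟨fun p => p.1.1 ⬝ᵥ p.2.1, (continuous_subtype_val.comp continuous_fst).dotProduct
      (continuous_subtype_val.comp continuous_snd)⟩
    ⟨fun m => cTransB Δ h Ψ m, hΦc.comp continuous_subtype_val⟩
    ⟨fun n => Ψ n, hΨc.comp continuous_subtype_val⟩
    (fun m n => by
      have := le_cTransB hΔ hΨc.continuousOn m.1 n.2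
      simp only [ContinuousMap.coe_mk]
      linarith)
    (fun φ ψ hφψ => by
      have h4 := hΨ.le_dualJ hΔ hh (continuousOn_extend φ.continuous)
        (continuousOn_extend ψ.continuous) fun m hm n hn => by
          rw [extend_val_apply _ hm, extend_val_apply _ hn]
          exact hφψ ⟨m, hm⟩ ⟨n, hn⟩
      unfold dualJ at h4
      have e1 := integral_subtype_comap (μ := muM Δ) hmA (Function.extend Subtype.val φ 0)
      have e2 := integral_subtype_comap (μ := ν) hmB (Function.extend Subtype.val ψ 0)
      have e3 := integral_subtype_comap (μ := muM Δ) hmA (cTransB Δ h Ψ)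
      have e4 := integral_subtype_comap (μ := ν) hmB Ψ
      simp only [Subtype.val_injective.extend_apply] at e1 e2
      show ∫ m : bdA Δ, cTransB Δ h Ψ m ∂μ' + ∫ n : bdB Δ h, Ψ n ∂ν' ≤
        ∫ m, φ m ∂μ' + ∫ n, ψ n ∂ν'
      rw [e1, e2, e3, e4]
      linarith)
  have hmap : Measurable (Prod.map Subtype.val Subtype.val : bdA Δ × bdB Δ h → Vec d × Vec d) :=
    measurable_subtype_coe.prodMap measurable_subtype_coe
  refine ⟨γ'.map (Prod.map Subtype.val Subtype.val), ⟨?_, ?_⟩, ?_⟩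
  · rw [Measure.map_map measurable_fst hmap, ← hμ'map, ← h1,
      Measure.map_map measurable_subtype_coe measurable_fst]
    rfl
  · rw [Measure.map_map measurable_snd hmap]
    conv_rhs => rw [← hν'map, ← h2, Measure.map_map measurable_subtype_coe measurable_snd]
    rfl
  · refine (ae_map_iff hmap.aemeasurable (p := fun p => p ∈ contact Δ h Ψ)
      (isCompact_contact hΔ hh hΨc.continuousOn).measurableSet).2 ?_
    filter_upwards [h3] with p hp
    exact ⟨p.1.2, p.2.2, hp.symm⟩

end

section

variable {d : ℕ} {Δ : Set (Vec d)} {h : Lat d → ℤ} {ν : Measure (Vec d)} {Ψ Ψ' : Vec d → ℝ}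

/-! ### From plans to solutions -/

/-- A plan concentrated on the stable part of the contact set transports `stableImage E` to `E`. -/
theorem IsPlan.muM_stableImage (hΔ : IsReflexive Δ) (hh : IsHeight Δ h)
    (hΨ : ContinuousOn Ψ (bdB Δ h)) {γ : Measure (Vec d × Vec d)} (hγ : IsPlan Δ ν γ)
    (hst : ∀ᵐ p ∂γ, p ∈ stableContact Δ h Ψ) {E : Set (Vec d)} (hE : MeasurableSet E) :
    muM Δ (stableImage Δ h Ψ E) = ν E := by
  have huniq := ae_stableContact_unique hΔ hh hΨ
  have hnull := nullMeasurableSet_stableImage hΔ hh hΨ hE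
  rw [← hγ.1] at huniq hnull ⊢
  conv_rhs => rw [← hγ.2]
  rw [Measure.map_apply₀ measurable_fst.aemeasurable hnull, Measure.map_apply measurable_snd hE]
  -- For `γ`-almost every pair, the second component is the only stable partner of the first, so
  -- membership of the first in the stable image of `E` is membership of the second in `E`.
  refine measure_congr ?_
  filter_upwards [hst, ae_of_ae_map measurable_fst.aemeasurable huniq] with p hp hu
  refine propext ⟨?_, fun hpE => ⟨p.2, hpE, hp⟩⟩
  rintro ⟨n, hn, h1⟩
  have := hu n p.2 h1 hp
  subst this
  exact hn

/-- Strong duality produces some plan of cost `J(Ψ)`. The optimal stable plan then has that cost as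
well, so it too lives on the contact set, hence on its stable part. -/
theorem HasStablePlan.solvesExtendedMA (hΔ : IsReflexive Δ) (hh : IsHeight Δ h)
    (hνB : ν (bdB Δ h)ᶜ = 0) (hνmass : ν (bdB Δ h) = muM Δ (bdA Δ)) (hst : HasStablePlan Δ h ν)
    (hΨ : IsKantorovichPotential Δ h ν Ψ) : SolvesExtendedMA Δ h ν (chartSet Δ h Ψ) Ψ := by
  have := isFiniteMeasure_target hΔ hνB hνmass
  obtain ⟨γ, ⟨hγ, hopt⟩, hγst⟩ := hst
  obtain ⟨γ₀, hγ₀, hγ₀c⟩ := hΨ.exists_plan hΔ hh hνB hνmass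
  have hc := hΨ.1.continuous
  have h0 := (hγ₀.cost_sub_dualJ hΔ hh hνB hc).2.2 hγ₀c
  obtain ⟨h1, h2⟩ := hγ.cost_sub_dualJ hΔ hh hνB hc
  have h3 := h2.1 (le_antisymm ((hopt γ₀ hγ₀).trans h0.le) h1)
  have h4 : ∀ᵐ p ∂γ, p ∈ stableContact Δ h Ψ := by
    filter_upwards [h3, measure_eq_zero_iff_ae_notMem.1 hγst] with p hp hp'
    exact ⟨hp, not_not.1 hp'⟩
  refine (solvesExtendedMA_iff hΔ hh hΨ.1).2 ⟨fun τ E _ hE => ?_, fun σ E _ hE => ?_⟩ <;>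
  exact hγ.muM_stableImage hΔ hh hc.continuousOn h4 hE

/-! ### From solutions to plans -/

theorem measurableSet_chartSet (hΔ : IsReflexive Δ) (hh : IsHeight Δ h) (hΨ : IsCConvex Δ h Ψ)
    (σ : Facet Δ) : MeasurableSet (chartSet Δ h Ψ σ) := by
  obtain ⟨O, hO, h1⟩ := exists_isOpen_chartSet hΔ hh hΨ σ
  rw [h1]
  exact hO.measurableSet.inter (measurableSet_bdB hΔ)

/-- The pieces, open facets and charts, may overlap. They are peeled off one at a time, using that
stable images of disjoint sets are almost disjoint. -/
theorem muM_stableImage_of_iUnion (hΔ : IsReflexive Δ) (hh : IsHeight Δ h)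
    (hΨ : ContinuousOn Ψ (bdB Δ h)) {ι : Type*} (P : ι → Set (Vec d))
    (hP : ∀ i, MeasurableSet (P i))
    (hMA : ∀ i, ∀ E ⊆ P i, MeasurableSet E → muM Δ (stableImage Δ h Ψ E) = ν E) (s : Finset ι) :
    ∀ E ⊆ ⋃ i ∈ s, P i, MeasurableSet E → muM Δ (stableImage Δ h Ψ E) = ν E := by
  classical
  induction s using Finset.induction_on with
  | empty =>
    intro E hE _
    have : E = ∅ := by simpa using hE
    subst this
    simp [stableImage]
  | insert i s _ ih =>
    intro E hE hEm
    rw [Finset.set_biUnion_insert] at hE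
    have h1 := hMA i (E ∩ P i) inter_subset_right (hEm.inter (hP i))
    have h2 := ih (E \ P i) (sdiff_subset_iff.2 hE) (hEm.diff (hP i))
    have hdisj : Disjoint (E ∩ P i) (E \ P i) := disjoint_sdiff_inter.symm
    rw [← measure_inter_add_sdiff E (hP i), ← h1, ← h2]
    conv_lhs => rw [← inter_union_sdiff E (P i), stableImage_union]
    exact measure_union₀ (nullMeasurableSet_stableImage hΔ hh hΨ (hEm.diff (hP i)))
      (stableImage_ae_disjoint hΔ hh hΨ hdisj)

/-- Solutions that do not charge the singular set come from transport plans concentrated on the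
stable part of the contact set. -/
theorem SolvesExtendedMA.exists_plan (hΔ : IsReflexive Δ) (hh : IsHeight Δ h)
    (hνB : ν (bdB Δ h)ᶜ = 0) (hνmass : ν (bdB Δ h) = muM Δ (bdA Δ))
    (hΨ : SolvesExtendedMA Δ h ν (chartSet Δ h Ψ) Ψ) (hsing : ν (sing Δ h Ψ) = 0) :
    ∃ γ, IsPlan Δ ν γ ∧ ∀ᵐ p ∂γ, p ∈ stableContact Δ h Ψ := by
  have hνfin := isFiniteMeasure_target hΔ hνB hνmass
  have hμfin := isFiniteMeasure_muM hΔ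
  have hfinA := Facet.finite hΔ
  have hfinB := Facet.finite_dualH hΔ hh
  have := Fintype.ofFinite (Facet Δ)
  have := Fintype.ofFinite (Facet (dualH Δ h))
  have hP := hΨ.mem_P
  have hc := hP.continuous.continuousOn (s := bdB Δ h)
  obtain ⟨hτ, hσ⟩ := (solvesExtendedMA_iff hΔ hh hP).1 hΨ
  let P : Facet (dualH Δ h) ⊕ Facet Δ → Set (Vec d) :=
    Sum.elim (fun τ => τ.relint) (fun σ => chartSet Δ h Ψ σ)
  have hPm : ∀ i, MeasurableSet (P i) := by
    rintro (τ | σ)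
    · exact τ.measurableSet_relint_dualH
    · exact measurableSet_chartSet hΔ hh (hP.isCConvex hΔ hh) σ
  have hMA := muM_stableImage_of_iUnion (ν := ν) hΔ hh hc P hPm (by
    rintro (τ | σ)
    · exact hτ τ
    · exact hσ σ) Finset.univ
  let G : Set (Vec d) := bdB Δ h ∩ ⋃ i ∈ (Finset.univ : Finset _), P i
  have hGm : MeasurableSet G :=
    (measurableSet_bdB hΔ).inter (Finset.measurableSet_biUnion _ fun i _ => hPm i)
  have hGc : ν Gᶜ = 0 := by
    refine measure_mono_null (fun n hn => ?_) (measure_union_null hνB hsing)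
    by_cases hnB : n ∈ bdB Δ h
    · refine Or.inr ⟨⟨hnB, fun h1 => hn ⟨hnB, ?_⟩⟩, fun h1 => hn ⟨hnB, ?_⟩⟩
      · obtain ⟨τ, h2⟩ := mem_iUnion.1 h1
        exact mem_iUnion₂.2 ⟨Sum.inl τ, Finset.mem_univ _, h2⟩
      · obtain ⟨σ, h2⟩ := mem_iUnion.1 h1
        exact mem_iUnion₂.2 ⟨Sum.inr σ, Finset.mem_univ _, h2⟩
    · exact Or.inl hnB
  have hMAG : ∀ E, MeasurableSet E → muM Δ (stableImage Δ h Ψ (E ∩ G)) = ν E := fun E hE => by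
    rw [hMA _ (inter_subset_right.trans inter_subset_right) (hE.inter hGm)]
    exact measure_inter_conull hGc
  -- The stable image of `G` has mass `ν(G)`, which is all of `ν(B)` and hence the total mass of
  -- `μ_M`.
  have hfull : ∀ᵐ m ∂muM Δ, m ∈ stableImage Δ h Ψ G := by
    have h1 : muM Δ (stableImage Δ h Ψ G) = muM Δ univ := by
      have h2 := hMAG univ MeasurableSet.univ
      rw [univ_inter] at h2
      rw [h2, ← muM_bdA hΔ, ← hνmass]
      rw [← measure_add_measure_compl (measurableSet_bdB (h := h) hΔ), hνB, add_zero]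
    exact (ae_iff_measure_eq (p := fun m => m ∈ stableImage Δ h Ψ G)
      (nullMeasurableSet_stableImage hΔ hh hc hGm)).2 h1
  have hex : ∀ m, ∃ n, m ∈ stableImage Δ h Ψ G → n ∈ G ∧ (m, n) ∈ stableContact Δ h Ψ := by
    intro m
    by_cases hm : m ∈ stableImage Δ h Ψ G
    · obtain ⟨n, hn⟩ := hm
      exact ⟨n, fun _ => hn⟩
    · exact ⟨0, fun h => absurd h hm⟩
  choose T hT using hex
  -- By almost sure uniqueness of stable partners, preimages under the arbitrary choice `T` are
  -- stable images up to null sets. This makes `T` almost everywhere measurable without a measurable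
  -- selection theorem; its junk value 0 occurs only on a null set.
  have hpre : ∀ E, MeasurableSet E → T ⁻¹' E =ᵐ[muM Δ] stableImage Δ h Ψ (E ∩ G) := by
    intro E _
    filter_upwards [hfull, ae_stableContact_unique hΔ hh hc] with m hm hu
    obtain ⟨h1, h2⟩ := hT m hm
    refine propext ⟨fun h3 => ⟨T m, ⟨h3, h1⟩, h2⟩, ?_⟩
    rintro ⟨n, hn, h3⟩
    have h4 : T m = n := hu _ _ h2 h3
    show T m ∈ E
    rw [h4]
    exact hn.1
  have hTm : AEMeasurable T (muM Δ) := by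
    refine NullMeasurable.aemeasurable fun E hE => ?_
    exact (nullMeasurableSet_stableImage hΔ hh hc (hE.inter hGm)).congr (hpre E hE).symm
  have hpair : AEMeasurable (fun m => (m, T m)) (muM Δ) := aemeasurable_id.prodMk hTm
  refine ⟨(muM Δ).map fun m => (m, T m), ⟨?_, ?_⟩, ?_⟩
  · rw [AEMeasurable.map_map_of_aemeasurable measurable_fst.aemeasurable hpair]
    exact Measure.map_id
  · rw [AEMeasurable.map_map_of_aemeasurable measurable_snd.aemeasurable hpair]
    ext E hE
    refine (Measure.map_apply_of_aemeasurable hTm hE).trans ?_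
    rw [measure_congr (hpre E hE), hMAG E hE]
  · refine (ae_map_iff hpair (p := fun p => p ∈ stableContact Δ h Ψ)
      (isCompact_stableContact hΔ hh hc).measurableSet).2 ?_
    filter_upwards [hfull] with m hm
    exact (hT m hm).2

/-- A plan on the contact set has cost exactly `J(Ψ)`, which is a lower bound for the cost of every
plan. -/
theorem SolvesExtendedMA.hasStablePlan (hΔ : IsReflexive Δ) (hh : IsHeight Δ h)
    (hνB : ν (bdB Δ h)ᶜ = 0) (hνmass : ν (bdB Δ h) = muM Δ (bdA Δ))
    (hΨ : SolvesExtendedMA Δ h ν (chartSet Δ h Ψ) Ψ) (hsing : ν (sing Δ h Ψ) = 0) :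
    HasStablePlan Δ h ν := by
  have := isFiniteMeasure_target hΔ hνB hνmass
  have hc := hΨ.mem_P.continuous
  obtain ⟨γ, hγ, hst⟩ := hΨ.exists_plan hΔ hh hνB hνmass hsing
  refine ⟨γ, ⟨hγ, fun γ' hγ' => ?_⟩, ?_⟩
  · rw [(hγ.cost_sub_dualJ hΔ hh hνB hc).2.2 (hst.mono fun _ hp => hp.1)]
    exact (hγ'.cost_sub_dualJ hΔ hh hνB hc).1
  · exact measure_eq_zero_iff_ae_notMem.2 (hst.mono fun _ hp => not_not.2 hp.2)

/-! ### Uniqueness -/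

/-- On a convex set, two functions with a common selection of subgradients differ by a constant. -/
theorem sub_eq_sub_of_common_subgradients {S : Set (Vec d)} (hS : Convex ℝ S) {φ φ' : Vec d → ℝ}
    {g : Vec d → Vec d} (hφ : ∀ x ∈ S, ∀ y ∈ S, φ x + (y - x) ⬝ᵥ g x ≤ φ y)
    (hφ' : ∀ x ∈ S, ∀ y ∈ S, φ' x + (y - x) ⬝ᵥ g x ≤ φ' y) {x y : Vec d} (hx : x ∈ S)
    (hy : y ∈ S) : φ y - φ' y = φ x - φ' x := by
  let δ : Vec d → ℝ := fun z => φ z - φ' z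
  -- Cut the segment into `N` equal steps. On each one the increments of `φ` and `φ'` lie between
  -- the same two bounds, given by the subgradients at its ends, so the increments of `δ` are at
  -- most `1/N` times those of `(y - x) ⬝ᵥ g`. The latter telescope to a bound independent of `N`.
  have key : ∀ N : ℕ, 0 < N → N * |δ y - δ x| ≤ (y - x) ⬝ᵥ g y - (y - x) ⬝ᵥ g x := by
    intro N hN
    have hN' : (0 : ℝ) < N := by exact_mod_cast hN
    let p : ℕ → Vec d := fun k => x + ((k : ℝ) / N) • (y - x)
    have hp : ∀ k ≤ N, p k ∈ S := fun k hk => hS.add_smul_sub_mem hx hy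
      ⟨by positivity, div_le_one_of_le₀ (by exact_mod_cast hk) hN'.le⟩
    have hstep : ∀ k, p (k + 1) - p k = (1 / (N : ℝ)) • (y - x) := fun k => by
      simp only [p]
      rw [add_sub_add_left_eq_sub, ← sub_smul]
      congr 1
      push_cast
      ring
    have hstep' : ∀ k, p k - p (k + 1) = -((1 / (N : ℝ)) • (y - x)) := fun k => by
      rw [← hstep, neg_sub]
    have hmain : ∀ k ≤ N, N * |δ (p k) - δ (p 0)| ≤
        (y - x) ⬝ᵥ g (p k) - (y - x) ⬝ᵥ g (p 0) := by
      intro k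
      induction k with
      | zero => simp
      | succ k ih =>
        intro hk
        have h0 := ih (by omega)
        have hk1 := hp k (by omega)
        have hk2 := hp (k + 1) hk
        have a1 := hφ _ hk1 _ hk2
        have a2 := hφ _ hk2 _ hk1
        have a3 := hφ' _ hk1 _ hk2
        have a4 := hφ' _ hk2 _ hk1
        rw [hstep, smul_dotProduct, smul_eq_mul] at a1 a3
        rw [hstep', neg_dotProduct, smul_dotProduct, smul_eq_mul] at a2 a4
        have h1 : |δ (p (k + 1)) - δ (p k)| ≤
            1 / N * ((y - x) ⬝ᵥ g (p (k + 1)) - (y - x) ⬝ᵥ g (p k)) := by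
          rw [abs_le]
          constructor <;> simp only [δ] <;> linarith
        have h2 : N * |δ (p (k + 1)) - δ (p k)| ≤
            (y - x) ⬝ᵥ g (p (k + 1)) - (y - x) ⬝ᵥ g (p k) := by
          refine (mul_le_mul_of_nonneg_left h1 hN'.le).trans_eq ?_
          field_simp
        have h3 := mul_le_mul_of_nonneg_left
          (abs_sub_le (δ (p (k + 1))) (δ (p k)) (δ (p 0))) hN'.le
        linarith
    have hpN : p N = y := by
      simp only [p]
      rw [div_self hN'.ne', one_smul]
      abel
    have hp0 : p 0 = x := by simp [p]
    have := hmain N le_rfl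
    rwa [hpN, hp0] at this
  by_contra hne
  have hpos : 0 < |δ y - δ x| := abs_pos.2 (sub_ne_zero.2 hne)
  obtain ⟨N, hN⟩ := exists_nat_gt (((y - x) ⬝ᵥ g y - (y - x) ⬝ᵥ g x) / |δ y - δ x|)
  have h1 := key (N + 1) N.succ_pos
  rw [div_lt_iff₀ hpos] at hN
  push_cast at h1
  linarith

theorem Facet.convex_carrier (hΔ : IsReflexive Δ) (σ : Facet Δ) : Convex ℝ σ.carrier := by
  intro x hx y hy a b ha hb hab
  rw [σ.mem_carrier_iff hΔ] at hx hy ⊢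
  refine ⟨hΔ.convex hx.1 hy.1 ha hb hab, ?_⟩
  rw [add_dotProduct, smul_dotProduct, smul_dotProduct, hx.2, hy.2, smul_eq_mul, smul_eq_mul,
    mul_one, mul_one, hab]

/-- A continuous function that is constant on the facets is constant on the boundary. -/
theorem eqOn_const_of_facets (hΔ : IsReflexive Δ) (hd : 1 ≤ d) {δ : Vec d → ℝ}
    (hδ : Continuous δ) (hσ : ∀ σ : Facet Δ, ∀ x ∈ σ.carrier, ∀ y ∈ σ.carrier, δ y = δ x) :
    ∀ x ∈ bdA Δ, ∀ y ∈ bdA Δ, δ x = δ y := by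
  have hfin := Facet.finite hΔ
  -- One value per facet: the image is finite, and it is connected in `ℝ`, hence a single point.
  have himg : (δ '' bdA Δ).Finite := by
    refine (Set.finite_range fun σ : Facet Δ => δ σ.nonempty.some).subset ?_
    rintro _ ⟨m, hm, rfl⟩
    obtain ⟨σ, hm'⟩ := hΔ.exists_facet_mem hm
    exact ⟨σ, hσ σ m hm' _ σ.nonempty.some_mem⟩
  have hconn : IsPreconnected (δ '' bdA Δ) :=
    (hΔ.isPreconnected_bdA hd).image δ hδ.continuousOn
  have hle : ∀ x ∈ bdA Δ, ∀ y ∈ bdA Δ, δ x ≤ δ y := fun x hx y hy => by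
    by_contra! hlt
    exact Set.Icc_infinite hlt
      (himg.subset (hconn.Icc_subset (mem_image_of_mem δ hy) (mem_image_of_mem δ hx)))
  exact fun x hx y hy => le_antisymm (hle x hx y hy) (hle y hy x hx)

/-- A plan concentrated on a compact subset of `A × B` has full support on `A`. -/
theorem IsPlan.exists_mem_of_isCompact (hΔ : IsReflexive Δ) {γ : Measure (Vec d × Vec d)}
    (hγ : IsPlan Δ ν γ) {K : Set (Vec d × Vec d)} (hK : IsCompact K) (hγK : ∀ᵐ p ∂γ, p ∈ K)
    {m : Vec d} (hm : m ∈ bdA Δ) : ∃ n, (m, n) ∈ K := by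
  have hcl : IsClosed (Prod.fst '' K) := (hK.image continuous_fst).isClosed
  have h0 : muM Δ (Prod.fst '' K)ᶜ = 0 := by
    rw [← hγ.1, Measure.map_apply measurable_fst hcl.measurableSet.compl]
    exact measure_eq_zero_iff_ae_notMem.2 (hγK.mono fun p hp hp' => hp' ⟨p, hp, rfl⟩)
  by_contra! hcon
  have hmem : m ∈ (Prod.fst '' K)ᶜ := by
    rintro ⟨⟨m', n⟩, hp, rfl⟩
    exact hcon n hp
  exact (muM_pos hΔ hm (hcl.isOpen_compl.mem_nhds hmem)).ne' h0

theorem cTransB_subgradient (hΔ : IsReflexive Δ) (hΨ : ContinuousOn Ψ (bdB Δ h)) {m n : Vec d}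
    (hmn : (m, n) ∈ contact Δ h Ψ) (m' : Vec d) :
    cTransB Δ h Ψ m + (m' - m) ⬝ᵥ n ≤ cTransB Δ h Ψ m' := by
  have h1 := le_cTransB hΔ hΨ m' hmn.2.1
  have h2 : cTransB Δ h Ψ m + Ψ n = m ⬝ᵥ n := hmn.2.2
  rw [sub_dotProduct]
  linarith

/-- Functions whose contact sets support a common plan differ by a constant. -/
theorem IsPlan.cTransB_sub_const (hd : 1 ≤ d) (hΔ : IsReflexive Δ) (hh : IsHeight Δ h)
    {γ : Measure (Vec d × Vec d)} (hγ : IsPlan Δ ν γ) (hΨ : ContinuousOn Ψ (bdB Δ h))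
    (hΨ' : ContinuousOn Ψ' (bdB Δ h)) (hc : ∀ᵐ p ∂γ, p ∈ contact Δ h Ψ)
    (hc' : ∀ᵐ p ∂γ, p ∈ contact Δ h Ψ') :
    ∃ c : ℝ, ∀ m ∈ bdA Δ, cTransB Δ h Ψ m = cTransB Δ h Ψ' m + c := by
  have hK := (isCompact_contact hΔ hh hΨ).inter (isCompact_contact hΔ hh hΨ')
  -- Compactness of the intersection of the two contact sets and full support of `μ_M` give a common
  -- partner at every point of `A`, not just almost every one.
  have hex : ∀ m, ∃ n, m ∈ bdA Δ → (m, n) ∈ contact Δ h Ψ ∩ contact Δ h Ψ' := by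
    intro m
    by_cases hm : m ∈ bdA Δ
    · obtain ⟨n, hn⟩ := hγ.exists_mem_of_isCompact hΔ hK
        (by filter_upwards [hc, hc'] with p h1 h2 using ⟨h1, h2⟩) hm
      exact ⟨n, fun _ => hn⟩
    · exact ⟨0, fun h => absurd h hm⟩
  choose g hg using hex
  obtain ⟨m₀, hm₀⟩ := bdA_nonempty hΔ
  refine ⟨cTransB Δ h Ψ m₀ - cTransB Δ h Ψ' m₀, fun m hm => ?_⟩
  have := eqOn_const_of_facets hΔ hd
    (δ := fun m => cTransB Δ h Ψ m - cTransB Δ h Ψ' m)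
    ((continuous_cTransB hΔ hh hΨ).sub (continuous_cTransB hΔ hh hΨ'))
    (fun σ x hx y hy => sub_eq_sub_of_common_subgradients (σ.convex_carrier hΔ) (g := g)
      (fun z hz w _ => cTransB_subgradient hΔ hΨ (hg z (σ.carrier_subset_bdA hΔ hz)).1 w)
      (fun z hz w _ => cTransB_subgradient hΔ hΨ' (hg z (σ.carrier_subset_bdA hΔ hz)).2 w) hx hy)
    m hm m₀ hm₀
  linarith

/-- Both functions are recovered as transforms of their transforms, and a second transform reverses
the sign of the constant. -/
theorem IsCConvex.eq_of_cTransB (hΔ : IsReflexive Δ) (hh : IsHeight Δ h) (hΨ : IsCConvex Δ h Ψ)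
    (hΨ' : IsCConvex Δ h Ψ') {c : ℝ}
    (hc : ∀ m ∈ bdA Δ, cTransB Δ h Ψ m = cTransB Δ h Ψ' m + c) :
    ∀ n ∈ bdB Δ h, Ψ n = Ψ' n - c := by
  intro n hn
  have h1 := (continuous_cTransB hΔ hh hΨ.1).continuousOn (s := bdA Δ)
  have h2 := (continuous_cTransB hΔ hh hΨ'.1).continuousOn (s := bdA Δ)
  rw [← hΨ.2 n hn, ← hΨ'.2 n hn]
  refine le_antisymm (cTransA_le hΔ fun m hm => ?_) ?_
  · have := le_cTransA hΔ h2 n hm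
    have := hc m hm
    linarith
  · rw [sub_le_iff_le_add]
    refine cTransA_le hΔ fun m hm => ?_
    have := le_cTransA hΔ h1 n hm
    have := hc m hm
    linarith

theorem sing_eq_of_contact_eq (hΔ : IsReflexive Δ) (hh : IsHeight Δ h) (hΨ : IsCConvex Δ h Ψ)
    (hΨ' : IsCConvex Δ h Ψ') (hc : contact Δ h Ψ = contact Δ h Ψ') :
    sing Δ h Ψ = sing Δ h Ψ' := by
  have : chartSet Δ h Ψ = chartSet Δ h Ψ' := by
    funext σ
    ext n
    rw [mem_chartSet_iff hΔ hh hΨ, mem_chartSet_iff hΔ hh hΨ', hc]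
  unfold sing
  rw [this]

theorem SolvesExtendedMA.unique (hd : 1 ≤ d) (hΔ : IsReflexive Δ) (hh : IsHeight Δ h)
    (hνB : ν (bdB Δ h)ᶜ = 0) (hνmass : ν (bdB Δ h) = muM Δ (bdA Δ))
    (hΨ : SolvesExtendedMA Δ h ν (chartSet Δ h Ψ) Ψ) (hs : ν (sing Δ h Ψ) = 0)
    (hΨ' : SolvesExtendedMA Δ h ν (chartSet Δ h Ψ') Ψ') (hs' : ν (sing Δ h Ψ') = 0) :
    sing Δ h Ψ = sing Δ h Ψ' ∧ ∃ c : ℝ, ∀ n ∈ bdB Δ h, Ψ n - Ψ' n = c := by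
  have := isFiniteMeasure_target hΔ hνB hνmass
  have hc := hΨ.mem_P.continuous
  have hc' := hΨ'.mem_P.continuous
  have hC := hΨ.mem_P.isCConvex hΔ hh
  have hC' := hΨ'.mem_P.isCConvex hΔ hh
  obtain ⟨γ, hγ, hst⟩ := hΨ.exists_plan hΔ hh hνB hνmass hs
  obtain ⟨γ', hγ', hst'⟩ := hΨ'.exists_plan hΔ hh hνB hνmass hs'
  have hγc : ∀ᵐ p ∂γ, p ∈ contact Δ h Ψ := hst.mono fun _ hp => hp.1
  have e1 := (hγ.cost_sub_dualJ hΔ hh hνB hc).2.2 hγc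
  have e2 := (hγ'.cost_sub_dualJ hΔ hh hνB hc').2.2 (hst'.mono fun _ hp => hp.1)
  obtain ⟨e3, e4⟩ := hγ.cost_sub_dualJ hΔ hh hνB hc'
  have e5 := (hγ'.cost_sub_dualJ hΔ hh hνB hc).1
  -- The plan `γ` costs `J(Ψ)` and `γ'` costs `J(Ψ')`. Weak duality of each plan with the other
  -- potential makes all these values equal, so `γ` has no gap with respect to `Ψ'`.
  have hγc' : ∀ᵐ p ∂γ, p ∈ contact Δ h Ψ' := e4.1 (le_antisymm (by linarith) e3)
  obtain ⟨c, hcst⟩ := hγ.cTransB_sub_const hd hΔ hh hc.continuousOn hc'.continuousOn hγc hγc'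
  have hsub := hC.eq_of_cTransB hΔ hh hC' hcst
  refine ⟨sing_eq_of_contact_eq hΔ hh hC hC' ?_, -c, fun n hn => by rw [hsub n hn]; ring⟩
  ext ⟨m, n⟩
  refine and_congr_right fun hm => and_congr_right fun hn => ?_
  show cTransB Δ h Ψ m + Ψ n = m ⬝ᵥ n ↔ cTransB Δ h Ψ' m + Ψ' n = m ⬝ᵥ n
  rw [hcst m hm, hsub n hn]
  constructor <;> intro h1 <;> linarith

end

end ReflexiveMA

theorem mainTheorem3 (d : ℕ) (hd : 1 ≤ d)
    (Δ : Set (Fin (d + 1) → ℝ)) (hΔ : IsReflexive Δ)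
    (h : (Fin (d + 1) → ℤ) → ℤ) (hh : IsHeight Δ h)
    (ν : MeasureTheory.Measure (Fin (d + 1) → ℝ))
    (hνB : ν (bdB Δ h)ᶜ = 0) (hνmass : ν (bdB Δ h) = muM Δ (bdA Δ)) :
    (∀ Ψ, InP Δ Ψ → IsChartCollection Δ h (chartSet Δ h Ψ)) ∧
    (HasStablePlan Δ h ν →
      (∃ Ψ, IsKantorovichPotential Δ h ν Ψ) ∧
      ∀ Ψ, IsKantorovichPotential Δ h ν Ψ → SolvesExtendedMA Δ h ν (chartSet Δ h Ψ) Ψ) ∧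
    (∀ Ψ, SolvesExtendedMA Δ h ν (chartSet Δ h Ψ) Ψ → ν (sing Δ h Ψ) = 0 →
      HasStablePlan Δ h ν) ∧
    (∀ Ψ Ψ', SolvesExtendedMA Δ h ν (chartSet Δ h Ψ) Ψ → ν (sing Δ h Ψ) = 0 →
      SolvesExtendedMA Δ h ν (chartSet Δ h Ψ') Ψ' → ν (sing Δ h Ψ') = 0 →
      sing Δ h Ψ = sing Δ h Ψ' ∧ ∃ c : ℝ, ∀ n ∈ bdB Δ h, Ψ n - Ψ' n = c) := by
  have := isFiniteMeasure_target hΔ hνB hνmass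
  refine ⟨fun Ψ hΨ => isChartCollection_chartSet hΔ hh (hΨ.isCConvex hΔ hh),
    fun hst => ⟨exists_kantorovichPotential hΔ hh hνmass,
      fun Ψ hΨ => hst.solvesExtendedMA hΔ hh hνB hνmass hΨ⟩,
    fun Ψ hΨ hs => hΨ.hasStablePlan hΔ hh hνB hνmass hs,
    fun Ψ Ψ' hΨ hs hΨ' hs' => hΨ.unique hd hΔ hh hνB hνmass hs hΨ' hs'⟩
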